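/- Let $T>0$, $\mu\in\mathbb R$, $0<\alpha_2<\alpha_1<1$ and $\beta_1,\beta_2\in[0,1]$. For $a>0$ put $I^a f(t)=\frac1{\Gamma(a)}\int_0^t(t-z)^{a-1}f(z)\,dz$, $I^0f=f$, and let $D^{\alpha,\beta}f=I^{\beta(1-\alpha)}\frac{d}{dt}I^{(1-\beta)(1-\alpha)}f$ be the Hilfer derivative of order $\alpha\in(0,1)$ and type $\beta$. For functions $v$ on $(0,T]\times[0,1]$ write $v\in C_{-1}$ if $v(t,x)=t^pf(t,x)$ for some $p>-1$ and some $f$ continuous on $[0,T]\times[0,1]$, and $v\in C^1_{-1}$ if $\partial_tv$ exists on $(0,T]\times[0,1]$ and belongs to $C_{-1}$. Consider the problem of finding a pair $(u,g)$ with $u\in C_{-1}$, $I^{(1-\beta_1)(1-\alpha_1)}u\in C_{-1}^1$ (fractional integrals and derivatives act in $t$), $u_{xx}$ continuous in $(0,T)\times(0,1)$, $g\in C[0,1]$, such that $D^{\alpha_2,\beta_2}u$ exists in $(0,T)\times(0,1)$ and $$D^{\alpha_1,\beta_1}u(t,x)+\mu D^{\alpha_2,\beta_2}u(t,x)-u_{xx}(t,x)=g(x),\qquad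 0<t<T,\ 0<x<1,$$ $$u(t,0)=u(t,1)=0\ (0\le t\le T),\qquad \lim_{t\to+0}I^{(1-\beta_i)(1-\alpha_i)}u(t,x)=0\ (0\le x\le1,\ i=1,2),\qquad u(T,x)=\varphi(x)\ (0\le x\le1).$$ Let $$E_{(\alpha_1-\alpha_2,\alpha_1),\rho}(x,y)=\sum_{n=0}^\infty\sum_{i=0}^n\binom ni\frac{x^iy^{n-i}}{\Gamma(\rho+\alpha_1n-\alpha_2i)},\qquad G_k(t)=t^{\alpha_1}E_{(\alpha_1-\alpha_2,\alpha_1),\alpha_1+1}\bigl(-\mu t^{\alpha_1-\alpha_2},-(k\pi)^2t^{\alpha_1}\bigr),$$ and $\varphi_k=2\int_0^1\varphi(x)\sin(k\pi x)\,dx$. Assume that $G_k(T)\ne0$ for every $k=1,2,\dots$, and that $\varphi\in C^2[0,1]$, $\varphi'''\in L_2(0,1)$ (i.e. $\varphi''$ is absolutely continuous with derivative in $L_2(0,1)$), $\varphi(0)=\varphi(1)=\varphi''(0)=\varphi''(1)=0$. Then the problem has a solution $(u,g)$, it is unique ($u$ on $(0,T]\times[0,1]$, $g$ on $[0,1]$),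 and it is given by the convergent series $$u(t,x)=\sum_{k=1}^\infty\frac{G_k(t)}{G_k(T)}\,\varphi_k\sin k\pi x,\qquad g(x)=\sum_{k=1}^\infty\frac{1}{G_k(T)}\,\varphi_k\sin k\pi x .$$ -/

import Mathlib

open MeasureTheory Set Filter Topology

noncomputable section

/-- Riemann–Liouville fractional integral `I_{0t}^a f (t)` of order `a ≥ 0`, with `I^0 f = f`. -/
def rlInt (a : ℝ) (f : ℝ → ℝ) (t : ℝ) : ℝ :=
  if a = 0 then f t
  else 1 / Real.Gamma a * ∫ z in (0 : ℝ)..t, (t - z) ^ (a - 1) * f z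

/-- Hilfer derivative of order `0 < α ≤ 1` (so that the integer `n` with `n - 1 < α ≤ n` is `1`)
and type `β`:  `I^{β(1-α)} (d/dt) I^{(1-β)(1-α)} f`. -/
def hilferDeriv (α β : ℝ) (f : ℝ → ℝ) (t : ℝ) : ℝ :=
  rlInt (β * (1 - α)) (deriv (rlInt ((1 - β) * (1 - α)) f)) t

/-- The Hilfer derivative of `f` is meaningful on `(0, T)`: the inner fractional integral is
differentiable there, its derivative is integrable up to `0`, and the outer fractional integral
of that derivative converges (nothing to ask when its order is `0`). -/
def HilferExists (α β T : ℝ) (f : ℝ → ℝ) : Prop :=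
  ∀ t ∈ Ioo 0 T,
    DifferentiableAt ℝ (rlInt ((1 - β) * (1 - α)) f) t ∧
    IntervalIntegrable (deriv (rlInt ((1 - β) * (1 - α)) f)) volume 0 t ∧
    (β * (1 - α) = 0 ∨
      IntervalIntegrable
        (fun z => (t - z) ^ (β * (1 - α) - 1) * deriv (rlInt ((1 - β) * (1 - α)) f) z)
        volume 0 t)

/-- `v ∈ C_{-1}[0,T]` in `t`, with values in `C[0,1]` in `x`: `v(t,x) = t^p f(t,x)` for
`0 < t ≤ T`, `0 ≤ x ≤ 1`, with some `p > -1` and `f` continuous on `[0,T] × [0,1]`. -/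
def MemCNegOne (T : ℝ) (v : ℝ → ℝ → ℝ) : Prop :=
  ∃ p : ℝ, -1 < p ∧ ∃ f : ℝ → ℝ → ℝ,
    ContinuousOn (fun q : ℝ × ℝ => f q.1 q.2) (Icc 0 T ×ˢ Icc 0 1) ∧
    ∀ t ∈ Ioc 0 T, ∀ x ∈ Icc (0 : ℝ) 1, v t x = t ^ p * f t x

/-- `v ∈ C_{-1}^1[0,T]` in `t`, with values in `C[0,1]` in `x`: the derivative `∂v/∂t` exists for
`0 < t ≤ T` (one-sided at `t = T`) and belongs to `C_{-1}[0,T]`. -/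
def MemCNegOneOne (T : ℝ) (v : ℝ → ℝ → ℝ) : Prop :=
  ∃ w : ℝ → ℝ → ℝ, MemCNegOne T w ∧
    ∀ t ∈ Ioc 0 T, ∀ x ∈ Icc (0 : ℝ) 1,
      HasDerivWithinAt (fun s => v s x) (w t x) (Ioc 0 T) t

/-- `(u, g)` solves the inverse source problem with final data `φ`. The arguments of `u` are
`t` and then `x`. -/
structure IsInverseSolution (α₁ α₂ β₁ β₂ μ T : ℝ) (φ : ℝ → ℝ)
    (u : ℝ → ℝ → ℝ) (g : ℝ → ℝ) : Prop where
  /-- regularity: `u ∈ C_{-1}[0,T]` in time, `C[0,1]` in space -/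
  u_mem : MemCNegOne T u
  /-- regularity: `I^{(1-β₁)(1-α₁)} u ∈ C_{-1}^1[0,T]` -/
  int_mem : MemCNegOneOne T (fun t x => rlInt ((1 - β₁) * (1 - α₁)) (fun s => u s x) t)
  /-- regularity: `u(t,·)` is of class `C²` on `(0,1)` -/
  u_contDiff : ∀ t ∈ Ioo 0 T, ContDiffOn ℝ 2 (u t) (Ioo 0 1)
  /-- regularity: `u_xx` is continuous in the open rectangle -/
  uxx_cont : ContinuousOn (fun q : ℝ × ℝ => deriv (deriv (u q.1)) q.2) (Ioo 0 T ×ˢ Ioo 0 1)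
  /-- regularity of the source -/
  g_cont : ContinuousOn g (Icc 0 1)
  /-- the Hilfer derivative of order `α₂` in the equation exists -/
  hilfer₂ : ∀ x ∈ Ioo (0 : ℝ) 1, HilferExists α₂ β₂ T (fun s => u s x)
  /-- the equation -/
  eqn : ∀ t ∈ Ioo 0 T, ∀ x ∈ Ioo (0 : ℝ) 1,
    hilferDeriv α₁ β₁ (fun s => u s x) t + μ * hilferDeriv α₂ β₂ (fun s => u s x) t
      - deriv (deriv (u t)) x = g x
  /-- boundary conditions -/
  bdry : ∀ t ∈ Icc 0 T, u t 0 = 0 ∧ u t 1 = 0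
  /-- initial condition for `i = 1` -/
  init₁ : ∀ x ∈ Icc (0 : ℝ) 1,
    Tendsto (rlInt ((1 - β₁) * (1 - α₁)) (fun s => u s x)) (𝓝[>] 0) (𝓝 0)
  /-- initial condition for `i = 2` -/
  init₂ : ∀ x ∈ Icc (0 : ℝ) 1,
    Tendsto (rlInt ((1 - β₂) * (1 - α₂)) (fun s => u s x)) (𝓝[>] 0) (𝓝 0)
  /-- over-determining condition -/
  final : ∀ x ∈ Icc (0 : ℝ) 1, u T x = φ x

/-- The bivariate Mittag-Leffler function `E_{(α-β,α),ρ}(x,y)`. -/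
def mittagLeffler₂ (α β ρ x y : ℝ) : ℝ :=
  ∑' n : ℕ, ∑ i ∈ Finset.range (n + 1),
    (n.choose i : ℝ) * (x ^ i * y ^ (n - i)) / Real.Gamma (ρ + α * n - β * i)

/-- `t^{α₁} E_{(α₁-α₂,α₁),α₁+1}(-μ t^{α₁-α₂}, -(kπ)² t^{α₁})`. -/
def modeFun (α₁ α₂ μ : ℝ) (k : ℕ) (t : ℝ) : ℝ :=
  t ^ α₁ * mittagLeffler₂ α₁ α₂ (α₁ + 1) (-μ * t ^ (α₁ - α₂)) (-(k * Real.pi) ^ 2 * t ^ α₁)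

/-- Sine coefficient `φ_k = 2 ∫₀¹ φ(x) sin(kπx) dx`. -/
def sineCoeff (φ : ℝ → ℝ) (k : ℕ) : ℝ :=
  2 * ∫ x in (0 : ℝ)..1, φ x * Real.sin (k * Real.pi * x)

/-- `φ ∈ C²[0,1]`, `φ''' ∈ L²(0,1)` (that is, `φ''` is the integral of an `L²` function), and
`φ(0) = φ(1) = φ''(0) = φ''(1) = 0`. -/
structure IsAdmissibleData (φ : ℝ → ℝ) : Prop where
  contDiff : ContDiffOn ℝ 2 φ (Icc 0 1)
  third : ∃ ψ : ℝ → ℝ, MemLp ψ 2 (volume.restrict (Ioo 0 1)) ∧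
    ∀ x ∈ Icc (0 : ℝ) 1, iteratedDerivWithin 2 φ (Icc 0 1) x =
      iteratedDerivWithin 2 φ (Icc 0 1) 0 + ∫ y in (0 : ℝ)..x, ψ y
  zero_left : φ 0 = 0
  zero_right : φ 1 = 0
  second_left : iteratedDerivWithin 2 φ (Icc 0 1) 0 = 0
  second_right : iteratedDerivWithin 2 φ (Icc 0 1) 1 = 0

end

/-!
Write `F_ρ = F_ρ(λ, ·)` for the solution of the Volterra equation
`f + μ I^{α₁-α₂} f + λ I^{α₁} f = t ^ (ρ - 1) / Γ(ρ)`. Expanding its Neumann series binomially gives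
`G_k = F_{1+α₁}((kπ)², ·)` (`modeFun_eq_resolventFun`). Since `I^γ F_ρ = F_{ρ+γ}`, every Hilfer
derivative of order `α` maps `F_{1+α₁}` to `F_{1+α₁-α}`, whatever its type, and the equation for one
mode is the Volterra equation with `ρ = 1`. What remains is to sum over `k` and to prove uniqueness.

Summation. The sine coefficients of `φ` satisfy `∑ (kπ)² |φ_k| < ∞` (integration by parts and
Bessel's inequality for the third derivative). Hence the amplitudes `φ_k / G_k(T)` are absolutely
summable as soon as `(kπ)² |G_k(T)|` is bounded away from `0`, and the series may be differentiated
termwise if in addition `λ F_{1+α₁}` and `t ^ (1 - α₁) F_{α₁}` are bounded on `(0, T]` uniformly in `λ ≥ 0`. The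
sign of `μ` is arbitrary, so the family `F_ρ` is not known to be positive or monotone. Both facts are
instead derived from an extremum principle (`extremum_principle`): the kernel of
`D^{α₁} + μ D^{α₂}` is, up to bounded perturbations, dominated by its `α₁`-part, so at a
nonnegative maximum of `f` the value of this operator is at least `-C max |f|`. This error is absorbed by
`λ f` for large `λ`, while for bounded `λ` the Neumann series suffices. This gives `exists_uniform_bound`, and
comparison of `F_{1+α₁}` with `t / (λ T)` gives `exists_lower_bound`. The finitely many `k` not
covered by the lower bound are those for which `G_k(T) ≠ 0` has to be assumed.

Uniqueness. For any solution `v`, the density `q = D^{α₁,β₁} v` satisfies `v = I^{α₁} q` and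
`q + μ I^{α₁-α₂} q - v_xx = h` (`IsInverseSolution.exists_density`). Green's formula turns this into
a scalar Volterra equation for the sine coefficients of `q`, with the constant right-hand side `h_k`.
Its only solution is `h_k F_1`, so that `v_k = h_k G_k` (`IsInverseSolution.sineCoeff_eq`). The final
condition determines `h_k`; the resulting coefficients of `v(t, ·)` are absolutely summable, and `v`
is the sum of its sine series (`hasSum_sineSeries`). Finally `h` is read off the equation.
-/

/-! ### Power kernels and the beta integral -/

section

/-- The Riemann–Liouville kernel `t ^ (s - 1) / Γ(s)`. These kernels form a convolution semigroup
in `s`: the fractional integral of order `γ` turns the kernel of index `s` into that of index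
`s + γ`. -/
noncomputable def rlKer (s t : ℝ) : ℝ := t ^ (s - 1) / Real.Gamma s

lemma integral_beta_scaled {γ s t : ℝ} (hγ : 0 < γ) (hs : 0 < s) (ht : 0 < t) :
    ∫ z in (0 : ℝ)..t, (t - z) ^ (γ - 1) * z ^ (s - 1) =
      t ^ (s + γ - 1) * (Real.Gamma s * Real.Gamma γ / Real.Gamma (s + γ)) := by
  have h := Complex.betaIntegral_scaled (s : ℂ) (γ : ℂ) ht
  rw [Complex.betaIntegral_eq_Gamma_mul_div _ _ (by simpa) (by simpa), ← Complex.ofReal_add,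
    Complex.Gamma_ofReal, Complex.Gamma_ofReal, Complex.Gamma_ofReal] at h
  have h1 : ∫ x in (0 : ℝ)..t, (x : ℂ) ^ ((s : ℂ) - 1) * ((t : ℂ) - x) ^ ((γ : ℂ) - 1) =
      ((∫ z in (0 : ℝ)..t, (t - z) ^ (γ - 1) * z ^ (s - 1) : ℝ) : ℂ) := by
    rw [← intervalIntegral.integral_ofReal]
    refine intervalIntegral.integral_congr fun z hz => ?_
    rw [uIcc_of_le ht.le] at hz
    have e1 : (0 : ℝ) ≤ t - z := by linarith [hz.2]
    rw [Complex.ofReal_mul, Complex.ofReal_cpow e1, Complex.ofReal_cpow hz.1]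
    push_cast
    ring
  rw [h1] at h
  have h2 : (t : ℂ) ^ (((s + γ : ℝ) : ℂ) - 1) = ((t ^ (s + γ - 1) : ℝ) : ℂ) := by
    rw [Complex.ofReal_cpow ht.le]
    push_cast
    rfl
  rw [h2] at h
  exact_mod_cast h

lemma intervalIntegrable_beta {γ s t : ℝ} (hγ : 0 < γ) (hs : 0 < s) (ht : 0 < t) :
    IntervalIntegrable (fun z => (t - z) ^ (γ - 1) * z ^ (s - 1)) volume 0 t := by
  apply intervalIntegral.intervalIntegrable_of_integral_ne_zero
  rw [integral_beta_scaled hγ hs ht]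
  have := Real.Gamma_pos_of_pos hγ
  have := Real.Gamma_pos_of_pos hs
  have := Real.Gamma_pos_of_pos (add_pos hs hγ)
  positivity

lemma rlInt_of_pos {γ : ℝ} (hγ : 0 < γ) (f : ℝ → ℝ) (t : ℝ) :
    rlInt γ f t = 1 / Real.Gamma γ * ∫ z in (0 : ℝ)..t, (t - z) ^ (γ - 1) * f z := by
  simp [rlInt, hγ.ne']

lemma rlInt_zero (f : ℝ → ℝ) : rlInt 0 f = f := by
  funext t; simp [rlInt]

lemma rlInt_one (f : ℝ → ℝ) (t : ℝ) : rlInt 1 f t = ∫ z in (0 : ℝ)..t, f z := by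
  simp [rlInt]

/-- The fractional integral at `t` only sees the values on `(0, t]`. -/
lemma rlInt_congr {γ t : ℝ} (ht : 0 < t) {f g : ℝ → ℝ} (h : ∀ z ∈ Ioc 0 t, f z = g z) :
    rlInt γ f t = rlInt γ g t := by
  unfold rlInt
  split_ifs with h0
  · exact h t ⟨ht, le_rfl⟩
  · congr 1
    apply intervalIntegral.integral_congr_ae
    rw [uIoc_of_le ht.le]
    exact Eventually.of_forall fun z hz => by rw [h z hz]

/-- For a positive order the fractional integral at `t` only sees the values on `(0, t)`. -/
lemma rlInt_congr_Ioo {γ t : ℝ} (ht : 0 < t) (hγ : γ ≠ 0) {f g : ℝ → ℝ}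
    (h : ∀ z ∈ Ioo 0 t, f z = g z) : rlInt γ f t = rlInt γ g t := by
  unfold rlInt
  simp only [hγ, if_false]
  congr 1
  rw [intervalIntegral.integral_of_le ht.le, intervalIntegral.integral_of_le ht.le,
    integral_Ioc_eq_integral_Ioo, integral_Ioc_eq_integral_Ioo]
  exact setIntegral_congr_fun measurableSet_Ioo fun z hz => by simp only [h z hz]

lemma rlInt_rlKer {γ s t : ℝ} (hγ : 0 < γ) (hs : 0 < s) (ht : 0 < t) :
    rlInt γ (rlKer s) t = rlKer (s + γ) t := by
  have h1 := (Real.Gamma_pos_of_pos hγ).ne'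
  have h2 := (Real.Gamma_pos_of_pos hs).ne'
  have h3 := (Real.Gamma_pos_of_pos (add_pos hs hγ)).ne'
  have : ∀ z : ℝ, (t - z) ^ (γ - 1) * rlKer s z =
      (1 / Real.Gamma s) * ((t - z) ^ (γ - 1) * z ^ (s - 1)) := fun z => by
    unfold rlKer; ring
  rw [rlInt_of_pos hγ]
  simp_rw [this]
  rw [intervalIntegral.integral_const_mul, integral_beta_scaled hγ hs ht]
  unfold rlKer
  field_simp

lemma rlKer_nonneg {s t : ℝ} (hs : 0 < s) (ht : 0 ≤ t) : 0 ≤ rlKer s t :=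
  div_nonneg (Real.rpow_nonneg ht _) (Real.Gamma_pos_of_pos hs).le

lemma rlKer_one (t : ℝ) : rlKer 1 t = 1 := by simp [rlKer]

lemma continuousOn_rlKer (s : ℝ) : ContinuousOn (rlKer s) (Ioi 0) := by
  unfold rlKer
  exact (continuousOn_id.rpow_const fun x hx => Or.inl (ne_of_gt hx)).div_const _

/-- Faster than exponential growth of `Γ`: `1 / Γ(s)` is at most `K B ^ (-s)` for any `B`. -/
lemma exists_inv_Gamma_le {B : ℝ} (hB : 0 < B) :
    ∃ K, 0 < K ∧ ∀ s, 0 < s → 1 / Real.Gamma s ≤ K * B ^ (-s) := by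
  set A := Real.exp 1 * B with hA
  have hApos : 0 < A := by positivity
  refine ⟨Real.exp A, Real.exp_pos _, fun s hs => ?_⟩
  have hG := Real.Gamma_pos_of_pos hs
  have key : A ^ s * Real.exp (-A) ≤ Real.Gamma (s + 1) := by
    rw [Real.Gamma_eq_integral (by linarith)]
    have hint := Real.GammaIntegral_convergent (show 0 < s + 1 by linarith)
    have h1 : ∫ x in Ioi A, Real.exp (-x) * A ^ s = A ^ s * Real.exp (-A) := by
      rw [integral_mul_const, integral_exp_neg_Ioi]; ring
    rw [← h1]
    calc ∫ x in Ioi A, Real.exp (-x) * A ^ s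
        ≤ ∫ x in Ioi A, Real.exp (-x) * x ^ (s + 1 - 1) := by
          apply setIntegral_mono_on
          · exact (integrableOn_exp_neg_Ioi A).mul_const _
          · exact hint.mono_set (Ioi_subset_Ioi hApos.le)
          · exact measurableSet_Ioi
          · intro x hx
            have : A ^ s ≤ x ^ s := Real.rpow_le_rpow hApos.le (le_of_lt hx) hs.le
            rw [add_sub_cancel_right]
            gcongr
      _ ≤ _ := by
          apply setIntegral_mono_set hint
          · filter_upwards [ae_restrict_mem measurableSet_Ioi] with x hx
            have : (0 : ℝ) < x := hx
            simp only [Pi.zero_apply]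
            positivity
          · exact (Ioi_subset_Ioi hApos.le).eventuallyLE
  rw [Real.Gamma_add_one hs.ne'] at key
  have hs' : s ≤ Real.exp s := by linarith [Real.add_one_le_exp s]
  have hAs : A ^ s = Real.exp s * B ^ s := by
    rw [hA, Real.mul_rpow (by positivity) hB.le, ← Real.exp_mul, one_mul]
  rw [Real.rpow_neg hB.le, div_le_iff₀ hG]
  have hBs : 0 < B ^ s := by positivity
  have h3 : A ^ s * Real.exp (-A) ≤ Real.exp s * Real.Gamma s :=
    key.trans (by gcongr)
  rw [hAs, mul_assoc] at h3
  have h4 := le_of_mul_le_mul_left h3 (Real.exp_pos s)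
  rw [Real.exp_neg] at h4
  have hE := Real.exp_pos A
  field_simp
  rw [← div_eq_mul_inv, div_le_iff₀ hE] at h4
  linarith

/-! ### Functions with an integrable power singularity at the origin -/

/-- `f` is continuous on `(0, T] × [0, 1]` and bounded there by `C t ^ (s - 1)`. -/
def PowerBdd (T s C : ℝ) (f : ℝ → ℝ → ℝ) : Prop :=
  ContinuousOn (fun q : ℝ × ℝ => f q.1 q.2) (Ioc 0 T ×ˢ Icc 0 1) ∧
    ∀ t ∈ Ioc 0 T, ∀ x ∈ Icc (0 : ℝ) 1, |f t x| ≤ C * t ^ (s - 1)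

/-- The bound `PowerBdd` for functions of time alone. -/
def PowerBdd₁ (T s C : ℝ) (f : ℝ → ℝ) : Prop :=
  ContinuousOn f (Ioc 0 T) ∧ ∀ t ∈ Ioc 0 T, |f t| ≤ C * t ^ (s - 1)

variable {T s C γ : ℝ}

lemma PowerBdd.slice {f : ℝ → ℝ → ℝ} (hf : PowerBdd T s C f) {x : ℝ} (hx : x ∈ Icc (0 : ℝ) 1) :
    PowerBdd₁ T s C (fun t => f t x) := by
  refine ⟨?_, fun t ht => hf.2 t ht x hx⟩
  exact hf.1.comp (f := fun t : ℝ => (t, x)) (by fun_prop) fun t ht => ⟨ht, hx⟩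

lemma PowerBdd₁.const {f : ℝ → ℝ} (hf : PowerBdd₁ T s C f) : PowerBdd T s C (fun t _ => f t) :=
  ⟨hf.1.comp (f := fun q : ℝ × ℝ => q.1) (by fun_prop) fun _ hq => hq.1, fun t ht _ _ => hf.2 t ht⟩

lemma PowerBdd₁.mono {f : ℝ → ℝ} (hf : PowerBdd₁ T s C f) {T' : ℝ} (h : T' ≤ T) :
    PowerBdd₁ T' s C f :=
  ⟨hf.1.mono (Ioc_subset_Ioc_right h), fun t ht => hf.2 t ⟨ht.1, ht.2.trans h⟩⟩

lemma PowerBdd₁.congr {f g : ℝ → ℝ} (hf : PowerBdd₁ T s C f) (h : ∀ t ∈ Ioc 0 T, g t = f t) :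
    PowerBdd₁ T s C g :=
  ⟨hf.1.congr h, fun t ht => by rw [h t ht]; exact hf.2 t ht⟩

lemma PowerBdd₁.const_mul {f : ℝ → ℝ} (hf : PowerBdd₁ T s C f) (c : ℝ) :
    PowerBdd₁ T s (|c| * C) (fun t => c * f t) :=
  ⟨continuousOn_const.mul hf.1, fun t ht => by
    rw [abs_mul, mul_assoc]; exact mul_le_mul_of_nonneg_left (hf.2 t ht) (abs_nonneg _)⟩

lemma PowerBdd₁.sub {f g : ℝ → ℝ} {D : ℝ} (hf : PowerBdd₁ T s C f) (hg : PowerBdd₁ T s D g) :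
    PowerBdd₁ T s (C + D) (fun t => f t - g t) :=
  ⟨hf.1.sub hg.1, fun t ht => by
    have h1 := hf.2 t ht
    have h2 := hg.2 t ht
    have h3 := abs_sub (f t) (g t)
    rw [add_mul]; linarith⟩

/-- A stronger vanishing order at `0` can be traded for a weaker one, on a bounded interval. -/
lemma PowerBdd₁.of_le {f : ℝ → ℝ} (hf : PowerBdd₁ T s C f) {s' : ℝ} (h : s' ≤ s) (hC : 0 ≤ C) :
    PowerBdd₁ T s' (C * T ^ (s - s')) f :=
  ⟨hf.1, fun t ht => by
    refine (hf.2 t ht).trans ?_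
    have : t ^ (s - 1) = t ^ (s - s') * t ^ (s' - 1) := by
      rw [← Real.rpow_add ht.1]; ring_nf
    rw [this, mul_assoc]
    have h1 : t ^ (s - s') ≤ T ^ (s - s') := Real.rpow_le_rpow ht.1.le ht.2 (by linarith)
    have h2 : 0 ≤ t ^ (s' - 1) := Real.rpow_nonneg ht.1.le _
    gcongr⟩

lemma powerBdd₁_rlKer (T : ℝ) (hs : 0 < s) : PowerBdd₁ T s (1 / Real.Gamma s) (rlKer s) := by
  refine ⟨(continuousOn_rlKer s).mono fun t ht => ht.1, fun t ht => ?_⟩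
  rw [abs_of_nonneg (rlKer_nonneg hs ht.1.le), rlKer]
  exact le_of_eq (by ring)

lemma PowerBdd₁.intervalIntegrable_kernel {f : ℝ → ℝ} (hf : PowerBdd₁ T s C f) (hs : 0 < s)
    (hγ : 0 < γ) {t : ℝ} (ht : t ∈ Ioc 0 T) :
    IntervalIntegrable (fun z => (t - z) ^ (γ - 1) * f z) volume 0 t := by
  have h := (intervalIntegrable_beta hγ hs ht.1).const_mul C
  rw [intervalIntegrable_iff_integrableOn_Ioo_of_le ht.1.le] at h ⊢
  refine h.mono' ?_ ?_
  · refine ContinuousOn.aestronglyMeasurable ?_ measurableSet_Ioo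
    refine ContinuousOn.mul ?_ (hf.1.mono fun z hz => ⟨hz.1, hz.2.le.trans ht.2⟩)
    exact (continuousOn_const.sub continuousOn_id).rpow_const fun z hz =>
      Or.inl (ne_of_gt (sub_pos.2 hz.2))
  · filter_upwards [ae_restrict_mem measurableSet_Ioo] with z hz
    have h1 := hf.2 z ⟨hz.1, hz.2.le.trans ht.2⟩
    have h2 : 0 ≤ (t - z) ^ (γ - 1) := Real.rpow_nonneg (by linarith [hz.2]) _
    rw [Real.norm_eq_abs, abs_mul, abs_of_nonneg h2]
    nlinarith

lemma PowerBdd₁.intervalIntegrable {f : ℝ → ℝ} (hf : PowerBdd₁ T s C f) (hs : 0 < s)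
    {t : ℝ} (ht : t ∈ Ioc 0 T) : IntervalIntegrable f volume 0 t := by
  simpa using hf.intervalIntegrable_kernel hs (γ := 1) one_pos ht

lemma PowerBdd₁.abs_rlInt_le {f : ℝ → ℝ} (hf : PowerBdd₁ T s C f) (hs : 0 < s)
    (hγ : 0 < γ) {t : ℝ} (ht : t ∈ Ioc 0 T) :
    |rlInt γ f t| ≤ C * Real.Gamma s * rlKer (s + γ) t := by
  have hG := Real.Gamma_pos_of_pos hγ
  have hGs := Real.Gamma_pos_of_pos hs
  rw [← rlInt_rlKer hγ hs ht.1, rlInt_of_pos hγ, rlInt_of_pos hγ, abs_mul,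
    abs_of_pos (by positivity), mul_left_comm]
  refine mul_le_mul_of_nonneg_left ?_ (by positivity)
  rw [← intervalIntegral.integral_const_mul]
  rw [← Real.norm_eq_abs]
  refine intervalIntegral.norm_integral_le_of_norm_le ht.1.le ?_ ?_
  · refine Eventually.of_forall fun z hz => ?_
    have h1 := hf.2 z ⟨hz.1, hz.2.trans ht.2⟩
    have h2 : 0 ≤ (t - z) ^ (γ - 1) := Real.rpow_nonneg (by linarith [hz.2]) _
    rw [Real.norm_eq_abs, abs_mul, abs_of_nonneg h2, rlKer]
    calc (t - z) ^ (γ - 1) * |f z| ≤ (t - z) ^ (γ - 1) * (C * z ^ (s - 1)) := by gcongr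
      _ = _ := by field_simp
  · have : (fun z => C * Real.Gamma s * ((t - z) ^ (γ - 1) * rlKer s z)) =
        fun z => C * ((t - z) ^ (γ - 1) * z ^ (s - 1)) := by
      funext z; unfold rlKer; field_simp
    rw [this]
    exact (intervalIntegrable_beta hγ hs ht.1).const_mul C

/-- Rescaling the weakly singular integral to `(0, 1)`, so that its dependence on `t` sits in the
function only. -/
lemma rlInt_eq_scaled (hγ : 0 < γ) (f : ℝ → ℝ) {t : ℝ} (ht : 0 < t) (s : ℝ) :
    rlInt γ f t = t ^ (s + γ - 1) / Real.Gamma γ *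
      ∫ σ in (0 : ℝ)..1, ((1 - σ) ^ (γ - 1) * σ ^ (s - 1)) * ((t * σ) ^ (1 - s) * f (t * σ)) := by
  have h := intervalIntegral.smul_integral_comp_mul_left
    (a := 0) (b := 1) (fun z => (t - z) ^ (γ - 1) * f z) t
  rw [mul_zero, mul_one] at h
  rw [rlInt_of_pos hγ, ← h, smul_eq_mul]
  have h2 : ∀ σ ∈ Ioo (0 : ℝ) 1, (t - t * σ) ^ (γ - 1) * f (t * σ) =
      t ^ (s + γ - 2) *
        (((1 - σ) ^ (γ - 1) * σ ^ (s - 1)) * ((t * σ) ^ (1 - s) * f (t * σ))) := fun σ hσ => by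
    have h1 : 0 ≤ 1 - σ := by linarith [hσ.2]
    rw [show t - t * σ = t * (1 - σ) by ring, Real.mul_rpow ht.le h1,
      Real.mul_rpow ht.le hσ.1.le]
    have e1 : σ ^ (s - 1) * σ ^ (1 - s) = 1 := by
      rw [← Real.rpow_add hσ.1]; simp
    have e2 : t ^ (s + γ - 2) * t ^ (1 - s) = t ^ (γ - 1) := by
      rw [← Real.rpow_add ht]; ring_nf
    calc t ^ (γ - 1) * (1 - σ) ^ (γ - 1) * f (t * σ)
        = (t ^ (s + γ - 2) * t ^ (1 - s)) * (1 - σ) ^ (γ - 1) * f (t * σ)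
            * (σ ^ (s - 1) * σ ^ (1 - s)) := by rw [e1, e2]; ring
      _ = _ := by ring
  have h3 : ∫ σ in (0 : ℝ)..1, (t - t * σ) ^ (γ - 1) * f (t * σ) =
      t ^ (s + γ - 2) * ∫ σ in (0 : ℝ)..1,
        ((1 - σ) ^ (γ - 1) * σ ^ (s - 1)) * ((t * σ) ^ (1 - s) * f (t * σ)) := by
    rw [← intervalIntegral.integral_const_mul]
    rw [intervalIntegral.integral_of_le zero_le_one, intervalIntegral.integral_of_le zero_le_one,
      integral_Ioc_eq_integral_Ioo, integral_Ioc_eq_integral_Ioo]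
    exact setIntegral_congr_fun measurableSet_Ioo h2
  rw [h3, show s + γ - 1 = (s + γ - 2) + 1 by ring, Real.rpow_add_one ht.ne']
  ring

/-- Fractional integration of order `γ` raises the exponent of a power bound by `γ`, and keeps
joint continuity. -/
lemma PowerBdd.rlInt {f : ℝ → ℝ → ℝ} (hf : PowerBdd T s C f) (hs : 0 < s) (hγ : 0 < γ) :
    PowerBdd T (s + γ) (C * Real.Gamma s / Real.Gamma (s + γ))
      (fun t x => rlInt γ (fun z => f z x) t) := by
  refine ⟨?_, fun t ht x hx => ?_⟩
  · have hc : ContinuousOn (fun q : ℝ × ℝ => q.1 ^ (s + γ - 1) / Real.Gamma γ *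
        ∫ σ in (0 : ℝ)..1, ((1 - σ) ^ (γ - 1) * σ ^ (s - 1)) *
          ((q.1 * σ) ^ (1 - s) * f (q.1 * σ) q.2)) (Ioc 0 T ×ˢ Icc 0 1) := by
      refine ContinuousOn.mul ?_ ?_
      · exact (continuousOn_fst.rpow_const fun q hq => Or.inl (ne_of_gt hq.1.1)).div_const _
      · simp_rw [intervalIntegral.integral_of_le zero_le_one, integral_Ioc_eq_integral_Ioo]
        have hb := (intervalIntegrable_beta hγ hs one_pos).const_mul C
        rw [intervalIntegrable_iff_integrableOn_Ioo_of_le zero_le_one] at hb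
        refine continuousOn_of_dominated
          (bound := fun σ => C * ((1 - σ) ^ (γ - 1) * σ ^ (s - 1))) ?_ ?_ hb ?_
        · rintro ⟨t, x⟩ ⟨ht, hx⟩
          refine ContinuousOn.aestronglyMeasurable ?_ measurableSet_Ioo
          have hmem : ∀ σ ∈ Ioo (0 : ℝ) 1, t * σ ∈ Ioc 0 T := fun σ hσ =>
            ⟨mul_pos ht.1 hσ.1, by nlinarith [ht.1, ht.2, hσ.1, hσ.2]⟩
          refine ContinuousOn.mul (ContinuousOn.mul ?_ ?_) (ContinuousOn.mul ?_ ?_)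
          · exact (continuousOn_const.sub continuousOn_id).rpow_const fun z hz =>
              Or.inl (ne_of_gt (sub_pos.2 hz.2))
          · exact continuousOn_id.rpow_const fun z hz => Or.inl (ne_of_gt hz.1)
          · exact (continuousOn_const.mul continuousOn_id).rpow_const fun z hz =>
              Or.inl (ne_of_gt (hmem z hz).1)
          · exact (hf.slice hx).1.comp (by fun_prop) hmem
        · rintro ⟨t, x⟩ ⟨ht, hx⟩
          filter_upwards [ae_restrict_mem measurableSet_Ioo] with σ hσ
          have hmem : t * σ ∈ Ioc 0 T :=
            ⟨mul_pos ht.1 hσ.1, by nlinarith [ht.1, ht.2, hσ.1, hσ.2]⟩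
          have h1 := hf.2 _ hmem x hx
          have h2 : 0 ≤ (1 - σ) ^ (γ - 1) * σ ^ (s - 1) :=
            mul_nonneg (Real.rpow_nonneg (by linarith [hσ.2]) _) (Real.rpow_nonneg hσ.1.le _)
          have h3 : 0 ≤ (t * σ) ^ (1 - s) := Real.rpow_nonneg hmem.1.le _
          have h4 : (t * σ) ^ (1 - s) * (t * σ) ^ (s - 1) = 1 := by
            rw [← Real.rpow_add hmem.1]; simp
          rw [Real.norm_eq_abs, abs_mul, abs_of_nonneg h2, abs_mul, abs_of_nonneg h3]
          have h5 : (t * σ) ^ (1 - s) * |f (t * σ) x| ≤ C := by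
            calc _ ≤ (t * σ) ^ (1 - s) * (C * (t * σ) ^ (s - 1)) := by gcongr
              _ = C * ((t * σ) ^ (1 - s) * (t * σ) ^ (s - 1)) := by ring
              _ = C := by rw [h4, mul_one]
          nlinarith
        · filter_upwards [ae_restrict_mem measurableSet_Ioo] with σ hσ
          have hmem : ∀ q ∈ Ioc 0 T ×ˢ Icc (0 : ℝ) 1, q.1 * σ ∈ Ioc 0 T := fun q hq =>
            ⟨mul_pos hq.1.1 hσ.1, by nlinarith [hq.1.1, hq.1.2, hσ.1, hσ.2]⟩
          refine continuousOn_const.mul (ContinuousOn.mul ?_ ?_)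
          · exact (continuousOn_fst.mul continuousOn_const).rpow_const fun q hq =>
              Or.inl (ne_of_gt (hmem q hq).1)
          · exact hf.1.comp (f := fun q : ℝ × ℝ => (q.1 * σ, q.2)) (by fun_prop)
              fun q hq => ⟨hmem q hq, hq.2⟩
    exact hc.congr fun q hq => rlInt_eq_scaled hγ (fun z => f z q.2) hq.1.1 s
  · refine ((hf.slice hx).abs_rlInt_le hs hγ ht).trans (le_of_eq ?_)
    unfold rlKer; ring

lemma PowerBdd₁.rlInt {f : ℝ → ℝ} (hf : PowerBdd₁ T s C f) (hs : 0 < s) (hγ : 0 < γ) :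
    PowerBdd₁ T (s + γ) (C * Real.Gamma s / Real.Gamma (s + γ)) (rlInt γ f) :=
  (hf.const.rlInt hs hγ).slice (x := 0) ⟨le_rfl, zero_le_one⟩

lemma PowerBdd₁.hasDerivAt_integral {f : ℝ → ℝ} (hf : PowerBdd₁ T s C f) (hs : 0 < s)
    {t : ℝ} (ht : t ∈ Ioo 0 T) : HasDerivAt (fun r => ∫ z in (0 : ℝ)..r, f z) (f t) t := by
  refine intervalIntegral.integral_hasDerivAt_right
    (hf.intervalIntegrable hs ⟨ht.1, ht.2.le⟩) ?_ ?_
  · exact (hf.1.mono Ioo_subset_Ioc_self).stronglyMeasurableAtFilter isOpen_Ioo t ht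
  · exact hf.1.continuousAt (Ioc_mem_nhds ht.1 ht.2)

lemma PowerBdd₁.tendsto_zero {f : ℝ → ℝ} (hf : PowerBdd₁ T s C f) (hT : 0 < T) (hs : 1 < s) :
    Tendsto f (𝓝[>] 0) (𝓝 0) := by
  have h1 : Tendsto (fun t : ℝ => C * t ^ (s - 1)) (𝓝[>] 0) (𝓝 0) := by
    have : Tendsto (fun t : ℝ => C * t ^ (s - 1)) (𝓝 0) (𝓝 (C * 0 ^ (s - 1))) :=
      ((Real.continuousAt_rpow_const 0 (s - 1) (Or.inr (by linarith))).tendsto).const_mul C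
    rw [Real.zero_rpow (by linarith), mul_zero] at this
    exact this.mono_left nhdsWithin_le_nhds
  refine squeeze_zero_norm' ?_ h1
  filter_upwards [Ioc_mem_nhdsGT hT] with t ht
  exact hf.2 t ht

end

/-! ### Semigroup law, termwise integration, and uniqueness of densities -/

section

variable {T s C γ : ℝ}

/-- The beta integral over `(s, t)`. -/
lemma integral_beta_between {a b s t : ℝ} (ha : 0 < a) (hb : 0 < b) (hst : s < t) :
    IntervalIntegrable (fun z => (t - z) ^ (a - 1) * (z - s) ^ (b - 1)) volume s t ∧
    ∫ z in s..t, (t - z) ^ (a - 1) * (z - s) ^ (b - 1) =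
      (t - s) ^ (a + b - 1) * (Real.Gamma a * Real.Gamma b / Real.Gamma (a + b)) := by
  have h : ∫ z in s..t, (t - z) ^ (a - 1) * (z - s) ^ (b - 1) =
      (t - s) ^ (a + b - 1) * (Real.Gamma a * Real.Gamma b / Real.Gamma (a + b)) := by
    have h1 := intervalIntegral.integral_comp_sub_right (a := s) (b := t)
      (fun y => ((t - s) - y) ^ (a - 1) * y ^ (b - 1)) s
    rw [sub_self, integral_beta_scaled ha hb (sub_pos.2 hst)] at h1
    simp only [sub_sub_sub_cancel_right] at h1
    rw [h1, add_comm b a, mul_comm (Real.Gamma b)]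
  refine ⟨?_, h⟩
  apply intervalIntegral.intervalIntegrable_of_integral_ne_zero
  rw [h]
  have := Real.Gamma_pos_of_pos ha
  have := Real.Gamma_pos_of_pos hb
  have := Real.Gamma_pos_of_pos (add_pos ha hb)
  have := sub_pos.2 hst
  positivity

/-- Semigroup law `I^a I^b f = I^{a+b} f` at a point where `I^{a+b} f` converges absolutely,
together with the absolute convergence of the outer integral. -/
theorem intervalIntegrable_and_rlInt_rlInt {a b t : ℝ} (ha : 0 < a) (hb : 0 < b) (ht : 0 < t)
    {f : ℝ → ℝ} (hm : AEStronglyMeasurable f (volume.restrict (Ioo 0 t)))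
    (hf : IntervalIntegrable (fun z => (t - z) ^ (a + b - 1) * f z) volume 0 t) :
    IntervalIntegrable (fun z => (t - z) ^ (a - 1) * rlInt b f z) volume 0 t ∧
      rlInt a (rlInt b f) t = rlInt (a + b) f t := by
  have hGa := Real.Gamma_pos_of_pos ha
  have hGb := Real.Gamma_pos_of_pos hb
  have hGab := Real.Gamma_pos_of_pos (add_pos ha hb)
  set ν := volume.restrict (Ioo (0 : ℝ) t) with hν
  let H : ℝ → ℝ → ℝ := fun z r =>
    (Ioi r).indicator (fun z => (t - z) ^ (a - 1) * (z - r) ^ (b - 1)) z * f r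
  rw [intervalIntegrable_iff_integrableOn_Ioo_of_le ht.le] at hf
  have hmeas : AEStronglyMeasurable (Function.uncurry H) (ν.prod ν) := by
    refine AEStronglyMeasurable.mul ?_ hm.comp_snd
    have hS : MeasurableSet {q : ℝ × ℝ | q.2 < q.1} :=
      measurableSet_lt measurable_snd measurable_fst
    have : (fun q : ℝ × ℝ => (Ioi q.2).indicator
        (fun z => (t - z) ^ (a - 1) * (z - q.2) ^ (b - 1)) q.1) =
        {q : ℝ × ℝ | q.2 < q.1}.indicator
          (fun q => (t - q.1) ^ (a - 1) * (q.1 - q.2) ^ (b - 1)) := by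
      funext q
      simp [indicator]
    rw [this]
    refine (Measurable.indicator ?_ hS).aestronglyMeasurable
    fun_prop
  have hinner : ∀ r ∈ Ioo 0 t, Integrable (fun z => (Ioi r).indicator
        (fun z => (t - z) ^ (a - 1) * (z - r) ^ (b - 1)) z) ν ∧
      ∫ z, (Ioi r).indicator (fun z => (t - z) ^ (a - 1) * (z - r) ^ (b - 1)) z ∂ν =
        (t - r) ^ (a + b - 1) * (Real.Gamma a * Real.Gamma b / Real.Gamma (a + b)) := by
    intro r hr
    obtain ⟨h1, h2⟩ := integral_beta_between ha hb hr.2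
    have hset : Ioo 0 t ∩ Ioi r = Ioo r t := by
      ext z; simp only [mem_inter_iff, mem_Ioo, mem_Ioi]
      constructor
      · rintro ⟨⟨-, h⟩, h'⟩; exact ⟨h', h⟩
      · rintro ⟨h, h'⟩; exact ⟨⟨hr.1.trans h, h'⟩, h⟩
    constructor
    · rw [integrable_indicator_iff measurableSet_Ioi, IntegrableOn, hν,
        Measure.restrict_restrict measurableSet_Ioi, inter_comm, hset]
      exact (intervalIntegrable_iff_integrableOn_Ioo_of_le hr.2.le).1 h1
    · rw [integral_indicator measurableSet_Ioi, hν,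
        Measure.restrict_restrict measurableSet_Ioi, inter_comm, hset, ← h2,
        intervalIntegral.integral_of_le hr.2.le, integral_Ioc_eq_integral_Ioo]
  have hint : Integrable (Function.uncurry H) (ν.prod ν) := by
    rw [integrable_prod_iff' hmeas]
    constructor
    · filter_upwards [ae_restrict_mem measurableSet_Ioo] with r hr
      exact (hinner r hr).1.mul_const (f r)
    · have : (fun r => ∫ z, ‖Function.uncurry H (z, r)‖ ∂ν) =ᵐ[ν] fun r =>
          (Real.Gamma a * Real.Gamma b / Real.Gamma (a + b)) * ‖(t - r) ^ (a + b - 1) * f r‖ := by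
        filter_upwards [ae_restrict_mem measurableSet_Ioo] with r hr
        have e : ∀ z ∈ Ioo 0 t, ‖Function.uncurry H (z, r)‖ = (Ioi r).indicator
            (fun z => (t - z) ^ (a - 1) * (z - r) ^ (b - 1)) z * |f r| := by
          intro z hz
          simp only [Function.uncurry, H, Real.norm_eq_abs, abs_mul]
          congr 1
          by_cases h : z ∈ Ioi r
          · rw [indicator_of_mem h]
            exact abs_of_nonneg (mul_nonneg (Real.rpow_nonneg (by linarith [hz.2]) _)
              (Real.rpow_nonneg (sub_nonneg.2 (le_of_lt h)) _))
          · rw [indicator_of_notMem h, abs_zero]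
        rw [setIntegral_congr_fun measurableSet_Ioo e, integral_mul_const]
        rw [(hinner r hr).2, Real.norm_eq_abs, abs_mul,
          abs_of_nonneg (Real.rpow_nonneg (by linarith [hr.2] : (0 : ℝ) ≤ t - r) _)]
        ring
      rw [integrable_congr this]
      exact (hf.norm).const_mul _
  have hswap := integral_integral_swap hint
  have hL' : ∀ z ∈ Ioo 0 t, ∫ r, H z r ∂ν =
      (t - z) ^ (a - 1) * ∫ r in (0 : ℝ)..z, (z - r) ^ (b - 1) * f r := by
    intro z hz
    have e : ∀ r, H z r = (Iio z).indicator
        (fun r => (t - z) ^ (a - 1) * ((z - r) ^ (b - 1) * f r)) r := by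
      intro r
      simp only [H, indicator, mem_Ioi, mem_Iio]
      split_ifs <;> ring
    have hset : Ioo 0 t ∩ Iio z = Ioo 0 z := by
      ext r; simp only [mem_inter_iff, mem_Ioo, mem_Iio]
      constructor
      · rintro ⟨⟨h, -⟩, h'⟩; exact ⟨h, h'⟩
      · rintro ⟨h, h'⟩; exact ⟨⟨h, h'.trans hz.2⟩, h'⟩
    simp_rw [e]
    rw [integral_indicator measurableSet_Iio, hν,
        Measure.restrict_restrict measurableSet_Iio, inter_comm, hset, integral_const_mul,
        intervalIntegral.integral_of_le hz.1.le, integral_Ioc_eq_integral_Ioo]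
  have hL : ∫ z, ∫ r, H z r ∂ν ∂ν =
      ∫ z in (0 : ℝ)..t, (t - z) ^ (a - 1) * ∫ r in (0 : ℝ)..z, (z - r) ^ (b - 1) * f r := by
    rw [intervalIntegral.integral_of_le ht.le, integral_Ioc_eq_integral_Ioo]
    exact setIntegral_congr_fun measurableSet_Ioo hL'
  have hR : ∫ r, ∫ z, H z r ∂ν ∂ν =
      (Real.Gamma a * Real.Gamma b / Real.Gamma (a + b)) *
        ∫ r in (0 : ℝ)..t, (t - r) ^ (a + b - 1) * f r := by
    rw [intervalIntegral.integral_of_le ht.le, integral_Ioc_eq_integral_Ioo, ← integral_const_mul]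
    refine setIntegral_congr_fun measurableSet_Ioo fun r hr => ?_
    simp only [H]
    rw [integral_mul_const, (hinner r hr).2]
    ring
  rw [hL, hR] at hswap
  constructor
  · rw [intervalIntegrable_iff_integrableOn_Ioo_of_le ht.le]
    refine (hint.integral_prod_left.const_mul (1 / Real.Gamma b)).congr ?_
    filter_upwards [ae_restrict_mem measurableSet_Ioo] with z hz
    have e : ∫ r, Function.uncurry H (z, r) ∂ν = _ := hL' z hz
    rw [e, rlInt_of_pos hb]
    ring
  rw [rlInt_of_pos ha, rlInt_of_pos (add_pos ha hb)]
  simp_rw [rlInt_of_pos hb, mul_left_comm _ (1 / Real.Gamma b)]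
  rw [intervalIntegral.integral_const_mul, hswap]
  field_simp

theorem rlInt_rlInt {a b t : ℝ} (ha : 0 < a) (hb : 0 < b) (ht : 0 < t) {f : ℝ → ℝ}
    (hm : AEStronglyMeasurable f (volume.restrict (Ioo 0 t)))
    (hf : IntervalIntegrable (fun z => (t - z) ^ (a + b - 1) * f z) volume 0 t) :
    rlInt a (rlInt b f) t = rlInt (a + b) f t :=
  (intervalIntegrable_and_rlInt_rlInt ha hb ht hm hf).2

lemma PowerBdd₁.aestronglyMeasurable {f : ℝ → ℝ} (hf : PowerBdd₁ T s C f) {t : ℝ} (ht : t ≤ T) :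
    AEStronglyMeasurable f (volume.restrict (Ioo 0 t)) :=
  (hf.1.mono fun _ hz => ⟨hz.1, hz.2.le.trans ht⟩).aestronglyMeasurable measurableSet_Ioo

lemma PowerBdd₁.rlInt_rlInt {f : ℝ → ℝ} (hf : PowerBdd₁ T s C f) (hs : 0 < s) {a b t : ℝ}
    (ha : 0 ≤ a) (hb : 0 ≤ b) (ht : t ∈ Ioc 0 T) :
    _root_.rlInt a (_root_.rlInt b f) t = _root_.rlInt (a + b) f t := by
  rcases ha.eq_or_lt with rfl | ha
  · rw [rlInt_zero, zero_add]
  rcases hb.eq_or_lt with rfl | hb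
  · rw [rlInt_zero, add_zero]
  exact _root_.rlInt_rlInt ha hb ht.1 (hf.aestronglyMeasurable ht.2)
    (hf.intervalIntegrable_kernel hs (add_pos ha hb) ht)

lemma PowerBdd₁.summable {f : ℕ → ℝ → ℝ} {M : ℕ → ℝ} (hf : ∀ n, PowerBdd₁ T s (M n) (f n))
    (hM : Summable M) {t : ℝ} (ht : t ∈ Ioc 0 T) : Summable fun n => f n t :=
  Summable.of_norm_bounded (hM.mul_right _) fun n => (hf n).2 t ht

lemma PowerBdd.tsum {f : ℕ → ℝ → ℝ → ℝ} {M : ℕ → ℝ} (hf : ∀ n, PowerBdd T s (M n) (f n))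
    (hM : Summable M) : PowerBdd T s (∑' n, M n) (fun t x => ∑' n, f n t x) := by
  refine ⟨?_, fun t ht x hx => ?_⟩
  · have h1 : ContinuousOn (fun q : ℝ × ℝ => ∑' n, q.1 ^ (1 - s) * f n q.1 q.2)
        (Ioc 0 T ×ˢ Icc 0 1) := by
      refine continuousOn_tsum (fun n => ?_) hM fun n q hq => ?_
      · exact (continuousOn_fst.rpow_const fun q hq => Or.inl (ne_of_gt hq.1.1)).mul (hf n).1
      · have h2 := (hf n).2 q.1 hq.1 q.2 hq.2
        have h3 : 0 ≤ q.1 ^ (1 - s) := Real.rpow_nonneg hq.1.1.le _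
        have h4 : q.1 ^ (1 - s) * q.1 ^ (s - 1) = 1 := by
          rw [← Real.rpow_add hq.1.1]; simp
        rw [Real.norm_eq_abs, abs_mul, abs_of_nonneg h3]
        calc _ ≤ q.1 ^ (1 - s) * (M n * q.1 ^ (s - 1)) := by gcongr
          _ = M n * (q.1 ^ (1 - s) * q.1 ^ (s - 1)) := by ring
          _ = M n := by rw [h4, mul_one]
    have h5 : ContinuousOn (fun q : ℝ × ℝ => q.1 ^ (s - 1) * ∑' n, q.1 ^ (1 - s) * f n q.1 q.2)
        (Ioc 0 T ×ˢ Icc 0 1) :=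
      (continuousOn_fst.rpow_const fun q hq => Or.inl (ne_of_gt hq.1.1)).mul h1
    refine h5.congr fun q hq => ?_
    have h4 : q.1 ^ (s - 1) * q.1 ^ (1 - s) = 1 := by
      rw [← Real.rpow_add hq.1.1]; simp
    simp only
    rw [tsum_mul_left, ← mul_assoc, h4, one_mul]
  · rw [← tsum_mul_right, ← Real.norm_eq_abs]
    exact tsum_of_norm_bounded (hM.mul_right _).hasSum fun n => (hf n).2 t ht x hx

lemma PowerBdd₁.tsum {f : ℕ → ℝ → ℝ} {M : ℕ → ℝ} (hf : ∀ n, PowerBdd₁ T s (M n) (f n))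
    (hM : Summable M) : PowerBdd₁ T s (∑' n, M n) (fun t => ∑' n, f n t) :=
  (PowerBdd.tsum (fun n => (hf n).const) hM).slice (x := 0) ⟨le_rfl, zero_le_one⟩

/-- Termwise fractional integration of a series with a summable family of power bounds. -/
lemma PowerBdd₁.hasSum_rlInt {f : ℕ → ℝ → ℝ} {M : ℕ → ℝ} (hf : ∀ n, PowerBdd₁ T s (M n) (f n))
    (hM : Summable M) (hs : 0 < s) (hγ : 0 ≤ γ) {t : ℝ} (ht : t ∈ Ioc 0 T) :
    HasSum (fun n => _root_.rlInt γ (f n) t) (_root_.rlInt γ (fun z => ∑' n, f n z) t) := by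
  rcases hγ.eq_or_lt with rfl | hγ
  · simp only [rlInt_zero]
    exact (PowerBdd₁.summable hf hM ht).hasSum
  simp only [rlInt_of_pos hγ]
  refine HasSum.mul_left _ ?_
  refine intervalIntegral.hasSum_integral_of_dominated_convergence
    (fun n z => M n * ((t - z) ^ (γ - 1) * z ^ (s - 1))) (fun n => ?_) (fun n => ?_) ?_ ?_ ?_
  · exact (intervalIntegrable_iff.1
      ((hf n).intervalIntegrable_kernel hs hγ ht)).aestronglyMeasurable
  · refine Eventually.of_forall fun z hz => ?_
    rw [uIoc_of_le ht.1.le] at hz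
    have h1 := (hf n).2 z ⟨hz.1, hz.2.trans ht.2⟩
    have h2 : 0 ≤ (t - z) ^ (γ - 1) := Real.rpow_nonneg (by linarith [hz.2]) _
    rw [Real.norm_eq_abs, abs_mul, abs_of_nonneg h2]
    nlinarith
  · exact Eventually.of_forall fun z _ => hM.mul_right _
  · simp_rw [tsum_mul_right]
    exact (intervalIntegrable_beta hγ hs ht.1).const_mul _
  · refine Eventually.of_forall fun z hz => ?_
    rw [uIoc_of_le ht.1.le] at hz
    exact ((PowerBdd₁.summable hf hM ⟨hz.1, hz.2.trans ht.2⟩).hasSum).mul_left _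

/-- Functions continuous on `(0, T)` with the same primitives from `0` agree on `(0, T)`. -/
lemma eqOn_of_integral_eq {f g : ℝ → ℝ}
    (hf : ContinuousOn f (Ioo 0 T)) (hg : ContinuousOn g (Ioo 0 T))
    (hfi : ∀ t ∈ Ioo 0 T, IntervalIntegrable f volume 0 t)
    (hgi : ∀ t ∈ Ioo 0 T, IntervalIntegrable g volume 0 t)
    (h : ∀ t ∈ Ioo 0 T, ∫ z in (0 : ℝ)..t, f z = ∫ z in (0 : ℝ)..t, g z) :
    EqOn f g (Ioo 0 T) := by
  intro t ht
  have h1 := intervalIntegral.integral_hasDerivAt_right (hfi t ht)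
    (hf.stronglyMeasurableAtFilter isOpen_Ioo t ht) (hf.continuousAt (Ioo_mem_nhds ht.1 ht.2))
  have h2 := intervalIntegral.integral_hasDerivAt_right (hgi t ht)
    (hg.stronglyMeasurableAtFilter isOpen_Ioo t ht) (hg.continuousAt (Ioo_mem_nhds ht.1 ht.2))
  refine h1.unique (h2.congr_of_eventuallyEq ?_)
  filter_upwards [Ioo_mem_nhds ht.1 ht.2] with r hr using h r hr

end

/-! ### The resolvent family of the two-term Volterra equation -/

section

variable {T s C γ : ℝ}

lemma PowerBdd₁.rlInt_add_mul {s' C' : ℝ} {f g : ℝ → ℝ} (hf : PowerBdd₁ T s C f)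
    (hg : PowerBdd₁ T s' C' g) (hs : 0 < s) (hs' : 0 < s') (hγ : 0 ≤ γ) (c d : ℝ) {t : ℝ}
    (ht : t ∈ Ioc 0 T) :
    _root_.rlInt γ (fun z => c * f z + d * g z) t =
      c * _root_.rlInt γ f t + d * _root_.rlInt γ g t := by
  rcases hγ.eq_or_lt with rfl | hγ
  · simp [rlInt_zero]
  have h1 := hf.intervalIntegrable_kernel hs hγ ht
  have h2 := hg.intervalIntegrable_kernel hs' hγ ht
  rw [rlInt_of_pos hγ, rlInt_of_pos hγ, rlInt_of_pos hγ]
  have e : ∀ z, (t - z) ^ (γ - 1) * (c * f z + d * g z) =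
      c * ((t - z) ^ (γ - 1) * f z) + d * ((t - z) ^ (γ - 1) * g z) := fun z => by ring
  simp_rw [e]
  rw [intervalIntegral.integral_add (h1.const_mul _) (h2.const_mul _),
    intervalIntegral.integral_const_mul, intervalIntegral.integral_const_mul]
  ring

lemma rlInt_const_mul (γ c : ℝ) (f : ℝ → ℝ) (t : ℝ) :
    rlInt γ (fun z => c * f z) t = c * rlInt γ f t := by
  unfold rlInt
  split_ifs
  · rfl
  · simp_rw [mul_left_comm _ c]
    rw [intervalIntegral.integral_const_mul]
    ring

/-- The `n`-th term `(-μ I^a - λ I^b)^n` applied to the kernel of index `ρ`, in the Neumann series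
of the Volterra equation `f + μ I^a f + λ I^b f = t ^ (ρ - 1) / Γ(ρ)`. -/
noncomputable def resolventTerm (a b μ lam : ℝ) : ℕ → ℝ → ℝ → ℝ
  | 0, ρ, t => rlKer ρ t
  | n + 1, ρ, t => -μ * resolventTerm a b μ lam n (ρ + a) t +
      -lam * resolventTerm a b μ lam n (ρ + b) t

/-- The solution `F_ρ` of the Volterra equation `f + μ I^a f + λ I^b f = t ^ (ρ - 1) / Γ(ρ)`. -/
noncomputable def resolventFun (a b μ lam ρ t : ℝ) : ℝ := ∑' n, resolventTerm a b μ lam n ρ t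

variable {a b μ lam ρ : ℝ}

lemma resolventTerm_eq_sum (n : ℕ) (ρ t : ℝ) :
    resolventTerm a b μ lam n ρ t = ∑ ij ∈ Finset.HasAntidiagonal.antidiagonal n,
      (n.choose ij.1 : ℝ) * ((-μ) ^ ij.1 * (-lam) ^ ij.2 * rlKer (ρ + a * ij.1 + b * ij.2) t) := by
  induction n generalizing ρ with
  | zero => simp [resolventTerm]
  | succ n ih =>
    rw [Finset.sum_antidiagonal_choose_succ_mul
      (fun i j => (-μ) ^ i * (-lam) ^ j * rlKer (ρ + a * i + b * j) t), resolventTerm, ih, ih,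
      add_comm, Finset.mul_sum, Finset.mul_sum]
    congr 1
    · refine Finset.sum_congr rfl fun ij _ => ?_
      push_cast
      rw [show ρ + b + a * ij.1 + b * ij.2 = ρ + a * ij.1 + b * (ij.2 + 1) by ring]
      ring
    · refine Finset.sum_congr rfl fun ij h => ?_
      rw [show n.choose ij.2 = n.choose ij.1 from
        (Nat.choose_symm_of_eq_add
          (by rw [← Finset.HasAntidiagonal.mem_antidiagonal.1 h, add_comm])).symm]
      push_cast
      rw [show ρ + a + a * ij.1 + b * ij.2 = ρ + a * (ij.1 + 1) + b * ij.2 by ring]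
      ring

lemma continuousOn_resolventTerm (n : ℕ) (ρ : ℝ) :
    ContinuousOn (resolventTerm a b μ lam n ρ) (Ioi 0) := by
  induction n generalizing ρ with
  | zero => exact continuousOn_rlKer ρ
  | succ n ih => exact (continuousOn_const.mul (ih _)).add (continuousOn_const.mul (ih _))

lemma resolventTerm_apply_zero (ha : 0 < a) (hb : 0 < b) (n : ℕ) (hρ : 1 < ρ) :
    resolventTerm a b μ lam n ρ 0 = 0 := by
  induction n generalizing ρ with
  | zero => simp [resolventTerm, rlKer, Real.zero_rpow (sub_pos.2 hρ).ne']
  | succ n ih => simp [resolventTerm, ih (show 1 < ρ + a by linarith),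
      ih (show 1 < ρ + b by linarith)]

lemma resolventFun_apply_zero (ha : 0 < a) (hb : 0 < b) (hρ : 1 < ρ) :
    resolventFun a b μ lam ρ 0 = 0 := by
  simp [resolventFun, resolventTerm_apply_zero ha hb _ hρ]

lemma abs_resolventTerm_le (ha : 0 < a) (hb : 0 < b) {B K : ℝ} (hB : 0 < B)
    (hK : ∀ s, 0 < s → 1 / Real.Gamma s ≤ K * B ^ (-s)) (n : ℕ) (hρ : 0 < ρ) {t : ℝ} (ht : 0 < t) :
    |resolventTerm a b μ lam n ρ t| ≤
      K * t⁻¹ * (t / B) ^ ρ * (|μ| * (t / B) ^ a + |lam| * (t / B) ^ b) ^ n := by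
  have htB : 0 < t / B := div_pos ht hB
  induction n generalizing ρ with
  | zero =>
    rw [resolventTerm, pow_zero, mul_one, abs_of_nonneg (rlKer_nonneg hρ ht.le), rlKer,
      Real.rpow_sub_one ht.ne', Real.div_rpow ht.le hB.le]
    have h1 := hK ρ hρ
    rw [Real.rpow_neg hB.le] at h1
    have h2 : 0 ≤ t ^ ρ / t := by positivity
    calc t ^ ρ / t / Real.Gamma ρ = t ^ ρ / t * (1 / Real.Gamma ρ) := by ring
      _ ≤ t ^ ρ / t * (K * (B ^ ρ)⁻¹) := by gcongr
      _ = _ := by ring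
  | succ n ih =>
    have h1 := ih (show 0 < ρ + a by linarith)
    have h2 := ih (show 0 < ρ + b by linarith)
    rw [Real.rpow_add htB] at h1 h2
    rw [resolventTerm]
    refine (abs_add_le _ _).trans ?_
    rw [abs_mul, abs_mul, abs_neg, abs_neg, pow_succ]
    have h3 := mul_le_mul_of_nonneg_left h1 (abs_nonneg μ)
    have h4 := mul_le_mul_of_nonneg_left h2 (abs_nonneg lam)
    refine (add_le_add h3 h4).trans (le_of_eq ?_)
    ring

/-- Geometric bounds for the Neumann series, uniform over all `λ` and `t ≤ T` with
`λ t ^ b ≤ Λ`. -/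
lemma exists_resolventTerm_bound (ha : 0 < a) (hb : 0 < b) (μ T Λ : ℝ) :
    ∃ K B : ℝ, 0 < K ∧ 0 < B ∧ ∀ lam t : ℝ, t ∈ Ioc 0 T → |lam| * t ^ b ≤ Λ → ∀ ρ, 0 < ρ →
      ∀ n, |resolventTerm a b μ lam n ρ t| ≤ K * B ^ (-ρ) * (1 / 2) ^ n * t ^ (ρ - 1) := by
  have h1 : ∀ c e : ℝ, 0 < e → ∀ᶠ B : ℝ in atTop, c * B ^ (-e) < 1 / 4 := fun c e he => by
    have := (tendsto_rpow_neg_atTop he).const_mul c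
    rw [mul_zero] at this
    exact this.eventually_lt_const (by norm_num)
  obtain ⟨B, ⟨hB1, hB2⟩, hB⟩ :=
    (((h1 (|μ| * T ^ a) a ha).and (h1 Λ b hb)).and (eventually_gt_atTop 0)).exists
  obtain ⟨K, hK0, hK⟩ := exists_inv_Gamma_le hB
  refine ⟨K, B, hK0, hB, fun lam t ht hΛ ρ hρ n => ?_⟩
  refine (abs_resolventTerm_le ha hb hB hK n hρ ht.1).trans ?_
  have hBa : 0 < B ^ (-a) := by positivity
  have hBb : 0 < B ^ (-b) := by positivity
  have h2 : |μ| * (t / B) ^ a ≤ 1 / 4 := by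
    rw [Real.div_rpow ht.1.le hB.le, div_eq_mul_inv, ← Real.rpow_neg hB.le, ← mul_assoc]
    refine le_trans ?_ hB1.le
    have := Real.rpow_le_rpow ht.1.le ht.2 ha.le
    gcongr
  have h3 : |lam| * (t / B) ^ b ≤ 1 / 4 := by
    rw [Real.div_rpow ht.1.le hB.le, div_eq_mul_inv, ← Real.rpow_neg hB.le, ← mul_assoc]
    refine le_trans ?_ hB2.le
    gcongr
  have htB : 0 < t / B := div_pos ht.1 hB
  have h4 : (|μ| * (t / B) ^ a + |lam| * (t / B) ^ b) ^ n ≤ (1 / 2) ^ n :=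
    pow_le_pow_left₀ (by positivity) (by linarith) n
  have h5 : 0 ≤ K * t⁻¹ * (t / B) ^ ρ := by have := ht.1; positivity
  refine (mul_le_mul_of_nonneg_left h4 h5).trans (le_of_eq ?_)
  rw [Real.div_rpow ht.1.le hB.le, Real.rpow_neg hB.le, Real.rpow_sub_one ht.1.ne']
  ring

lemma exists_powerBdd_resolventTerm (ha : 0 < a) (hb : 0 < b) (μ lam T : ℝ)
    (hρ : 0 < ρ) :
    ∃ K : ℝ, 0 < K ∧
      ∀ n, PowerBdd₁ T ρ (K * (1 / 2) ^ n) (resolventTerm a b μ lam n ρ) := by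
  obtain ⟨K, B, hK, hB, h⟩ := exists_resolventTerm_bound ha hb μ T (|lam| * T ^ b)
  refine ⟨K * B ^ (-ρ), by positivity, fun n =>
    ⟨(continuousOn_resolventTerm n ρ).mono fun t ht => ht.1, fun t ht => ?_⟩⟩
  refine h lam t ht ?_ ρ hρ n
  have := Real.rpow_le_rpow ht.1.le ht.2 hb.le
  gcongr

lemma summable_geometric_mul (K : ℝ) : Summable fun n : ℕ => K * (1 / 2 : ℝ) ^ n :=
  (summable_geometric_of_lt_one (by norm_num) (by norm_num)).mul_left K

lemma exists_powerBdd_resolventFun (ha : 0 < a) (hb : 0 < b) (μ lam T : ℝ)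
    (hρ : 0 < ρ) : ∃ K : ℝ, PowerBdd₁ T ρ K (resolventFun a b μ lam ρ) := by
  obtain ⟨K, -, h⟩ := exists_powerBdd_resolventTerm ha hb μ lam T hρ
  exact ⟨_, PowerBdd₁.tsum h (summable_geometric_mul K)⟩

lemma summable_resolventTerm (ha : 0 < a) (hb : 0 < b) (μ lam : ℝ) (hρ : 0 < ρ) {t : ℝ}
    (ht : 0 < t) : Summable fun n => resolventTerm a b μ lam n ρ t := by
  obtain ⟨K, -, h⟩ := exists_powerBdd_resolventTerm ha hb μ lam t hρ
  exact PowerBdd₁.summable h (summable_geometric_mul K) ⟨ht, le_rfl⟩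

/-- The Volterra equation `F_ρ + μ F_{ρ+a} + λ F_{ρ+b} = t ^ (ρ - 1) / Γ(ρ)`. -/
lemma resolventFun_eq (ha : 0 < a) (hb : 0 < b) (μ lam : ℝ) (hρ : 0 < ρ) {t : ℝ} (ht : 0 < t) :
    resolventFun a b μ lam ρ t = rlKer ρ t - μ * resolventFun a b μ lam (ρ + a) t
      - lam * resolventFun a b μ lam (ρ + b) t := by
  have h1 := summable_resolventTerm ha hb μ lam hρ ht
  have h2 := summable_resolventTerm ha hb μ lam (show 0 < ρ + a by linarith) ht
  have h3 := summable_resolventTerm ha hb μ lam (show 0 < ρ + b by linarith) ht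
  unfold resolventFun
  rw [h1.tsum_eq_zero_add]
  simp only [resolventTerm]
  rw [(h2.mul_left _).tsum_add (h3.mul_left _), tsum_mul_left, tsum_mul_left]
  ring

lemma rlInt_resolventTerm (ha : 0 < a) (hb : 0 < b) (μ lam : ℝ) (hρ : 0 < ρ) (hγ : 0 ≤ γ) {t : ℝ}
    (ht : 0 < t) (n : ℕ) :
    rlInt γ (resolventTerm a b μ lam n ρ) t = resolventTerm a b μ lam n (ρ + γ) t := by
  rcases hγ.eq_or_lt with rfl | hγ'
  · rw [rlInt_zero, add_zero]
  induction n generalizing ρ with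
  | zero => exact rlInt_rlKer hγ' hρ ht
  | succ n ih =>
    have ha' : 0 < ρ + a := by linarith
    have hb' : 0 < ρ + b := by linarith
    obtain ⟨K, -, h⟩ := exists_powerBdd_resolventTerm ha hb μ lam t ha'
    obtain ⟨K', -, h'⟩ := exists_powerBdd_resolventTerm ha hb μ lam t hb'
    have := (h n).rlInt_add_mul (h' n) ha' hb' hγ (-μ) (-lam) ⟨ht, le_rfl⟩
    rw [ih ha', ih hb'] at this
    simp only [resolventTerm]
    rw [add_right_comm ρ γ a, add_right_comm ρ γ b, ← this]

/-- Fractional integration shifts the index of the resolvent family. -/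
lemma rlInt_resolventFun (ha : 0 < a) (hb : 0 < b) (μ lam : ℝ) (hρ : 0 < ρ) (hγ : 0 ≤ γ) {t : ℝ}
    (ht : 0 < t) :
    rlInt γ (resolventFun a b μ lam ρ) t = resolventFun a b μ lam (ρ + γ) t := by
  obtain ⟨K, -, h⟩ := exists_powerBdd_resolventTerm ha hb μ lam t hρ
  have := PowerBdd₁.hasSum_rlInt h (summable_geometric_mul K) hρ hγ ⟨ht, le_rfl⟩
  simp only [rlInt_resolventTerm ha hb μ lam hρ hγ ht] at this
  exact this.tsum_eq.symm

lemma hasDerivAt_resolventFun (ha : 0 < a) (hb : 0 < b) (μ lam : ℝ) (hρ : 0 < ρ) {t : ℝ}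
    (ht : 0 < t) :
    HasDerivAt (resolventFun a b μ lam (ρ + 1)) (resolventFun a b μ lam ρ t) t := by
  obtain ⟨K, h⟩ := exists_powerBdd_resolventFun ha hb μ lam (t + 1) hρ
  refine (h.hasDerivAt_integral hρ (t := t) ⟨ht, by linarith⟩).congr_of_eventuallyEq ?_
  filter_upwards [Ioi_mem_nhds ht] with r hr
  rw [← rlInt_one, rlInt_resolventFun ha hb μ lam hρ zero_le_one hr]

/-- Every member of the family is differentiable on `(0, ∞)`: the Volterra equation expresses
`F_ρ` through members of higher index, and those of index above `1` are primitives. -/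
lemma differentiableAt_resolventFun (ha : 0 < a) (hb : 0 < b) (μ lam : ℝ) (hρ : 0 < ρ) {t : ℝ}
    (ht : 0 < t) : DifferentiableAt ℝ (resolventFun a b μ lam ρ) t := by
  obtain ⟨n, hn⟩ := exists_nat_gt ((1 - ρ) / min a b)
  have hm : 0 < min a b := lt_min ha hb
  rw [div_lt_iff₀ hm] at hn
  induction n generalizing ρ with
  | zero =>
    have hρ1 : 0 < ρ - 1 := by simp at hn; linarith
    have := (hasDerivAt_resolventFun ha hb μ lam hρ1 ht).differentiableAt
    rwa [sub_add_cancel] at this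
  | succ n ih =>
    push_cast at hn
    have h1 := ih (show 0 < ρ + a by linarith) (by linarith [min_le_left a b])
    have h2 := ih (show 0 < ρ + b by linarith) (by linarith [min_le_right a b])
    have h3 : DifferentiableAt ℝ (rlKer ρ) t :=
      ((differentiableAt_id.rpow_const (Or.inl ht.ne')).div_const _)
    refine ((h3.sub (h1.const_mul μ)).sub (h2.const_mul lam)).congr_of_eventuallyEq ?_
    filter_upwards [Ioi_mem_nhds ht] with r hr
    exact resolventFun_eq ha hb μ lam hρ hr

lemma continuousOn_resolventFun (ha : 0 < a) (hb : 0 < b) (μ lam : ℝ) (hρ : 1 < ρ) :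
    ContinuousOn (resolventFun a b μ lam ρ) (Ici 0) := by
  intro t ht
  rcases (show (0 : ℝ) ≤ t from ht).eq_or_lt with rfl | ht
  · obtain ⟨K, h⟩ := exists_powerBdd_resolventFun ha hb μ lam 1
      (show 0 < ρ by linarith)
    rw [← Ioi_insert, continuousWithinAt_insert_self, ContinuousWithinAt,
      resolventFun_apply_zero ha hb hρ]
    exact h.tendsto_zero one_pos hρ
  · exact (differentiableAt_resolventFun ha hb μ lam
      (by linarith) ht).continuousAt.continuousWithinAt

/-- The time factors of the series solution belong to the resolvent family. -/
lemma modeFun_eq_resolventFun {α₁ α₂ : ℝ} (μ : ℝ) (k : ℕ) (h₁ : 0 < α₁)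
    (h₂ : α₂ < α₁) {t : ℝ} (ht : 0 ≤ t) :
    modeFun α₁ α₂ μ k t =
      resolventFun (α₁ - α₂) α₁ μ ((k * Real.pi) ^ 2) (α₁ + 1) t := by
  rcases ht.eq_or_lt with rfl | ht
  · rw [resolventFun_apply_zero (sub_pos.2 h₂) h₁ (by linarith), modeFun, Real.zero_rpow h₁.ne',
      zero_mul]
  unfold modeFun mittagLeffler₂ resolventFun
  rw [← tsum_mul_left]
  refine tsum_congr fun n => ?_
  rw [resolventTerm_eq_sum, Finset.Nat.sum_antidiagonal_eq_sum_range_succ_mk, Finset.mul_sum]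
  refine Finset.sum_congr rfl fun i hi => ?_
  have hin : i ≤ n := Nat.lt_succ_iff.1 (Finset.mem_range.1 hi)
  simp only [rlKer]
  rw [Nat.cast_sub hin, mul_pow, mul_pow, ← Real.rpow_mul_natCast ht.le,
    ← Real.rpow_mul_natCast ht.le, Nat.cast_sub hin,
    show α₁ + 1 + (α₁ - α₂) * i + α₁ * ((n : ℝ) - i) = α₁ + 1 + α₁ * n - α₂ * i by ring,
    show α₁ + 1 + α₁ * n - α₂ * i - 1 = α₁ + (α₁ - α₂) * i + α₁ * ((n : ℝ) - i) by ring,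
    Real.rpow_add ht, Real.rpow_add ht]
  ring

end

/-! ### An extremum principle for the two-term fractional derivative -/

section

variable {α₁ α₂ μ : ℝ}

/-- The memory kernel of `D^{α₁} + μ D^{α₂}` in Caputo form. -/
noncomputable def memKer (α₁ α₂ μ s : ℝ) : ℝ := rlKer (1 - α₁) s + μ * rlKer (1 - α₂) s

/-- A weaker singularity is dominated by a stronger one up to a constant. -/
lemma exists_rpow_neg_le {A B p q : ℝ} (hA : 0 ≤ A) (hB : 0 < B) (hp : 0 < p) (hpq : p < q) :
    ∃ C, 0 ≤ C ∧ ∀ s : ℝ, 0 < s → A * s ^ (-p) ≤ B * s ^ (-q) + C := by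
  have h0 : Tendsto (fun s : ℝ => A * s ^ (q - p)) (𝓝 0) (𝓝 0) := by
    have := ((Real.continuousAt_rpow_const 0 (q - p) (Or.inr (by linarith))).tendsto).const_mul A
    rwa [Real.zero_rpow (by linarith), mul_zero] at this
  obtain ⟨ε, hε, h⟩ := Metric.eventually_nhds_iff.1 (h0.eventually_lt_const hB)
  refine ⟨A * (ε / 2) ^ (-p), by positivity, fun s hs => ?_⟩
  rcases lt_or_ge s (ε / 2) with h1 | h1
  · have h2 := h (y := s) (by rw [Real.dist_eq, sub_zero, abs_of_pos hs]; linarith)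
    have h3 : s ^ (-p) = s ^ (q - p) * s ^ (-q) := by rw [← Real.rpow_add hs]; ring_nf
    have h4 : 0 < s ^ (-q) := by positivity
    have h5 : 0 ≤ A * (ε / 2) ^ (-p) := by positivity
    rw [h3, ← mul_assoc]
    nlinarith
  · have h2 : s ^ (-p) ≤ (ε / 2) ^ (-p) :=
      Real.rpow_le_rpow_of_nonpos (by positivity) h1 (by linarith)
    have h4 : 0 ≤ B * s ^ (-q) := by positivity
    nlinarith

lemma hasDerivAt_rlKer_one_sub {α s : ℝ} (hs : 0 < s) :
    HasDerivAt (rlKer (1 - α)) (-(α / Real.Gamma (1 - α)) * s ^ (-(α + 1))) s := by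
  have := (Real.hasDerivAt_rpow_const (x := s) (p := 1 - α - 1) (Or.inl hs.ne')).div_const
    (Real.Gamma (1 - α))
  refine HasDerivAt.congr_deriv (f := rlKer (1 - α)) this ?_
  rw [show 1 - α - 1 - 1 = -(α + 1) by ring]
  ring

/-- Whatever the sign of `μ`, the memory kernel is bounded below and becomes nonincreasing after
adding a linear function: its leading singularity is that of order `α₁`. -/
lemma exists_memKer_const (hα₂ : 0 < α₂) (hα : α₂ < α₁) (hα₁ : α₁ < 1) (μ : ℝ) :
    ∃ C, 0 ≤ C ∧ (∀ s, 0 < s → -C ≤ memKer α₁ α₂ μ s) ∧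
      ∀ s h, 0 < s → 0 < h → memKer α₁ α₂ μ (s + h) - memKer α₁ α₂ μ s ≤ C * h := by
  have hG1 := Real.Gamma_pos_of_pos (sub_pos.2 hα₁)
  have hG2 := Real.Gamma_pos_of_pos (sub_pos.2 (hα.trans hα₁))
  have hα₁0 : 0 < α₁ := hα₂.trans hα
  obtain ⟨C, hC, h⟩ := exists_rpow_neg_le (A := |μ| / Real.Gamma (1 - α₂))
    (B := 1 / Real.Gamma (1 - α₁)) (p := α₂) (q := α₁) (by positivity) (by positivity) hα₂ hα
  obtain ⟨C', hC', h'⟩ := exists_rpow_neg_le (A := |μ| * (α₂ / Real.Gamma (1 - α₂)))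
    (B := α₁ / Real.Gamma (1 - α₁)) (p := α₂ + 1) (q := α₁ + 1) (by positivity) (by positivity)
    (by linarith) (by linarith)
  refine ⟨max C C', le_max_of_le_left hC, fun s hs => ?_, fun s h hs hh => ?_⟩
  · have h1 := h s hs
    have h2 : -(|μ| / Real.Gamma (1 - α₂) * s ^ (-α₂)) ≤ μ * rlKer (1 - α₂) s := by
      unfold rlKer
      rw [show 1 - α₂ - 1 = -α₂ by ring]
      have : -|μ| ≤ μ := neg_abs_le μ
      have h3 : 0 ≤ s ^ (-α₂) / Real.Gamma (1 - α₂) := by positivity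
      calc _ = -|μ| * (s ^ (-α₂) / Real.Gamma (1 - α₂)) := by ring
        _ ≤ _ := by gcongr
    have h3 : rlKer (1 - α₁) s = 1 / Real.Gamma (1 - α₁) * s ^ (-α₁) := by
      unfold rlKer
      rw [show 1 - α₁ - 1 = -α₁ by ring]; ring
    have := le_max_left C C'
    unfold memKer
    linarith
  · have hder : ∀ r, 0 < r → HasDerivAt (memKer α₁ α₂ μ)
        (-(α₁ / Real.Gamma (1 - α₁)) * r ^ (-(α₁ + 1)) +
          μ * (-(α₂ / Real.Gamma (1 - α₂)) * r ^ (-(α₂ + 1)))) r := fun r hr =>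
      (hasDerivAt_rlKer_one_sub hr).add ((hasDerivAt_rlKer_one_sub hr).const_mul μ)
    have hmv := (convex_Icc s (s + h)).image_sub_le_mul_sub_of_deriv_le
      (f := memKer α₁ α₂ μ) (C := max C C')
      (fun r hr => (hder r (hs.trans_le hr.1)).continuousAt.continuousWithinAt)
      (fun r hr => by
        rw [interior_Icc] at hr
        exact (hder r (hs.trans hr.1)).differentiableAt.differentiableWithinAt)
      (fun r hr => by
        rw [interior_Icc] at hr
        have hr0 : 0 < r := hs.trans hr.1
        rw [(hder r hr0).deriv]
        have h1 := h' r hr0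
        have h3 : 0 ≤ α₂ / Real.Gamma (1 - α₂) * r ^ (-(α₂ + 1)) := by positivity
        have h2 : μ * (-(α₂ / Real.Gamma (1 - α₂)) * r ^ (-(α₂ + 1))) ≤
            |μ| * (α₂ / Real.Gamma (1 - α₂)) * r ^ (-(α₂ + 1)) := by
          have := neg_abs_le μ
          nlinarith
        have := le_max_right C C'
        linarith)
      s ⟨le_rfl, by linarith⟩ (s + h) ⟨by linarith, le_rfl⟩ (by linarith)
    rwa [add_sub_cancel_left] at hmv

lemma rlInt_one_sub_add (hα : α₂ < α₁) (hα₁ : α₁ < 1) {f : ℝ → ℝ} {T s C t : ℝ}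
    (hf : PowerBdd₁ T s C f) (hs : 0 < s) (ht : t ∈ Ioc 0 T) :
    IntervalIntegrable (fun z => memKer α₁ α₂ μ (t - z) * f z) volume 0 t ∧
    rlInt (1 - α₁) f t + μ * rlInt (1 - α₂) f t =
      ∫ z in (0 : ℝ)..t, memKer α₁ α₂ μ (t - z) * f z := by
  have h1 : 0 < 1 - α₁ := by linarith
  have h2 : 0 < 1 - α₂ := by linarith
  have i1 := (hf.intervalIntegrable_kernel hs h1 ht).const_mul (1 / Real.Gamma (1 - α₁))
  have i2 := (hf.intervalIntegrable_kernel hs h2 ht).const_mul (μ * (1 / Real.Gamma (1 - α₂)))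
  have e : (fun z => memKer α₁ α₂ μ (t - z) * f z) = fun z =>
      1 / Real.Gamma (1 - α₁) * ((t - z) ^ (1 - α₁ - 1) * f z) +
        μ * (1 / Real.Gamma (1 - α₂)) * ((t - z) ^ (1 - α₂ - 1) * f z) := by
    funext z; unfold memKer rlKer; ring
  rw [e]
  refine ⟨i1.add i2, ?_⟩
  rw [intervalIntegral.integral_add i1 i2, intervalIntegral.integral_const_mul,
    intervalIntegral.integral_const_mul, rlInt_of_pos h1, rlInt_of_pos h2]
  ring

/-- Extremum principle: where `f` attains a nonnegative maximum over `(0, t₀]`, the derivative of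
`I^{1-α₁} f + μ I^{1-α₂} f` is bounded below in terms of the size of `f` only. For `μ ≥ 0` one
could take `C = 0`. -/
theorem extremum_principle (hα₂ : 0 < α₂) (hα : α₂ < α₁) (hα₁ : α₁ < 1) {C : ℝ}
    (hC0 : 0 ≤ C) (hC₁ : ∀ s, 0 < s → -C ≤ memKer α₁ α₂ μ s)
    (hC₂ : ∀ s h, 0 < s → 0 < h → memKer α₁ α₂ μ (s + h) - memKer α₁ α₂ μ s ≤ C * h)
    {f : ℝ → ℝ} {t₀ B d : ℝ} (ht₀ : 0 < t₀) (hfc : ContinuousOn f (Ioc 0 t₀))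
    (hmax : ∀ s ∈ Ioc 0 t₀, f s ≤ f t₀) (hB : ∀ s ∈ Ioc 0 t₀, f t₀ - f s ≤ B)
    (hM : 0 ≤ f t₀) (hd : DifferentiableAt ℝ f t₀)
    (hN : HasDerivAt (fun t => rlInt (1 - α₁) f t + μ * rlInt (1 - α₂) f t) d t₀) :
    -(C * f t₀ + C * t₀ * B) ≤ d := by
  set k := memKer α₁ α₂ μ with hk
  have hkd : k = memKer α₁ α₂ μ := hk
  set M := f t₀ with hMdef
  let F : ℝ → ℝ := fun s => M - f s
  have hB0 : 0 ≤ B := by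
    have := hB t₀ ⟨ht₀, le_rfl⟩
    rwa [← hMdef, sub_self] at this
  have hone : PowerBdd₁ t₀ 1 1 (fun _ => (1 : ℝ)) :=
    ⟨continuousOn_const, fun t _ => by simp⟩
  have hF : PowerBdd₁ t₀ 1 B F := by
    refine ⟨continuousOn_const.sub hfc, fun t ht => ?_⟩
    rw [sub_self, Real.rpow_zero, mul_one, abs_of_nonneg (sub_nonneg.2 (hmax t ht))]
    exact hB t ht
  have hf : PowerBdd₁ t₀ 1 (M + B) f := by
    refine ⟨hfc, fun t ht => ?_⟩
    rw [sub_self, Real.rpow_zero, mul_one, abs_le]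
    have h1 := hmax t ht
    have h2 := hB t ht
    constructor <;> linarith
  -- the kernel is integrable up to the origin
  have hki : ∀ t ∈ Ioc 0 t₀, IntervalIntegrable (fun z => k (t - z)) volume 0 t := fun t ht => by
    have := (rlInt_one_sub_add (μ := μ) hα hα₁ hone one_pos ht).1
    simpa using this
  have hki' : ∀ t ∈ Ioc 0 t₀, IntervalIntegrable k volume 0 t := fun t ht => by
    have := (hki t ht).comp_sub_left t
    simpa using this.symm
  have hNe : ∀ t ∈ Ioc 0 t₀, rlInt (1 - α₁) f t + μ * rlInt (1 - α₂) f t =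
      M * (∫ z in (0 : ℝ)..t, k z) - ∫ z in (0 : ℝ)..t, k (t - z) * F z := fun t ht => by
    rw [(rlInt_one_sub_add hα hα₁ hf one_pos ht).2]
    have h1 : ∫ z in (0 : ℝ)..t, k z = ∫ z in (0 : ℝ)..t, k (t - z) := by
      rw [intervalIntegral.integral_comp_sub_left (fun z => k z) t]; simp
    rw [h1, ← intervalIntegral.integral_const_mul, ← intervalIntegral.integral_sub
      ((hki t ht).const_mul M) (rlInt_one_sub_add hα hα₁ hF one_pos ht).1]
    refine intervalIntegral.integral_congr fun z _ => ?_
    simp only [F]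
    ring
  obtain ⟨L, hL0, hL⟩ := hd.isBigO_sub.exists_pos
  obtain ⟨ε, hε, hLε⟩ := Metric.eventually_nhds_iff.1 hL.bound
  -- the essential estimate for a backward difference of step `h`
  have key : ∀ h, 0 < h → h < min ε t₀ →
      -(C * M + C * t₀ * B) * h - L * h * ∫ z in (0 : ℝ)..h, |k z| ≤
      (rlInt (1 - α₁) f t₀ + μ * rlInt (1 - α₂) f t₀) -
        (rlInt (1 - α₁) f (t₀ - h) + μ * rlInt (1 - α₂) f (t₀ - h)) := by
    intro h hh hlt
    have hlt1 : h < ε := hlt.trans_le (min_le_left _ _)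
    have hlt2 : h < t₀ := hlt.trans_le (min_le_right _ _)
    have m0 : t₀ ∈ Ioc 0 t₀ := ⟨ht₀, le_rfl⟩
    have m1 : t₀ - h ∈ Ioc 0 t₀ := ⟨by linarith, by linarith⟩
    rw [hNe _ m0, hNe _ m1]
    have iF0 := (rlInt_one_sub_add (μ := μ) hα hα₁ hF one_pos m0).1
    have iF1 := (rlInt_one_sub_add (μ := μ) hα hα₁ hF one_pos m1).1
    rw [← hkd] at iF0 iF1
    have sub1 : uIcc 0 (t₀ - h) ⊆ uIcc 0 t₀ := by
      rw [uIcc_of_le m1.1.le, uIcc_of_le ht₀.le]; exact Icc_subset_Icc_right m1.2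
    have sub2 : uIcc (t₀ - h) t₀ ⊆ uIcc 0 t₀ := by
      rw [uIcc_of_le m1.2, uIcc_of_le ht₀.le]; exact Icc_subset_Icc_left m1.1.le
    have iFa := iF0.mono_set sub1
    have iFb := iF0.mono_set sub2
    have hsplit := intervalIntegral.integral_add_adjacent_intervals iFa iFb
    have hKsplit := intervalIntegral.integral_add_adjacent_intervals
      ((hki' t₀ m0).mono_set sub1) ((hki' t₀ m0).mono_set sub2)
    have hK : -C * h ≤ ∫ z in (t₀ - h)..t₀, k z := by
      have : ∫ z in (t₀ - h)..t₀, (-C) ≤ ∫ z in (t₀ - h)..t₀, k z :=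
        intervalIntegral.integral_mono_on m1.2 (by simp) ((hki' t₀ m0).mono_set sub2)
          fun z hz => hC₁ z (m1.1.trans_le hz.1)
      rw [intervalIntegral.integral_const, smul_eq_mul] at this
      linarith
    have hfirst : (∫ z in (0 : ℝ)..(t₀ - h), k (t₀ - z) * F z) -
        ∫ z in (0 : ℝ)..(t₀ - h), k (t₀ - h - z) * F z ≤ C * t₀ * B * h := by
      rw [← intervalIntegral.integral_sub iFa iF1]
      have : ∫ z in (0 : ℝ)..(t₀ - h), (k (t₀ - z) * F z - k (t₀ - h - z) * F z) ≤
          ∫ z in (0 : ℝ)..(t₀ - h), C * h * B := by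
        refine intervalIntegral.integral_mono_on_of_le_Ioo m1.1.le (iFa.sub iF1) (by simp)
          fun z hz => ?_
        have hz' : z ∈ Ioc 0 t₀ := ⟨hz.1, by linarith [hz.2]⟩
        have e1 := hC₂ (t₀ - h - z) h (by linarith [hz.2]) hh
        rw [show t₀ - h - z + h = t₀ - z by ring] at e1
        have e2 : 0 ≤ F z := sub_nonneg.2 (hmax z hz')
        have e3 : F z ≤ B := hB z hz'
        have e4 : 0 ≤ C * h := by positivity
        nlinarith
      refine this.trans ?_
      rw [intervalIntegral.integral_const, smul_eq_mul, sub_zero]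
      have : 0 ≤ C * h * B := by positivity
      nlinarith
    have hsecond : ∫ z in (t₀ - h)..t₀, k (t₀ - z) * F z ≤ L * h * ∫ z in (0 : ℝ)..h, |k z| := by
      have ik := (hki t₀ m0).mono_set sub2
      have : ∫ z in (t₀ - h)..t₀, k (t₀ - z) * F z ≤
          ∫ z in (t₀ - h)..t₀, L * h * |k (t₀ - z)| := by
        refine intervalIntegral.integral_mono_on_of_le_Ioo m1.2 iFb (ik.abs.const_mul _)
          fun z hz => ?_
        have hz' : z ∈ Ioc 0 t₀ := ⟨m1.1.trans hz.1, hz.2.le⟩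
        have e2 : 0 ≤ F z := sub_nonneg.2 (hmax z hz')
        have e3 : F z ≤ L * h := by
          have e5 : |z - t₀| = t₀ - z := by rw [abs_sub_comm, abs_of_pos (sub_pos.2 hz.2)]
          have := hLε (y := z) (by rw [Real.dist_eq, e5]; linarith [hz.1])
          rw [Real.norm_eq_abs, Real.norm_eq_abs, e5] at this
          calc F z ≤ |f z - f t₀| := by rw [abs_sub_comm]; exact le_abs_self _
            _ ≤ L * (t₀ - z) := this
            _ ≤ L * h := by have := hz.1; gcongr; linarith
        calc k (t₀ - z) * F z ≤ |k (t₀ - z)| * F z := by gcongr; exact le_abs_self _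
          _ ≤ |k (t₀ - z)| * (L * h) := by gcongr
          _ = _ := by ring
      refine this.trans (le_of_eq ?_)
      rw [intervalIntegral.integral_const_mul,
        intervalIntegral.integral_comp_sub_left (fun z => |k z|) t₀]
      simp
    have hMK := mul_le_mul_of_nonneg_left hK hM
    rw [← hsplit, ← hKsplit]
    linarith
  have hslope := hN.tendsto_slope_zero_left
  have hκ : Tendsto (fun h => ∫ z in (0 : ℝ)..(-h), |k z|) (𝓝[<] 0) (𝓝 0) := by
    have hc := intervalIntegral.continuousOn_primitive_interval'
      (hki' t₀ ⟨ht₀, le_rfl⟩).abs left_mem_uIcc 0 left_mem_uIcc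
    rw [uIcc_of_le ht₀.le, ContinuousWithinAt, intervalIntegral.integral_same] at hc
    refine hc.comp ?_
    refine tendsto_nhdsWithin_iff.2 ⟨?_, ?_⟩
    · have : Tendsto (fun h : ℝ => -h) (𝓝 0) (𝓝 (-0)) := tendsto_id.neg
      rw [neg_zero] at this
      exact this.mono_left nhdsWithin_le_nhds
    · filter_upwards [Ioo_mem_nhdsLT (show -t₀ < 0 by linarith)] with h hh
      exact ⟨by linarith [hh.2], by linarith [hh.1]⟩
  have hlow : Tendsto (fun h => -(C * M + C * t₀ * B) - L * ∫ z in (0 : ℝ)..(-h), |k z|)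
      (𝓝[<] 0) (𝓝 (-(C * M + C * t₀ * B))) := by
    have := (hκ.const_mul L).const_sub (-(C * M + C * t₀ * B))
    simpa using this
  refine le_of_tendsto_of_tendsto hlow hslope ?_
  filter_upwards [Ioo_mem_nhdsLT (show -min ε t₀ < 0 by simpa using ⟨hε, ht₀⟩)] with h hh
  have h1 := key (-h) (by linarith [hh.2]) (by linarith [hh.1])
  rw [sub_neg_eq_add] at h1
  have hneg : 0 < -h := by linarith [hh.2]
  rw [smul_eq_mul, inv_mul_eq_div, ← neg_div_neg_eq, le_div_iff₀ hneg]
  linarith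

end

/-! ### Bounds for the resolvent family uniform in the spectral parameter -/

section

variable {α₁ α₂ μ : ℝ}

/-- Maximum bound for solutions of `D^{α₁} f + μ D^{α₂} f + λ f = r` with `f(0) = 0` and `λ` large:
at a point where `|f|` is maximal, `λ |f| ≤ 2 |r|`. The equation is stated for the primitive
`I^{1-α₁} f + μ I^{1-α₂} f`, so that `f` need not have an integrable derivative. -/
lemma exists_max_le (hα₂ : 0 < α₂) (hα : α₂ < α₁) (hα₁ : α₁ < 1) {C T lam : ℝ} (hT : 0 < T)
    (hC0 : 0 ≤ C) (hC₁ : ∀ s, 0 < s → -C ≤ memKer α₁ α₂ μ s)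
    (hC₂ : ∀ s h, 0 < s → 0 < h → memKer α₁ α₂ μ (s + h) - memKer α₁ α₂ μ s ≤ C * h)
    (hlam : 2 * (C + 2 * C * T) ≤ lam) {f r : ℝ → ℝ} (hfc : ContinuousOn f (Icc 0 T))
    (hf0 : f 0 = 0) (hd : ∀ t ∈ Ioc 0 T, DifferentiableAt ℝ f t)
    (hN : ∀ t ∈ Ioc 0 T, HasDerivAt (fun t => rlInt (1 - α₁) f t + μ * rlInt (1 - α₂) f t)
      (r t - lam * f t) t) :
    ∃ t₀ ∈ Ioc 0 T, (∀ t ∈ Icc 0 T, |f t| ≤ |f t₀|) ∧ lam * |f t₀| ≤ 2 * |r t₀| := by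
  obtain ⟨t₀, ht₀, hmax⟩ := isCompact_Icc.exists_isMaxOn ⟨0, le_rfl, hT.le⟩ hfc.abs
  have hmax' : ∀ t ∈ Icc 0 T, |f t| ≤ |f t₀| := fun t ht => hmax ht
  rcases ht₀.1.eq_or_lt with h0 | h0
  · rw [← h0, hf0, abs_zero] at hmax'
    have hT0 : f T = 0 := abs_nonpos_iff.1 (hmax' T ⟨hT.le, le_rfl⟩)
    exact ⟨T, ⟨hT, le_rfl⟩, fun t ht => (hmax' t ht).trans (abs_nonneg _), by simp [hT0]⟩
  have hmem : t₀ ∈ Ioc 0 T := ⟨h0, ht₀.2⟩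
  refine ⟨t₀, hmem, hmax', ?_⟩
  -- the extremum principle for `e f`, where the sign `e` makes `e f t₀ = |f t₀|`
  have main : ∀ e : ℝ, |e| = 1 → e * f t₀ = |f t₀| →
      -(C * |f t₀| + C * T * (2 * |f t₀|)) ≤ e * (r t₀ - lam * f t₀) := by
    intro e he hef
    have habs : ∀ s ∈ Ioc 0 t₀, |e * f s| ≤ |f t₀| := fun s hs => by
      rw [abs_mul, he, one_mul]; exact hmax' s ⟨hs.1.le, hs.2.trans ht₀.2⟩
    have hN' : HasDerivAt (fun t => rlInt (1 - α₁) (fun z => e * f z) t +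
        μ * rlInt (1 - α₂) (fun z => e * f z) t) (e * (r t₀ - lam * f t₀)) t₀ := by
      simp_rw [rlInt_const_mul]
      have := (hN t₀ hmem).const_mul e
      refine this.congr_of_eventuallyEq (Eventually.of_forall fun t => ?_)
      ring
    have := extremum_principle hα₂ hα hα₁ hC0 hC₁ hC₂ (f := fun z => e * f z) (B := 2 * |f t₀|) h0
      (continuousOn_const.mul (hfc.mono fun s hs => ⟨hs.1.le, hs.2.trans ht₀.2⟩))
      (fun s hs => by simp only [hef]; exact (le_abs_self _).trans (habs s hs))
      (fun s hs => by
        simp only [hef]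
        have := neg_le_of_abs_le (habs s hs)
        linarith)
      (by simp only [hef]; exact abs_nonneg _)
      ((hd t₀ hmem).const_mul e) hN'
    simp only [hef] at this
    refine le_trans ?_ this
    have h1 : C * t₀ * (2 * |f t₀|) ≤ C * T * (2 * |f t₀|) := by
      have := ht₀.2
      gcongr
    linarith
  have hfin : lam * |f t₀| ≤ |r t₀| + (C * |f t₀| + C * T * (2 * |f t₀|)) := by
    rcases le_total 0 (f t₀) with h | h
    · have := main 1 (by simp) (by rw [one_mul, abs_of_nonneg h])
      have h2 := le_abs_self (r t₀)
      rw [abs_of_nonneg h] at *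
      linarith
    · have := main (-1) (by simp) (by rw [abs_of_nonpos h]; ring)
      have h2 := neg_abs_le (r t₀)
      rw [abs_of_nonpos h] at *
      linarith
  have := abs_nonneg (f t₀)
  nlinarith

lemma abs_resolventFun_le_of_term {a b lam ρ t K w : ℝ}
    (h : ∀ n, |resolventTerm a b μ lam n ρ t| ≤ K * (1 / 2) ^ n * w) :
    |resolventFun a b μ lam ρ t| ≤ 2 * K * w := by
  have h2 := (hasSum_geometric_two.mul_left K).mul_right w
  have h3 : ‖∑' n, resolventTerm a b μ lam n ρ t‖ ≤ K * 2 * w := tsum_of_norm_bounded h2 h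
  rw [mul_comm 2 K]
  exact h3

lemma hasDerivAt_rlKer {s t : ℝ} (hs : 0 < s) (ht : 0 < t) :
    HasDerivAt (rlKer (s + 1)) (rlKer s t) t := by
  have := (Real.hasDerivAt_rpow_const (x := t) (p := s + 1 - 1) (Or.inl ht.ne')).div_const
    (Real.Gamma (s + 1))
  refine HasDerivAt.congr_deriv (f := rlKer (s + 1)) this ?_
  have := (Real.Gamma_pos_of_pos hs).ne'
  rw [Real.Gamma_add_one hs.ne', rlKer, add_sub_cancel_right]
  field_simp

/-- The commutator of multiplication by `t` with the fractional integral. -/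
lemma PowerBdd₁.rlInt_mul_id {T s C γ : ℝ} {f : ℝ → ℝ} (hf : PowerBdd₁ T s C f) (hs : 0 < s)
    (hγ : 0 < γ) {t : ℝ} (ht : t ∈ Ioc 0 T) :
    _root_.rlInt γ (fun z => z * f z) t =
      t * _root_.rlInt γ f t - γ * _root_.rlInt (γ + 1) f t := by
  have i1 := hf.intervalIntegrable_kernel hs hγ ht
  have i2 := hf.intervalIntegrable_kernel hs (show 0 < γ + 1 by linarith) ht
  have hG := (Real.Gamma_pos_of_pos hγ).ne'
  rw [rlInt_of_pos hγ, rlInt_of_pos hγ, rlInt_of_pos (show 0 < γ + 1 by linarith),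
    Real.Gamma_add_one hγ.ne']
  have e : ∫ z in (0 : ℝ)..t, (t - z) ^ (γ - 1) * (z * f z) =
      t * (∫ z in (0 : ℝ)..t, (t - z) ^ (γ - 1) * f z) -
        ∫ z in (0 : ℝ)..t, (t - z) ^ (γ + 1 - 1) * f z := by
    rw [← intervalIntegral.integral_const_mul, ← intervalIntegral.integral_sub (i1.const_mul t) i2,
      intervalIntegral.integral_of_le ht.1.le, intervalIntegral.integral_of_le ht.1.le,
      integral_Ioc_eq_integral_Ioo, integral_Ioc_eq_integral_Ioo]
    refine setIntegral_congr_fun measurableSet_Ioo fun z hz => ?_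
    have hz' : 0 < t - z := sub_pos.2 hz.2
    rw [show γ + 1 - 1 = γ - 1 + 1 by ring, Real.rpow_add_one hz'.ne']
    ring
  rw [e]
  field_simp

/-- `D^{α₁} F_ρ + μ D^{α₂} F_ρ + λ F_ρ` is a power kernel. -/
lemma hasDerivAt_memory_resolventFun (hα₂ : 0 < α₂) (hα : α₂ < α₁) (hα₁ : α₁ < 1) (μ lam : ℝ)
    {ρ t : ℝ} (hρ : α₁ < ρ) (ht : 0 < t) :
    HasDerivAt (fun t => rlInt (1 - α₁) (resolventFun (α₁ - α₂) α₁ μ lam ρ) t +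
        μ * rlInt (1 - α₂) (resolventFun (α₁ - α₂) α₁ μ lam ρ) t)
      (rlKer (ρ - α₁) t - lam * resolventFun (α₁ - α₂) α₁ μ lam ρ t) t := by
  have ha : 0 < α₁ - α₂ := sub_pos.2 hα
  have hb : 0 < α₁ := hα₂.trans hα
  have hρ0 : 0 < ρ := hb.trans hρ
  have h1 := (hasDerivAt_resolventFun ha hb μ lam (sub_pos.2 hρ) ht).add
    ((hasDerivAt_resolventFun ha hb μ lam (show 0 < ρ - α₂ by linarith) ht).const_mul μ)
  have h2 := resolventFun_eq ha hb μ lam (sub_pos.2 hρ) ht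
  rw [show ρ - α₁ + (α₁ - α₂) = ρ - α₂ by ring, sub_add_cancel] at h2
  refine (h1.congr_deriv (by rw [h2]; ring)).congr_of_eventuallyEq ?_
  filter_upwards [Ioi_mem_nhds ht] with r hr
  rw [rlInt_resolventFun ha hb μ lam hρ0 (by linarith) hr,
    rlInt_resolventFun ha hb μ lam hρ0 (by linarith) hr, Pi.add_apply,
    show ρ + (1 - α₁) = ρ - α₁ + 1 by ring, show ρ + (1 - α₂) = ρ - α₂ + 1 by ring]

/-- The equation solved by the scaling derivative `t F_{α₁} = t (d/dt) F_{1+α₁}`. -/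
lemma hasDerivAt_memory_mul_resolventFun (hα₂ : 0 < α₂) (hα : α₂ < α₁) (hα₁ : α₁ < 1) (μ lam : ℝ)
    {t : ℝ} (ht : 0 < t) :
    HasDerivAt (fun t =>
        rlInt (1 - α₁) (fun z => z * resolventFun (α₁ - α₂) α₁ μ lam α₁ z) t +
        μ * rlInt (1 - α₂) (fun z => z * resolventFun (α₁ - α₂) α₁ μ lam α₁ z) t)
      ((1 - lam * resolventFun (α₁ - α₂) α₁ μ lam (α₁ + 1) t
          - (1 - α₁) * resolventFun (α₁ - α₂) α₁ μ lam 1 t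
          - μ * (1 - α₂) * resolventFun (α₁ - α₂) α₁ μ lam (1 + (α₁ - α₂)) t)
        - lam * (t * resolventFun (α₁ - α₂) α₁ μ lam α₁ t)) t := by
  have ha : 0 < α₁ - α₂ := sub_pos.2 hα
  have hb : 0 < α₁ := hα₂.trans hα
  have d1 := hasDerivAt_resolventFun ha hb μ lam hb ht
  have d2 := hasDerivAt_resolventFun ha hb μ lam one_pos ht
  have d3 := hasDerivAt_resolventFun ha hb μ lam (show 0 < 1 + (α₁ - α₂) by linarith) ht
  have h1 := (((hasDerivAt_id t).mul ((d1.const_mul lam).const_sub 1)).sub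
    (d2.const_mul (1 - α₁))).sub (d3.const_mul (μ * (1 - α₂)))
  refine (h1.congr_deriv (by simp only [id]; ring)).congr_of_eventuallyEq ?_
  filter_upwards [Ioi_mem_nhds ht] with r hr
  have hr0 : 0 < r := hr
  obtain ⟨K, hK⟩ := exists_powerBdd_resolventFun ha hb μ lam r hb
  rw [hK.rlInt_mul_id hb (by linarith) ⟨hr0, le_rfl⟩,
    hK.rlInt_mul_id hb (by linarith) ⟨hr0, le_rfl⟩,
    rlInt_resolventFun ha hb μ lam hb (by linarith) hr0,
    rlInt_resolventFun ha hb μ lam hb (by linarith) hr0,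
    rlInt_resolventFun ha hb μ lam hb (by linarith) hr0,
    rlInt_resolventFun ha hb μ lam hb (by linarith) hr0,
    show α₁ + (1 - α₁) = 1 by ring, show α₁ + (1 - α₂) = 1 + (α₁ - α₂) by ring,
    show α₁ + (1 - α₁ + 1) = 1 + 1 by ring, show α₁ + (1 - α₂ + 1) = 1 + (α₁ - α₂) + 1 by ring]
  have h2 := resolventFun_eq ha hb μ lam one_pos hr0
  rw [rlKer_one, add_comm 1 α₁] at h2
  simp only [Pi.sub_apply, Pi.mul_apply, id]
  rw [h2]
  ring

/-- For `λ` large, `λ F_{1+α₁}` and `t ^ (1 - α₁) F_{α₁}` are bounded on `(0, T]` by a constant that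
does not depend on `λ`. Where `λ t ^ α₁ ≤ 1` this is read off the Neumann series; elsewhere it comes
from the maximum bound. -/
lemma exists_uniform_bound_of_large (hα₂ : 0 < α₂) (hα : α₂ < α₁) (hα₁ : α₁ < 1) (μ : ℝ) {T : ℝ}
    (hT : 0 < T) : ∃ Λ K : ℝ, 0 < Λ ∧ 0 < K ∧ ∀ lam, Λ ≤ lam → ∀ t ∈ Ioc 0 T,
      lam * |resolventFun (α₁ - α₂) α₁ μ lam (α₁ + 1) t| ≤ K ∧
      |resolventFun (α₁ - α₂) α₁ μ lam α₁ t| ≤ K * t ^ (α₁ - 1) := by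
  have ha : 0 < α₁ - α₂ := sub_pos.2 hα
  have hb : 0 < α₁ := hα₂.trans hα
  obtain ⟨C, hC0, hC₁, hC₂⟩ := exists_memKer_const hα₂ hα hα₁ μ
  obtain ⟨K₀, B, hK₀, hB, hser⟩ := exists_resolventTerm_bound ha hb μ T 1
  -- bound where `λ t ^ α₁ ≤ 1`
  have hsmall : ∀ lam t : ℝ, 0 ≤ lam → t ∈ Ioc 0 T → lam * t ^ α₁ ≤ 1 → ∀ ρ, 0 < ρ →
      |resolventFun (α₁ - α₂) α₁ μ lam ρ t| ≤ 2 * (K₀ * B ^ (-ρ)) * t ^ (ρ - 1) := by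
    intro lam t hl ht h ρ hρ
    have h1 := hser lam t ht (by rwa [abs_of_nonneg hl]) ρ hρ
    exact abs_resolventFun_le_of_term h1
  have hG := Real.Gamma_pos_of_pos (sub_pos.2 (hα.trans hα₁))
  set A₁ := max (2 * (K₀ * B ^ (-(1 + (α₁ - α₂)))) * T ^ (α₁ - α₂)) (2 / Real.Gamma (1 - α₂))
    with hA₁
  have hA₁0 : 0 < A₁ := lt_max_of_lt_right (by positivity)
  set A₂ := 3 + |μ| * A₁ with hA₂
  have hA₂0 : 0 < A₂ := by positivity
  set A₃ := 2 * (3 + A₂ + |μ| * A₁) with hA₃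
  have hA₃0 : 0 < A₃ := by positivity
  refine ⟨max 1 (2 * (C + 2 * C * T)), max 2 (max A₃ (2 * (K₀ * B ^ (-α₁)))),
    lt_max_of_lt_left one_pos, lt_max_of_lt_left two_pos, fun lam hlam => ?_⟩
  have hlam1 : 1 ≤ lam := (le_max_left _ _).trans hlam
  have hlam2 : 2 * (C + 2 * C * T) ≤ lam := (le_max_right _ _).trans hlam
  have hlam0 : 0 < lam := by linarith
  -- `λ |F_{1+α₁}| ≤ 2`
  have b1 : ∀ t ∈ Icc 0 T, lam * |resolventFun (α₁ - α₂) α₁ μ lam (α₁ + 1) t| ≤ 2 := by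
    obtain ⟨t₀, ht₀, hmax, hle⟩ := exists_max_le hα₂ hα hα₁ hT hC0 hC₁ hC₂ hlam2
      (f := resolventFun (α₁ - α₂) α₁ μ lam (α₁ + 1)) (r := rlKer 1)
      ((continuousOn_resolventFun ha hb μ lam (by linarith)).mono fun t ht => ht.1)
      (resolventFun_apply_zero ha hb (by linarith))
      (fun t ht => differentiableAt_resolventFun ha hb μ lam (by linarith) ht.1)
      (fun t ht => by
        have := hasDerivAt_memory_resolventFun hα₂ hα hα₁ μ lam
          (show α₁ < α₁ + 1 by linarith) ht.1
        rwa [add_sub_cancel_left] at this)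
    rw [rlKer_one, abs_one, mul_one] at hle
    intro t ht
    exact (mul_le_mul_of_nonneg_left (hmax t ht) hlam0.le).trans hle
  -- `|F_{1+α₁-α₂}| ≤ A₁`
  have b2 : ∀ t ∈ Icc 0 T, |resolventFun (α₁ - α₂) α₁ μ lam (1 + (α₁ - α₂)) t| ≤ A₁ := by
    obtain ⟨t₀, ht₀, hmax, hle⟩ := exists_max_le hα₂ hα hα₁ hT hC0 hC₁ hC₂ hlam2
      (f := resolventFun (α₁ - α₂) α₁ μ lam (1 + (α₁ - α₂))) (r := rlKer (1 - α₂))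
      ((continuousOn_resolventFun ha hb μ lam (by linarith)).mono fun t ht => ht.1)
      (resolventFun_apply_zero ha hb (by linarith))
      (fun t ht => differentiableAt_resolventFun ha hb μ lam (by linarith) ht.1)
      (fun t ht => by
        have := hasDerivAt_memory_resolventFun hα₂ hα hα₁ μ lam
          (show α₁ < 1 + (α₁ - α₂) by linarith) ht.1
        rwa [show 1 + (α₁ - α₂) - α₁ = 1 - α₂ by ring] at this)
    intro t ht
    refine (hmax t ht).trans ?_
    rcases le_total (lam * t₀ ^ α₁) 1 with h | h
    · refine (hsmall lam t₀ hlam0.le ht₀ h _ (by linarith)).trans (le_trans ?_ (le_max_left _ _))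
      rw [add_sub_cancel_left]
      have := Real.rpow_le_rpow ht₀.1.le ht₀.2 ha.le
      gcongr
    · refine le_trans ?_ (le_max_right _ _)
      -- here `t₀ ^ (-α₂) ≤ λ`
      have hp : t₀ ^ (1 - α₂ - 1) ≤ lam := by
        rw [show 1 - α₂ - 1 = -α₂ by ring, Real.rpow_neg ht₀.1.le]
        have ht : 0 < t₀ ^ α₂ := Real.rpow_pos_of_pos ht₀.1 _
        rw [inv_le_comm₀ ht hlam0]
        rcases le_total t₀ 1 with h1 | h1
        · have := Real.rpow_le_rpow_of_exponent_ge ht₀.1 h1 hα.le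
          refine le_trans ?_ this
          rw [inv_le_iff_one_le_mul₀ hlam0]
          linarith
        · have := Real.one_le_rpow h1 hα₂.le
          exact (inv_le_one_of_one_le₀ hlam1).trans this
      rw [abs_of_nonneg (rlKer_nonneg (by linarith) ht₀.1.le), rlKer] at hle
      have h3 : 2 * (t₀ ^ (1 - α₂ - 1) / Real.Gamma (1 - α₂)) ≤
          2 * (lam / Real.Gamma (1 - α₂)) := by
        gcongr
      have h4 := hle.trans h3
      rw [show 2 * (lam / Real.Gamma (1 - α₂)) = lam * (2 / Real.Gamma (1 - α₂)) by ring] at h4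
      exact le_of_mul_le_mul_left h4 hlam0
  -- `|F_1| ≤ A₂`
  have b3 : ∀ t ∈ Ioc 0 T, |resolventFun (α₁ - α₂) α₁ μ lam 1 t| ≤ A₂ := by
    intro t ht
    have h1 := b1 t ⟨ht.1.le, ht.2⟩
    have h2 := b2 t ⟨ht.1.le, ht.2⟩
    rw [resolventFun_eq ha hb μ lam one_pos ht.1, rlKer_one, add_comm 1 α₁]
    refine (abs_sub _ _).trans ?_
    refine (add_le_add_left (abs_sub _ _) _).trans ?_
    rw [abs_mul, abs_mul, abs_of_pos hlam0, abs_one]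
    have := mul_le_mul_of_nonneg_left h2 (abs_nonneg μ)
    linarith
  -- `λ |t F_{α₁}| ≤ A₃`
  have b4 : ∀ t ∈ Icc 0 T, lam * |t * resolventFun (α₁ - α₂) α₁ μ lam α₁ t| ≤ A₃ := by
    obtain ⟨K, hK⟩ := exists_powerBdd_resolventFun ha hb μ lam T hb
    have hc : ContinuousOn (fun t => t * resolventFun (α₁ - α₂) α₁ μ lam α₁ t) (Icc 0 T) := by
      have h1 : PowerBdd₁ T (α₁ + 1) K (fun t => t * resolventFun (α₁ - α₂) α₁ μ lam α₁ t) := by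
        refine ⟨continuousOn_id.mul hK.1, fun t ht => ?_⟩
        rw [abs_mul, abs_of_pos ht.1, show α₁ + 1 - 1 = α₁ - 1 + 1 by ring,
          Real.rpow_add_one ht.1.ne']
        have := mul_le_mul_of_nonneg_left (hK.2 t ht) ht.1.le
        linarith
      intro t ht
      rcases ht.1.eq_or_lt with rfl | h0
      · rw [← Ioc_insert_left hT.le, continuousWithinAt_insert_self, ContinuousWithinAt, zero_mul]
        exact (h1.tendsto_zero hT (by linarith)).mono_left
          (nhdsWithin_mono _ fun t ht => ht.1)
      · exact (continuousAt_id.mul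
          (differentiableAt_resolventFun ha hb μ lam hb h0).continuousAt).continuousWithinAt
    obtain ⟨t₀, ht₀, hmax, hle⟩ := exists_max_le hα₂ hα hα₁ hT hC0 hC₁ hC₂ hlam2 hc
      (zero_mul _)
      (fun t ht => differentiableAt_id.mul (differentiableAt_resolventFun ha hb μ lam hb ht.1))
      (fun t ht => hasDerivAt_memory_mul_resolventFun hα₂ hα hα₁ μ lam ht.1)
    intro t ht
    refine (mul_le_mul_of_nonneg_left (hmax t ht) hlam0.le).trans (hle.trans ?_)
    have h1 := b1 t₀ ⟨ht₀.1.le, ht₀.2⟩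
    have h2 := b2 t₀ ⟨ht₀.1.le, ht₀.2⟩
    have h3 := b3 t₀ ht₀
    refine mul_le_mul_of_nonneg_left ?_ two_pos.le
    refine (abs_sub _ _).trans ?_
    refine (add_le_add_left (abs_sub _ _) _).trans ?_
    refine (add_le_add_left (add_le_add_left (abs_sub _ _) _) _).trans ?_
    rw [abs_mul, abs_mul, abs_mul, abs_mul, abs_of_pos hlam0, abs_one,
      abs_of_pos (show 0 < 1 - α₁ by linarith), abs_of_pos (show 0 < 1 - α₂ by linarith)]
    have e1 : (1 - α₁) * |resolventFun (α₁ - α₂) α₁ μ lam 1 t₀| ≤ 1 * A₂ := by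
      gcongr
      linarith
    have e2 : |μ| * (1 - α₂) * |resolventFun (α₁ - α₂) α₁ μ lam (1 + (α₁ - α₂)) t₀| ≤
        |μ| * 1 * A₁ := by
      gcongr
      linarith
    linarith
  intro t ht
  refine ⟨(b1 t ⟨ht.1.le, ht.2⟩).trans (le_max_left _ _), ?_⟩
  have htp : 0 < t ^ (α₁ - 1) := Real.rpow_pos_of_pos ht.1 _
  rcases le_total (lam * t ^ α₁) 1 with h | h
  · refine (hsmall lam t hlam0.le ht h α₁ hb).trans ?_
    gcongr
    exact (le_max_right _ _).trans (le_max_right _ _)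
  · have h1 := b4 t ⟨ht.1.le, ht.2⟩
    rw [abs_mul, abs_of_pos ht.1] at h1
    have h2 : A₃ ≤ max 2 (max A₃ (2 * (K₀ * B ^ (-α₁)))) :=
      (le_max_left _ _).trans (le_max_right _ _)
    refine le_trans ?_ (mul_le_mul_of_nonneg_right h2 htp.le)
    have h3 : t ^ α₁ = t ^ (α₁ - 1) * t := by
      rw [← Real.rpow_add_one ht.1.ne', sub_add_cancel]
    rw [h3] at h
    have hF := abs_nonneg (resolventFun (α₁ - α₂) α₁ μ lam α₁ t)
    calc |resolventFun (α₁ - α₂) α₁ μ lam α₁ t|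
        ≤ (lam * (t ^ (α₁ - 1) * t)) * |resolventFun (α₁ - α₂) α₁ μ lam α₁ t| :=
          le_mul_of_one_le_left hF h
      _ = (lam * (t * |resolventFun (α₁ - α₂) α₁ μ lam α₁ t|)) * t ^ (α₁ - 1) := by ring
      _ ≤ A₃ * t ^ (α₁ - 1) := by gcongr

/-- Bounds for the resolvent family on `(0, T]` uniform over all `λ ≥ 0`. -/
theorem exists_uniform_bound (hα₂ : 0 < α₂) (hα : α₂ < α₁) (hα₁ : α₁ < 1) (μ : ℝ) {T : ℝ}
    (hT : 0 < T) : ∃ K : ℝ, 0 < K ∧ ∀ lam, 0 ≤ lam → ∀ t ∈ Ioc 0 T,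
      lam * |resolventFun (α₁ - α₂) α₁ μ lam (α₁ + 1) t| ≤ K ∧
      |resolventFun (α₁ - α₂) α₁ μ lam α₁ t| ≤ K * t ^ (α₁ - 1) := by
  have ha : 0 < α₁ - α₂ := sub_pos.2 hα
  have hb : 0 < α₁ := hα₂.trans hα
  obtain ⟨Λ, K, hΛ, hK, h⟩ := exists_uniform_bound_of_large hα₂ hα hα₁ μ hT
  obtain ⟨K₀, B, hK₀, hB, hser⟩ := exists_resolventTerm_bound ha hb μ T (Λ * T ^ α₁)
  set A := 2 * (K₀ * B ^ (-(α₁ + 1))) * T ^ α₁ with hA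
  set A' := 2 * (K₀ * B ^ (-α₁)) with hA'
  have hA0 : 0 < A := by positivity
  have hA0' : 0 < A' := by positivity
  refine ⟨K + Λ * A + A', by positivity, fun lam hl t ht => ?_⟩
  have htp : 0 < t ^ (α₁ - 1) := Real.rpow_pos_of_pos ht.1 _
  rcases le_total Λ lam with hl' | hl'
  · obtain ⟨h1, h2⟩ := h lam hl' t ht
    refine ⟨h1.trans (by linarith [mul_pos hΛ hA0]), h2.trans ?_⟩
    gcongr
    linarith [mul_pos hΛ hA0]
  · have hbd : ∀ ρ, 0 < ρ →
        |resolventFun (α₁ - α₂) α₁ μ lam ρ t| ≤ 2 * (K₀ * B ^ (-ρ)) * t ^ (ρ - 1) := by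
      intro ρ hρ
      have h1 := hser lam t ht (by
        rw [abs_of_nonneg hl]
        have h1 := Real.rpow_le_rpow ht.1.le ht.2 hb.le
        exact mul_le_mul hl' h1 (Real.rpow_nonneg ht.1.le _) hΛ.le) ρ hρ
      exact abs_resolventFun_le_of_term h1
    constructor
    · have h1 := hbd (α₁ + 1) (by linarith)
      rw [add_sub_cancel_right] at h1
      have h2 : 2 * (K₀ * B ^ (-(α₁ + 1))) * t ^ α₁ ≤ A := by
        have := Real.rpow_le_rpow ht.1.le ht.2 hb.le
        rw [hA]; gcongr
      calc _ ≤ Λ * A := by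
            have := h1.trans h2
            gcongr
        _ ≤ _ := by linarith
    · refine (hbd α₁ hb).trans ?_
      gcongr
      linarith [mul_pos hΛ hA0]

/-- `λ F_{1+α₁}(T)` stays away from `0` for large `λ`. The comparison function is `t / (λ T)`,
which solves the same equation as `F_{1+α₁}` up to a source term that is nonpositive to leading
order. -/
theorem exists_lower_bound (hα₂ : 0 < α₂) (hα : α₂ < α₁) (hα₁ : α₁ < 1) (μ : ℝ) {T : ℝ}
    (hT : 0 < T) : ∃ Λ : ℝ, ∀ lam, Λ ≤ lam →
      1 / 2 ≤ lam * resolventFun (α₁ - α₂) α₁ μ lam (α₁ + 1) T := by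
  have ha : 0 < α₁ - α₂ := sub_pos.2 hα
  have hb : 0 < α₁ := hα₂.trans hα
  obtain ⟨C, hC0, hC₁, hC₂⟩ := exists_memKer_const hα₂ hα hα₁ μ
  obtain ⟨K, hK, hbd⟩ := exists_uniform_bound hα₂ hα hα₁ μ hT
  have hG1 := Real.Gamma_pos_of_pos (show 0 < 2 - α₁ by linarith)
  have hG2 := Real.Gamma_pos_of_pos (show 0 < 2 - α₂ by linarith)
  set D := T ^ (1 - α₁) / Real.Gamma (2 - α₁) + |μ| * (T ^ (1 - α₂) / Real.Gamma (2 - α₂)) with hD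
  have hD0 : 0 < D := by positivity
  set E := D / T + C * (1 + K) + C * T * (2 * (1 + K)) with hE
  have hE0 : 0 < E := by positivity
  refine ⟨max 1 (2 * E), fun lam hlam => ?_⟩
  have hlam1 : 1 ≤ lam := (le_max_left _ _).trans hlam
  have hlamE : 2 * E ≤ lam := (le_max_right _ _).trans hlam
  have hlam0 : 0 < lam := by linarith
  set G := resolventFun (α₁ - α₂) α₁ μ lam (α₁ + 1) with hG
  set c := 1 / (lam * T) with hc
  have hc0 : 0 < c := by positivity
  set f : ℝ → ℝ := fun t => c * t - G t with hf
  have hfc : ContinuousOn f (Icc 0 T) := (continuousOn_const.mul continuousOn_id).sub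
    ((continuousOn_resolventFun ha hb μ lam (by linarith)).mono fun t ht => ht.1)
  have hG0 : G 0 = 0 := resolventFun_apply_zero ha hb (by linarith)
  have hf0 : f 0 = 0 := by simp [hf, hG0]
  have hGb : ∀ t ∈ Icc 0 T, |G t| ≤ K / lam := fun t ht => by
    rcases ht.1.eq_or_lt with h | h
    · rw [← h, hG0, abs_zero]; positivity
    · rw [le_div_iff₀ hlam0, mul_comm]; exact (hbd lam hlam0.le t ⟨h, ht.2⟩).1
  have hct : ∀ t ∈ Icc 0 T, c * t ≤ 1 / lam := fun t ht => by
    calc c * t ≤ c * T := by have := ht.2; gcongr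
      _ = 1 / lam := by rw [hc]; field_simp
  have hfb : ∀ t ∈ Icc 0 T, |f t| ≤ (1 + K) / lam := fun t ht => by
    refine (abs_sub _ _).trans ?_
    rw [abs_of_nonneg (mul_nonneg hc0.le ht.1), add_div]
    exact add_le_add (hct t ht) (hGb t ht)
  have hfT : f T = 1 / lam - G T := by simp only [hf, hc]; field_simp
  obtain ⟨t₀, ht₀, hmax⟩ := isCompact_Icc.exists_isMaxOn ⟨0, le_rfl, hT.le⟩ hfc
  have hmax' : ∀ t ∈ Icc 0 T, f t ≤ f t₀ := fun t ht => hmax ht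
  have hM : 0 ≤ f t₀ := by rw [← hf0]; exact hmax' 0 ⟨le_rfl, hT.le⟩
  suffices hsuff : lam * f t₀ ≤ E / lam by
    have h1 := hmax' T ⟨hT.le, le_rfl⟩
    rw [hfT] at h1
    have h2 : lam * (1 / lam - G T) ≤ E / lam := (mul_le_mul_of_nonneg_left h1 hlam0.le).trans hsuff
    have h3 : E / lam ≤ 1 / 2 := by rw [div_le_iff₀ hlam0]; linarith
    rw [mul_sub, mul_one_div_cancel hlam0.ne'] at h2
    linarith
  rcases ht₀.1.eq_or_lt with h0 | h0
  · rw [← h0, hf0, mul_zero]; positivity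
  have hN : HasDerivAt (fun t => rlInt (1 - α₁) f t + μ * rlInt (1 - α₂) f t)
      (c * (rlKer (2 - α₁) t₀ + μ * rlKer (2 - α₂) t₀) - (1 - lam * G t₀)) t₀ := by
    have h1 := hasDerivAt_memory_resolventFun hα₂ hα hα₁ μ lam (show α₁ < α₁ + 1 by linarith) h0
    rw [add_sub_cancel_left, rlKer_one, ← hG] at h1
    have h2 := ((hasDerivAt_rlKer (show 0 < 2 - α₁ by linarith) h0).add
      ((hasDerivAt_rlKer (show 0 < 2 - α₂ by linarith) h0).const_mul μ)).const_mul c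
    refine (h2.sub h1).congr_of_eventuallyEq ?_
    filter_upwards [Ioi_mem_nhds h0] with r hr
    have hr0 : 0 < r := hr
    obtain ⟨K', hK'⟩ := exists_powerBdd_resolventFun ha hb μ lam r (show 0 < α₁ + 1 by linarith)
    have h2b := powerBdd₁_rlKer r (s := 2) two_pos
    have hk2 : ∀ z : ℝ, rlKer 2 z = z := fun z => by
      rw [rlKer, Real.Gamma_two, div_one, show (2 : ℝ) - 1 = 1 by norm_num, Real.rpow_one]
    have e : f = fun z => c * rlKer 2 z + -1 * G z := by
      funext z; rw [hk2]; simp only [hf]; ring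
    rw [e, h2b.rlInt_add_mul hK' two_pos (by linarith) (by linarith) c (-1) ⟨hr0, le_rfl⟩,
      h2b.rlInt_add_mul hK' two_pos (by linarith) (by linarith) c (-1) ⟨hr0, le_rfl⟩,
      rlInt_rlKer (by linarith) two_pos hr0, rlInt_rlKer (by linarith) two_pos hr0,
      show 2 + (1 - α₁) = 2 - α₁ + 1 by ring, show 2 + (1 - α₂) = 2 - α₂ + 1 by ring]
    simp only [Pi.sub_apply, Pi.add_apply]
    ring
  have hext := extremum_principle hα₂ hα hα₁ hC0 hC₁ hC₂ (f := f) (B := 2 * ((1 + K) / lam)) h0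
    (hfc.mono fun s hs => ⟨hs.1.le, hs.2.trans ht₀.2⟩)
    (fun s hs => hmax' s ⟨hs.1.le, hs.2.trans ht₀.2⟩)
    (fun s hs => by
      have h1 := le_of_abs_le (hfb t₀ ht₀)
      have h2 := neg_le_of_abs_le (hfb s ⟨hs.1.le, hs.2.trans ht₀.2⟩)
      linarith)
    hM
    ((differentiableAt_id.const_mul c).sub
      (differentiableAt_resolventFun ha hb μ lam (by linarith) h0)) hN
  have hk : ∀ α, α < 1 → rlKer (2 - α) t₀ ≤ T ^ (1 - α) / Real.Gamma (2 - α) ∧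
      0 ≤ rlKer (2 - α) t₀ := fun α hα' => by
    refine ⟨?_, rlKer_nonneg (by linarith) h0.le⟩
    unfold rlKer
    rw [show 2 - α - 1 = 1 - α by ring]
    have := Real.Gamma_pos_of_pos (show 0 < 2 - α by linarith)
    have := Real.rpow_le_rpow h0.le ht₀.2 (show 0 ≤ 1 - α by linarith)
    gcongr
  have hsrc : c * (rlKer (2 - α₁) t₀ + μ * rlKer (2 - α₂) t₀) ≤ D / T / lam := by
    have h1 : μ * rlKer (2 - α₂) t₀ ≤ |μ| * (T ^ (1 - α₂) / Real.Gamma (2 - α₂)) :=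
      mul_le_mul (le_abs_self μ) (hk α₂ (hα.trans hα₁)).1 (hk α₂ (hα.trans hα₁)).2 (abs_nonneg _)
    have h2 : rlKer (2 - α₁) t₀ + μ * rlKer (2 - α₂) t₀ ≤ D := add_le_add (hk α₁ hα₁).1 h1
    calc _ ≤ c * D := by gcongr
      _ = D / T / lam := by rw [hc]; field_simp
  have hGt : lam * G t₀ = t₀ / T - lam * f t₀ := by simp only [hf, hc]; field_simp; ring
  have htT : t₀ / T ≤ 1 := (div_le_one hT).2 ht₀.2
  have hMle : f t₀ ≤ (1 + K) / lam := le_of_abs_le (hfb t₀ ht₀)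
  have h1 : C * f t₀ ≤ C * ((1 + K) / lam) := by gcongr
  have h2 : C * t₀ * (2 * ((1 + K) / lam)) ≤ C * T * (2 * ((1 + K) / lam)) := by
    have := ht₀.2
    gcongr
  have h3 : E / lam = D / T / lam + C * ((1 + K) / lam) + C * T * (2 * ((1 + K) / lam)) := by
    rw [hE]; ring
  rw [h3]
  linarith

end

/-! ### Sine series -/

lemma fourierCoeffOn_neg_one_one {b : ℝ} (hb : b = 1) (hab : (-1 : ℝ) < b) (F : ℝ → ℂ) (n : ℤ) :
    fourierCoeffOn hab F n =
      1 / 2 * ∫ x in (-1 : ℝ)..1, Complex.exp (-(Real.pi * n * x) * Complex.I) * F x := by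
  subst hb
  rw [fourierCoeffOn_eq_integral, Complex.real_smul]
  congr 1
  · norm_num
  · refine intervalIntegral.integral_congr fun x _ => ?_
    simp only [fourier_coe_apply, smul_eq_mul]
    congr 2
    push_cast
    ring

/-- The odd extension of a function on `[0, 1]`, complex valued. -/
noncomputable def oddExt (f : ℝ → ℝ) (x : ℝ) : ℂ := if 0 ≤ x then (f x : ℂ) else -(f (-x) : ℂ)

lemma continuousOn_oddExt {f : ℝ → ℝ} (hf : ContinuousOn f (Icc 0 1)) (h0 : f 0 = 0) :
    ContinuousOn (oddExt f) (Icc (-1) 1) := by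
  have hset : Icc (-1 : ℝ) 1 = Icc (-1) 0 ∪ Icc 0 1 :=
    (Icc_union_Icc_eq_Icc (by norm_num) (by norm_num)).symm
  rw [hset]
  refine ContinuousOn.union_of_isClosed ?_ ?_ isClosed_Icc isClosed_Icc
  · have h1 : ContinuousOn (fun x : ℝ => -(f (-x) : ℂ)) (Icc (-1) 0) :=
      (Complex.continuous_ofReal.comp_continuousOn (hf.comp continuousOn_neg fun x hx =>
        ⟨by linarith [hx.2], by linarith [hx.1]⟩)).neg
    refine h1.congr fun x hx => ?_
    rcases hx.2.eq_or_lt with h | h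
    · simp [h, oddExt, h0]
    · simp [oddExt, not_le.2 h]
  · refine (Complex.continuous_ofReal.comp_continuousOn hf).congr fun x hx => ?_
    simp [oddExt, hx.1]

/-- The Fourier coefficients of the odd extension are, up to the factor `-i`, the sine integrals. -/
lemma fourierCoeffOn_oddExt {b : ℝ} (hb : b = 1) (hab : (-1 : ℝ) < b) {f : ℝ → ℝ}
    (hf : ContinuousOn f (Icc 0 1)) (h0 : f 0 = 0) (n : ℤ) :
    fourierCoeffOn hab (oddExt f) n =
      -Complex.I * ((∫ x in (0 : ℝ)..1, f x * Real.sin (n * Real.pi * x) : ℝ) : ℂ) := by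
  rw [fourierCoeffOn_neg_one_one hb]
  have hc : ContinuousOn (fun x : ℝ => Complex.exp (-(Real.pi * n * x) * Complex.I) * oddExt f x)
      (Icc (-1) 1) := by
    refine ContinuousOn.mul ?_ (continuousOn_oddExt hf h0)
    fun_prop
  have i1 : IntervalIntegrable
      (fun x : ℝ => Complex.exp (-(Real.pi * n * x) * Complex.I) * oddExt f x) volume (-1) 0 :=
    (hc.mono (Icc_subset_Icc_right zero_le_one)).intervalIntegrable_of_Icc (by norm_num)
  have i2 : IntervalIntegrable
      (fun x : ℝ => Complex.exp (-(Real.pi * n * x) * Complex.I) * oddExt f x) volume 0 1 :=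
    (hc.mono (Icc_subset_Icc_left (by norm_num))).intervalIntegrable_of_Icc (by norm_num)
  rw [← intervalIntegral.integral_add_adjacent_intervals i1 i2]
  have e1 := intervalIntegral.integral_comp_neg (a := 0) (b := 1)
    (fun x : ℝ => Complex.exp (-(Real.pi * n * x) * Complex.I) * oddExt f x)
  rw [neg_zero] at e1
  have i3 : IntervalIntegrable
      (fun x : ℝ => Complex.exp (-(Real.pi * n * ((-x : ℝ) : ℂ)) * Complex.I)
      * oddExt f (-x)) volume 0 1 := by
    have : ContinuousOn (fun x : ℝ => Complex.exp (-(Real.pi * n * ((-x : ℝ) : ℂ)) * Complex.I)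
      * oddExt f (-x)) (Icc 0 1) :=
      hc.comp continuousOn_neg fun x hx => ⟨by linarith [hx.2], by linarith [hx.1]⟩
    exact this.intervalIntegrable_of_Icc zero_le_one
  rw [← e1, ← intervalIntegral.integral_add i3 i2, ← intervalIntegral.integral_ofReal,
    ← intervalIntegral.integral_const_mul, ← intervalIntegral.integral_const_mul]
  refine intervalIntegral.integral_congr fun x hx => ?_
  rw [uIcc_of_le zero_le_one] at hx
  have e2 : oddExt f x = f x := by simp [oddExt, hx.1]
  have e3 : oddExt f (-x) = -f x := by
    rcases hx.1.eq_or_lt with h | h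
    · simp [← h, oddExt, h0]
    · simp [oddExt, not_le.2 h]
  simp only [e2, e3]
  push_cast
  rw [Complex.sin, show -((Real.pi : ℂ) * n * -x) * Complex.I = n * Real.pi * x * Complex.I by ring,
    show -((Real.pi : ℂ) * n * x) * Complex.I = -(n * Real.pi * x) * Complex.I by ring]
  have hI : Complex.I * Complex.I = -1 := Complex.I_mul_I
  linear_combination ((1 / 2) * f x * (Complex.exp (-(n * Real.pi * x) * Complex.I)
    - Complex.exp (n * Real.pi * x * Complex.I))) * hI

/-- A continuous function on `[0, 1]` vanishing at the end points, with absolutely summable sine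
coefficients, is the sum of its sine series. -/
theorem hasSum_sineSeries {f : ℝ → ℝ} (hf : ContinuousOn f (Icc 0 1)) (h0 : f 0 = 0) (h1 : f 1 = 0)
    (hs : Summable fun k : ℕ => sineCoeff f (k + 1)) {x : ℝ} (hx : x ∈ Icc (0 : ℝ) 1) :
    HasSum (fun k : ℕ => sineCoeff f (k + 1) * Real.sin ((k + 1 : ℕ) * Real.pi * x)) (f x) := by
  have : Fact ((0 : ℝ) < 2) := ⟨two_pos⟩
  have hcont : Continuous (AddCircle.liftIco (2 : ℝ) (-1) (oddExt f)) := by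
    refine AddCircle.liftIco_continuous ?_ ?_
    · norm_num [oddExt, h1]
    · rw [show (-1 : ℝ) + 2 = 1 by norm_num]
      exact continuousOn_oddExt hf h0
  set F : C(AddCircle (2 : ℝ), ℂ) := ⟨_, hcont⟩ with hF
  set σ : ℤ → ℝ := fun n => ∫ x in (0 : ℝ)..1, f x * Real.sin (n * Real.pi * x) with hσ
  have hcoef : ∀ n : ℤ, fourierCoeff F n = -Complex.I * (σ n : ℂ) := fun n => by
    rw [hF, ContinuousMap.coe_mk, fourierCoeff_liftIco_eq,
      fourierCoeffOn_oddExt (by norm_num) _ hf h0]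
  have hσneg : ∀ n : ℤ, σ (-n) = -σ n := fun n => by
    simp only [hσ]
    rw [← intervalIntegral.integral_neg]
    refine intervalIntegral.integral_congr fun x _ => ?_
    push_cast
    rw [neg_mul, neg_mul, Real.sin_neg]
    ring
  have hσ0 : σ 0 = 0 := by simp [hσ]
  have hσk : ∀ k : ℕ, sineCoeff f k = 2 * σ k := fun k => by simp [hσ, sineCoeff]
  have hσsum : Summable fun k : ℕ => σ k := by
    rw [← summable_nat_add_iff 1]
    refine (hs.mul_left (1 / 2)).congr fun k => ?_
    rw [hσk]
    push_cast
    ring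
  have hσsumC : Summable fun k : ℕ => -Complex.I * ((σ k : ℝ) : ℂ) :=
    (Complex.summable_ofReal.2 hσsum).mul_left _
  have hsum : Summable (fourierCoeff F) := by
    rw [summable_int_iff_summable_nat_and_neg]
    simp_rw [hcoef, hσneg]
    refine ⟨hσsumC, ?_⟩
    refine hσsumC.neg.congr fun k => ?_
    push_cast
    ring
  rcases hx.2.eq_or_lt with hx1 | hx1
  · rw [hx1, h1]
    convert hasSum_zero using 2 with k
    rw [mul_one, Real.sin_nat_mul_pi, mul_zero]
  have hpt := has_pointwise_sum_fourier_series_of_summable hsum (x : AddCircle (2 : ℝ))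
  have hFx : F (x : AddCircle (2 : ℝ)) = f x := by
    rw [hF, ContinuousMap.coe_mk, AddCircle.liftIco_coe_apply ⟨by linarith [hx.1], by linarith⟩]
    simp [oddExt, hx.1]
  rw [hFx] at hpt
  have h2 := hpt.nat_add_neg
  rw [hcoef 0, hσ0, Complex.ofReal_zero, mul_zero, zero_smul, add_zero] at h2
  have h3 : ∀ n : ℕ, fourierCoeff F n • fourier (n : ℤ) (x : AddCircle (2 : ℝ)) +
      fourierCoeff F (-(n : ℤ)) • fourier (-(n : ℤ)) (x : AddCircle (2 : ℝ)) =
      ((sineCoeff f n * Real.sin (n * Real.pi * x) : ℝ) : ℂ) := fun n => by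
    rw [hcoef, hcoef, hσneg, hσk, fourier_coe_apply, fourier_coe_apply, smul_eq_mul, smul_eq_mul]
    push_cast
    rw [Complex.sin,
      show 2 * (Real.pi : ℂ) * Complex.I * n * x / 2 = n * Real.pi * x * Complex.I by ring,
      show 2 * (Real.pi : ℂ) * Complex.I * -n * x / 2 = -(n * Real.pi * x) * Complex.I by ring]
    ring
  simp_rw [h3] at h2
  have h4 := Complex.hasSum_ofReal.1 h2
  rw [← hasSum_nat_add_iff' 1] at h4
  simpa using h4

/-- Bessel's inequality for cosines on `(0, 1)`. -/
lemma summable_sq_integral_cos {ψ : ℝ → ℝ} (hψ : MemLp ψ 2 (volume.restrict (Ioo 0 1))) :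
    Summable fun k : ℕ => (∫ x in (0 : ℝ)..1, ψ x * Real.cos (k * Real.pi * x)) ^ 2 := by
  set F : ℝ → ℂ := (Ioo (0 : ℝ) 1).indicator fun x => (ψ x : ℂ) with hF
  have hab : (-1 : ℝ) < 1 := by norm_num
  have hsub : Ioo (0 : ℝ) 1 ⊆ Ioc (-1) 1 := fun x hx => ⟨by linarith [hx.1], hx.2.le⟩
  have hL2 : MemLp F 2 (volume.restrict (Ioc (-1) 1)) := by
    rw [hF, memLp_indicator_iff_restrict measurableSet_Ioo,
      Measure.restrict_restrict measurableSet_Ioo,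
      inter_eq_self_of_subset_left hsub]
    exact hψ.ofReal
  have hs := (hasSum_sq_fourierCoeffOn hab hL2).summable
  have hs' : Summable fun k : ℕ => 4 * ‖fourierCoeffOn hab F (k : ℤ)‖ ^ 2 :=
    (summable_int_iff_summable_nat_and_neg.1 hs).1.mul_left 4
  have hψi : IntegrableOn ψ (Ioo 0 1) := hψ.integrable (by norm_num)
  refine Summable.of_nonneg_of_le (fun k => sq_nonneg _) (fun k => ?_) hs'
  have hint : IntegrableOn (fun x : ℝ => Complex.exp (-(Real.pi * k * x) * Complex.I) * (ψ x : ℂ))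
      (Ioo 0 1) := by
    refine hψi.ofReal.bdd_mul (c := 1) ?_ ?_
    · exact Continuous.aestronglyMeasurable (by fun_prop)
    · refine Eventually.of_forall fun x => ?_
      rw [show -((Real.pi : ℂ) * k * x) * Complex.I = ((-(Real.pi * k * x) : ℝ) : ℂ) * Complex.I by
        push_cast; ring, Complex.norm_exp_ofReal_mul_I]
  have hcoef : fourierCoeffOn hab F (k : ℤ) =
      1 / 2 * ∫ x in Ioo (0 : ℝ) 1, Complex.exp (-(Real.pi * k * x) * Complex.I) * (ψ x : ℂ) := by
    rw [fourierCoeffOn_neg_one_one rfl, intervalIntegral.integral_of_le hab.le]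
    congr 1
    have : ∀ x : ℝ, Complex.exp (-(Real.pi * ((k : ℤ) : ℂ) * x) * Complex.I) * F x =
        (Ioo (0 : ℝ) 1).indicator
          (fun x : ℝ => Complex.exp (-(Real.pi * k * x) * Complex.I) * (ψ x : ℂ)) x := fun x => by
      simp only [hF, indicator]
      split_ifs <;> simp
    simp_rw [this]
    rw [integral_indicator measurableSet_Ioo, Measure.restrict_restrict measurableSet_Ioo,
      inter_eq_self_of_subset_left hsub]
  have hre : (∫ x in Ioo (0 : ℝ) 1, Complex.exp (-(Real.pi * k * x) * Complex.I) * (ψ x : ℂ)).re =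
      ∫ x in (0 : ℝ)..1, ψ x * Real.cos (k * Real.pi * x) := by
    rw [intervalIntegral.integral_of_le zero_le_one, integral_Ioc_eq_integral_Ioo]
    have h1 : ∫ x in Ioo (0 : ℝ) 1, (Complex.exp (-(Real.pi * k * x) * Complex.I) * (ψ x : ℂ)).re =
        (∫ x in Ioo (0 : ℝ) 1, Complex.exp (-(Real.pi * k * x) * Complex.I) * (ψ x : ℂ)).re :=
      integral_re hint
    rw [← h1]
    refine integral_congr_ae (Eventually.of_forall fun x => ?_)
    simp only
    rw [Complex.re_mul_ofReal,
      show -((Real.pi : ℂ) * k * x) * Complex.I = ((-(Real.pi * k * x) : ℝ) : ℂ) * Complex.I by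
        push_cast; ring, Complex.exp_ofReal_mul_I_re, Real.cos_neg, mul_comm,
      mul_comm Real.pi]
  rw [← hre, hcoef, norm_mul, mul_pow]
  have h2 := Complex.abs_re_le_norm
    (∫ x in Ioo (0 : ℝ) 1, Complex.exp (-(Real.pi * k * x) * Complex.I) * (ψ x : ℂ))
  have h3 := pow_le_pow_left₀ (abs_nonneg _) h2 2
  rw [sq_abs] at h3
  refine h3.trans (le_of_eq ?_)
  norm_num
  ring

/-- Two integrations by parts against a sine vanishing at both end points. -/
lemma integral_mul_sin_of_hasDerivAt {f f' f'' : ℝ → ℝ} {k : ℕ} (hk : k ≠ 0)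
    (hf : ContinuousOn f (Icc 0 1)) (hf' : ContinuousOn f' (Icc 0 1))
    (hf'' : IntervalIntegrable f'' volume 0 1)
    (hd : ∀ x ∈ Ioo (0 : ℝ) 1, HasDerivAt f (f' x) x)
    (hd' : ∀ x ∈ Ioo (0 : ℝ) 1, HasDerivAt f' (f'' x) x) (h0 : f 0 = 0) (h1 : f 1 = 0) :
    ∫ x in (0 : ℝ)..1, f'' x * Real.sin (k * Real.pi * x) =
      -(k * Real.pi) ^ 2 * ∫ x in (0 : ℝ)..1, f x * Real.sin (k * Real.pi * x) := by
  set ω := (k : ℝ) * Real.pi with hω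
  have hω0 : ω ≠ 0 := mul_ne_zero (Nat.cast_ne_zero.2 hk) Real.pi_ne_zero
  have hsin : ∀ x : ℝ, HasDerivAt (fun x => Real.sin (ω * x)) (ω * Real.cos (ω * x)) x :=
      fun x => by
    have := (Real.hasDerivAt_sin (ω * x)).comp x ((hasDerivAt_id x).const_mul ω)
    exact HasDerivAt.congr_deriv (f := fun x => Real.sin (ω * x)) this (by ring)
  have hcos : ∀ x : ℝ, HasDerivAt (fun x => ω * Real.cos (ω * x)) (-ω ^ 2 * Real.sin (ω * x)) x :=
    fun x => by
    have := ((Real.hasDerivAt_cos (ω * x)).comp x ((hasDerivAt_id x).const_mul ω)).const_mul ω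
    exact HasDerivAt.congr_deriv (f := fun x => ω * Real.cos (ω * x)) this (by ring)
  have hu : uIcc (0 : ℝ) 1 = Icc 0 1 := uIcc_of_le zero_le_one
  have e1 := intervalIntegral.integral_mul_deriv_eq_deriv_mul_of_hasDerivAt
    (a := 0) (b := 1) (u := fun x => Real.sin (ω * x)) (v := f')
    (by fun_prop) (by rwa [hu]) (fun x _ => hsin x)
    (fun x hx => hd' x (by simpa using hx))
    (Continuous.intervalIntegrable (by fun_prop) _ _) hf''
  have e2 := intervalIntegral.integral_mul_deriv_eq_deriv_mul_of_hasDerivAt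
    (a := 0) (b := 1) (u := fun x => ω * Real.cos (ω * x)) (v := f)
    (by fun_prop) (by rwa [hu]) (fun x _ => hcos x)
    (fun x hx => hd x (by simpa using hx))
    (Continuous.intervalIntegrable (by fun_prop) _ _)
    (by rw [← hu] at hf'; exact hf'.intervalIntegrable)
  have hs1 : Real.sin (ω * 1) = 0 := by rw [mul_one, hω, Real.sin_nat_mul_pi]
  rw [e2, h0, h1, hs1, mul_zero, Real.sin_zero] at e1
  simp only [mul_zero, zero_mul, sub_zero, zero_sub, neg_neg] at e1
  calc ∫ x in (0 : ℝ)..1, f'' x * Real.sin (ω * x)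
      = ∫ x in (0 : ℝ)..1, Real.sin (ω * x) * f'' x := by simp_rw [mul_comm]
    _ = ∫ x in (0 : ℝ)..1, -ω ^ 2 * Real.sin (ω * x) * f x := e1
    _ = _ := by
        rw [← intervalIntegral.integral_const_mul]
        exact intervalIntegral.integral_congr fun x _ => by ring

/-- Integration by parts for a primitive `Ψ` of an integrable function, vanishing at both ends. -/
lemma integral_primitive_mul_sin {ψ : ℝ → ℝ} (hψ : IntervalIntegrable ψ volume 0 1)
    (h1 : ∫ y in (0 : ℝ)..1, ψ y = 0) {ω : ℝ} (hω : ω ≠ 0) :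
    ω * ∫ x in (0 : ℝ)..1, (∫ y in (0 : ℝ)..x, ψ y) * Real.sin (ω * x) =
      ∫ x in (0 : ℝ)..1, ψ x * Real.cos (ω * x) := by
  have hAC := hψ.absolutelyContinuousOnInterval_intervalIntegral (c := 0) left_mem_uIcc
  have hcd : ContDiff ℝ 1 fun x => -Real.cos (ω * x) / ω := by fun_prop
  have hAC2 : AbsolutelyContinuousOnInterval (fun x => -Real.cos (ω * x) / ω) 0 1 :=
    hcd.contDiffOn.absolutelyContinuousOnInterval
  have h := hAC.integral_mul_deriv_eq_deriv_mul hAC2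
  rw [h1, intervalIntegral.integral_same, zero_mul, zero_mul, sub_zero, zero_sub] at h
  have hd : ∀ x, deriv (fun x => -Real.cos (ω * x) / ω) x = Real.sin (ω * x) := fun x => by
    have := (((Real.hasDerivAt_cos (ω * x)).comp x ((hasDerivAt_id x).const_mul ω)).neg).div_const ω
    exact (HasDerivAt.congr_deriv (f := fun x => -Real.cos (ω * x) / ω) this (by field_simp)).deriv
  simp_rw [hd] at h
  rw [h, ← intervalIntegral.integral_neg, ← intervalIntegral.integral_const_mul]
  refine intervalIntegral.integral_congr_ae ?_
  filter_upwards [hψ.ae_hasDerivAt_integral] with x hx hx'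
  rw [(hx (uIoc_subset_uIcc hx') 0 left_mem_uIcc).deriv]
  field_simp

/-- The sine coefficients of admissible data are summable with the weight `(k π)²`. -/
theorem IsAdmissibleData.summable_sineCoeff {φ : ℝ → ℝ} (hφ : IsAdmissibleData φ) :
    Summable fun k : ℕ => (((k + 1 : ℕ) : ℝ) * Real.pi) ^ 2 * |sineCoeff φ (k + 1)| := by
  obtain ⟨ψ, hψ, hint⟩ := hφ.third
  have hψi : IntervalIntegrable ψ volume 0 1 := by
    rw [intervalIntegrable_iff_integrableOn_Ioo_of_le zero_le_one]
    exact hψ.integrable (by norm_num)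
  have hψ1 : ∫ y in (0 : ℝ)..1, ψ y = 0 := by
    have := hint 1 ⟨zero_le_one, le_rfl⟩
    rw [hφ.second_left, hφ.second_right, zero_add] at this
    exact this.symm
  have hU : UniqueDiffOn ℝ (Icc (0 : ℝ) 1) := uniqueDiffOn_Icc zero_lt_one
  have hc1 : ContDiffOn ℝ 1 (derivWithin φ (Icc 0 1)) (Icc 0 1) :=
    hφ.contDiff.derivWithin hU (by norm_num)
  have hc2 : ContinuousOn (derivWithin (derivWithin φ (Icc 0 1)) (Icc 0 1)) (Icc 0 1) :=
    hc1.continuousOn_derivWithin hU le_rfl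
  have hit : ∀ x, iteratedDerivWithin 2 φ (Icc 0 1) x =
      derivWithin (derivWithin φ (Icc 0 1)) (Icc 0 1) x := fun x => by
    rw [iteratedDerivWithin_succ]
    congr 1
    exact iteratedDerivWithin_one
  have hpart : ∀ k : ℕ, k ≠ 0 → ((k : ℝ) * Real.pi) ^ 2 * |sineCoeff φ k| =
      2 / (k * Real.pi) * |∫ x in (0 : ℝ)..1, ψ x * Real.cos (k * Real.pi * x)| := by
    intro k hk
    have hω : 0 < (k : ℝ) * Real.pi :=
      mul_pos (Nat.cast_pos.2 (Nat.pos_of_ne_zero hk)) Real.pi_pos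
    have h1 := integral_mul_sin_of_hasDerivAt hk hφ.contDiff.continuousOn hc1.continuousOn
      (hc2.intervalIntegrable_of_Icc zero_le_one)
      (fun x hx => ((hφ.contDiff.differentiableOn (by norm_num) x
        (Ioo_subset_Icc_self hx)).hasDerivWithinAt).hasDerivAt (Icc_mem_nhds hx.1 hx.2))
      (fun x hx => ((hc1.differentiableOn (by norm_num) x
        (Ioo_subset_Icc_self hx)).hasDerivWithinAt).hasDerivAt (Icc_mem_nhds hx.1 hx.2))
      hφ.zero_left hφ.zero_right
    have h2 := integral_primitive_mul_sin hψi hψ1 hω.ne'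
    have h3 : ∫ x in (0 : ℝ)..1, (∫ y in (0 : ℝ)..x, ψ y) * Real.sin (k * Real.pi * x) =
        ∫ x in (0 : ℝ)..1, derivWithin (derivWithin φ (Icc 0 1)) (Icc 0 1) x *
          Real.sin (k * Real.pi * x) := by
      refine intervalIntegral.integral_congr fun x hx => ?_
      rw [uIcc_of_le zero_le_one] at hx
      have := hint x hx
      rw [hφ.second_left, zero_add, hit] at this
      simp only [this]
    rw [h3, h1] at h2
    rw [← h2, sineCoeff, abs_mul 2, abs_mul (k * Real.pi), abs_mul (-(k * Real.pi) ^ 2), abs_neg,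
      abs_of_pos hω, abs_two,
      abs_of_nonneg (sq_nonneg (k * Real.pi))]
    field_simp
  have hsq : Summable fun k : ℕ =>
      (∫ x in (0 : ℝ)..1, ψ x * Real.cos ((k + 1 : ℕ) * Real.pi * x)) ^ 2 :=
    (summable_nat_add_iff (f := fun k : ℕ =>
      (∫ x in (0 : ℝ)..1, ψ x * Real.cos (k * Real.pi * x)) ^ 2) 1).2 (summable_sq_integral_cos hψ)
  have hinv : Summable fun k : ℕ => 1 / (((k + 1 : ℕ) : ℝ) * Real.pi) ^ 2 := by
    have h1 : Summable fun k : ℕ => 1 / ((k + 1 : ℕ) : ℝ) ^ 2 :=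
      (summable_nat_add_iff (f := fun k : ℕ => 1 / (k : ℝ) ^ 2) 1).2
        (Real.summable_one_div_nat_pow.2 one_lt_two)
    have h2 : (fun k : ℕ => 1 / (((k + 1 : ℕ) : ℝ) * Real.pi) ^ 2) =
        fun k : ℕ => 1 / ((k + 1 : ℕ) : ℝ) ^ 2 * (1 / Real.pi ^ 2) := by
      funext k
      rw [mul_pow, one_div_mul_one_div]
    rw [h2]
    exact h1.mul_right _
  have hle : ∀ k : ℕ, (((k + 1 : ℕ) : ℝ) * Real.pi) ^ 2 * |sineCoeff φ (k + 1)| ≤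
      (∫ x in (0 : ℝ)..1, ψ x * Real.cos ((k + 1 : ℕ) * Real.pi * x)) ^ 2 +
        1 / (((k + 1 : ℕ) : ℝ) * Real.pi) ^ 2 := fun k => by
    rw [hpart (k + 1) k.succ_ne_zero]
    generalize (∫ x in (0 : ℝ)..1, ψ x * Real.cos ((k + 1 : ℕ) * Real.pi * x)) = d
    generalize ((k + 1 : ℕ) : ℝ) * Real.pi = ω
    have := sq_nonneg (|d| - 1 / ω)
    rw [sub_sq, sq_abs, div_pow, one_pow] at this
    have e : 2 * |d| * (1 / ω) = 2 / ω * |d| := by ring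
    linarith
  exact Summable.of_nonneg_of_le (fun k => mul_nonneg (sq_nonneg _) (abs_nonneg _)) hle
    (hsq.add hinv)

/-! ### Fractional integral form of the equation -/

section

variable {T s C γ : ℝ}

lemma MemCNegOne.exists_powerBdd {v : ℝ → ℝ → ℝ} (hv : MemCNegOne T v) :
    ∃ s C, 0 < s ∧ 0 ≤ C ∧ PowerBdd T s C v := by
  obtain ⟨p, hp, f, hf, hvf⟩ := hv
  obtain ⟨C, hC⟩ := (isCompact_Icc.prod isCompact_Icc).exists_bound_of_continuousOn hf
  refine ⟨p + 1, max C 0, by linarith, le_max_right _ _, ?_, fun t ht x hx => ?_⟩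
  · have h1 : ContinuousOn (fun q : ℝ × ℝ => q.1 ^ p * f q.1 q.2) (Ioc 0 T ×ˢ Icc 0 1) :=
      (continuousOn_fst.rpow_const fun q hq => Or.inl (ne_of_gt hq.1.1)).mul
        (hf.mono (prod_mono_left Ioc_subset_Icc_self))
    exact h1.congr fun q hq => hvf q.1 hq.1 q.2 hq.2
  · have h1 := hC (t, x) ⟨Ioc_subset_Icc_self ht, hx⟩
    have h2 : 0 ≤ t ^ p := Real.rpow_nonneg ht.1.le _
    rw [hvf t ht x hx, abs_mul, abs_of_nonneg h2, add_sub_cancel_right, mul_comm]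
    exact mul_le_mul_of_nonneg_right (h1.trans (le_max_left _ _)) h2

lemma PowerBdd.exists_rlInt {f : ℝ → ℝ → ℝ} (hf : PowerBdd T s C f) (hs : 0 < s) (hγ : 0 ≤ γ) :
    ∃ C', PowerBdd T (s + γ) C' (fun t x => _root_.rlInt γ (fun z => f z x) t) := by
  rcases hγ.eq_or_lt with rfl | hγ
  · simp only [rlInt_zero, add_zero]; exact ⟨C, hf⟩
  · exact ⟨_, hf.rlInt hs hγ⟩

lemma PowerBdd₁.exists_rlInt {f : ℝ → ℝ} (hf : PowerBdd₁ T s C f) (hs : 0 < s) (hγ : 0 ≤ γ) :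
    ∃ C', PowerBdd₁ T (s + γ) C' (_root_.rlInt γ f) := by
  obtain ⟨C', h⟩ := hf.const.exists_rlInt hs hγ
  exact ⟨C', h.slice (x := 0) ⟨le_rfl, zero_le_one⟩⟩

/-- Fundamental theorem of calculus on `(0, T]` for a function vanishing at `0+`. -/
lemma PowerBdd₁.eq_integral {J w : ℝ → ℝ} (hw : PowerBdd₁ T s C w) (hs : 0 < s)
    (hd : ∀ t ∈ Ioc 0 T, HasDerivWithinAt J (w t) (Ioc 0 T) t)
    (h0 : Tendsto J (𝓝[>] 0) (𝓝 0)) {t : ℝ} (ht : t ∈ Ioc 0 T) :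
    J t = ∫ z in (0 : ℝ)..t, w z := by
  have hb : Tendsto J (𝓝[<] t) (𝓝 (J t)) := by
    rw [← nhdsWithin_Ioo_eq_nhdsLT ht.1]
    exact ((hd t ht).continuousWithinAt.mono
      fun z hz => ⟨hz.1, hz.2.le.trans ht.2⟩ : ContinuousWithinAt J (Ioo 0 t) t)
  rw [intervalIntegral.integral_eq_sub_of_hasDerivAt_of_tendsto ht.1 (fun z hz => ?_)
    (hw.intervalIntegrable hs ht) h0 hb, sub_zero]
  exact (hd z ⟨hz.1, hz.2.le.trans ht.2⟩).hasDerivAt (Ioc_mem_nhds hz.1 (hz.2.trans_le ht.2))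

/-- Inversion of the fractional integral: `I^γ v = I^1 w` forces `v = I^{1-γ} w`. -/
lemma PowerBdd₁.eq_rlInt_of_rlInt_eq {s' C' : ℝ} {v w : ℝ → ℝ}
    (hv : PowerBdd₁ T s C v) (hs : 0 < s) (hw : PowerBdd₁ T s' C' w) (hs' : 0 < s')
    (hγ : 0 ≤ γ) (hγ1 : γ ≤ 1)
    (h : ∀ t ∈ Ioc 0 T, _root_.rlInt γ v t = ∫ z in (0 : ℝ)..t, w z) {t : ℝ} (ht : t ∈ Ioc 0 T) :
    v t = _root_.rlInt (1 - γ) w t := by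
  have hδ : 0 ≤ 1 - γ := by linarith
  obtain ⟨K, hK⟩ := hw.exists_rlInt hs' hδ
  have hTpos : 0 < T := ht.1.trans_le ht.2
  have hIoo : EqOn v (_root_.rlInt (1 - γ) w) (Ioo 0 T) := by
    refine eqOn_of_integral_eq (hv.1.mono Ioo_subset_Ioc_self) (hK.1.mono Ioo_subset_Ioc_self)
      (fun r hr => hv.intervalIntegrable hs (Ioo_subset_Ioc_self hr))
      (fun r hr => hK.intervalIntegrable (by linarith) (Ioo_subset_Ioc_self hr)) fun r hr => ?_
    have hr' := Ioo_subset_Ioc_self hr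
    rw [← rlInt_one, ← rlInt_one]
    have e1 := hv.rlInt_rlInt hs hδ hγ hr'
    have e2 := hw.rlInt_rlInt hs' hδ zero_le_one hr'
    have e3 := hw.rlInt_rlInt hs' zero_le_one hδ hr'
    rw [sub_add_cancel] at e1
    rw [← e1, e3, add_comm, ← e2]
    refine rlInt_congr hr.1 fun z hz => ?_
    rw [h z ⟨hz.1, hz.2.trans hr'.2⟩, rlInt_one]
  refine hIoo.of_subset_closure hv.1 hK.1 Ioo_subset_Ioc_self ?_ ht
  rw [closure_Ioo hTpos.ne]
  exact Ioc_subset_Icc_self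

/-- If `V = I^α Q`, then the primitive of the Hilfer derivative of `V` of a lower order `α'` is that
of `I^{α-α'} Q`. Only the bare existence of the Hilfer derivative and its initial condition are
used. -/
lemma integral_hilferDeriv_eq {α α' β : ℝ} (hα' : 0 < α') (hα'α : α' < α) (hα1 : α < 1)
    (hβ : β ∈ Icc (0 : ℝ) 1) {V Q : ℝ → ℝ} (hQ : PowerBdd₁ T s C Q) (hs : 0 < s)
    (hV : ∀ t ∈ Ioc 0 T, V t = rlInt α Q t) (hex : HilferExists α' β T V)
    (h0 : Tendsto (rlInt ((1 - β) * (1 - α')) V) (𝓝[>] 0) (𝓝 0)) {t : ℝ} (ht : t ∈ Ioo 0 T) :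
    IntervalIntegrable (hilferDeriv α' β V) volume 0 t ∧
    ∫ z in (0 : ℝ)..t, hilferDeriv α' β V z = ∫ z in (0 : ℝ)..t, rlInt (α - α') Q z := by
  set γ := (1 - β) * (1 - α') with hγ
  set η := β * (1 - α') with hη
  have hγ0 : 0 ≤ γ := mul_nonneg (by linarith [hβ.2]) (by linarith)
  have hη0 : 0 ≤ η := mul_nonneg hβ.1 (by linarith)
  have hsum : η + γ = 1 - α' := by rw [hγ, hη]; ring
  have ht' := Ioo_subset_Ioc_self ht
  set w := deriv (rlInt γ V) with hw
  have hwint : ∀ r ∈ Ioo 0 T, IntervalIntegrable w volume 0 r := fun r hr => (hex r hr).2.1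
  -- `I^1 w = I^γ V = I^{γ+α} Q`
  have hprim : ∀ r ∈ Ioo 0 T, ∫ z in (0 : ℝ)..r, w z = rlInt (γ + α) Q r := by
    intro r hr
    have hd : ∀ z ∈ Ioo 0 T, HasDerivAt (rlInt γ V) (w z) z := fun z hz => (hex z hz).1.hasDerivAt
    have hb : Tendsto (rlInt γ V) (𝓝[<] r) (𝓝 (rlInt γ V r)) :=
      (hd r hr).continuousAt.tendsto.mono_left nhdsWithin_le_nhds
    rw [intervalIntegral.integral_eq_sub_of_hasDerivAt_of_tendsto hr.1
      (fun z hz => hd z ⟨hz.1, hz.2.trans hr.2⟩) (hwint r hr) h0 hb, sub_zero,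
      ← hQ.rlInt_rlInt hs hγ0 (by linarith) (Ioo_subset_Ioc_self hr)]
    exact rlInt_congr hr.1 fun z hz => hV z ⟨hz.1, hz.2.trans hr.2.le⟩
  have hQsum : ∫ z in (0 : ℝ)..t, rlInt (α - α') Q z = rlInt (η + (γ + α)) Q t := by
    rw [← rlInt_one, hQ.rlInt_rlInt hs zero_le_one (by linarith) ht',
      show η + (γ + α) = 1 + (α - α') by linarith]
  change IntervalIntegrable (rlInt η w) volume 0 t ∧ ∫ z in (0 : ℝ)..t, rlInt η w z = _
  rw [hQsum]
  rcases hη0.eq_or_lt with h | h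
  · rw [← h, rlInt_zero, zero_add]
    exact ⟨hwint t ht, hprim t ht⟩
  · have hm : AEStronglyMeasurable w (volume.restrict (Ioo 0 t)) :=
      ((intervalIntegrable_iff_integrableOn_Ioo_of_le ht.1.le).1 (hwint t ht)).aestronglyMeasurable
    have hk : IntervalIntegrable (fun z => (t - z) ^ η * w z) volume 0 t := by
      refine (hwint t ht).continuousOn_mul ?_
      exact ((continuous_const.sub continuous_id).rpow_const fun _ => Or.inr h.le).continuousOn
    obtain ⟨i1, e1⟩ := intervalIntegrable_and_rlInt_rlInt one_pos h ht.1 hm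
      (by rwa [add_sub_cancel_left])
    have e2 := rlInt_rlInt h one_pos ht.1 hm (by rwa [add_sub_cancel_right])
    refine ⟨by simpa using i1, ?_⟩
    rw [← rlInt_one, e1, add_comm, ← e2, ← hQ.rlInt_rlInt hs hη0 (by linarith) ht']
    refine rlInt_congr ht.1 fun z hz => ?_
    rw [rlInt_one, hprim z ⟨hz.1, hz.2.trans_lt ht.2⟩]

/-- Green's formula for a function that vanishes at the end points and whose second derivative in
the open interval extends continuously to the closed one. -/
lemma integral_mul_sin_of_deriv_deriv {y r : ℝ → ℝ} {k : ℕ} (hk : k ≠ 0)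
    (hy : ContinuousOn y (Icc 0 1)) (hcd : ContDiffOn ℝ 2 y (Ioo 0 1)) (h0 : y 0 = 0) (h1 : y 1 = 0)
    (hr : ContinuousOn r (Icc 0 1)) (hd : ∀ x ∈ Ioo (0 : ℝ) 1, deriv (deriv y) x = r x) :
    ∫ x in (0 : ℝ)..1, r x * Real.sin (k * Real.pi * x) =
      -(k * Real.pi) ^ 2 * ∫ x in (0 : ℝ)..1, y x * Real.sin (k * Real.pi * x) := by
  have hri : IntervalIntegrable r volume 0 1 := hr.intervalIntegrable_of_Icc zero_le_one
  have hmid : (1 / 2 : ℝ) ∈ uIcc (0 : ℝ) 1 := by rw [uIcc_of_le zero_le_one]; norm_num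
  have hsub : ∀ x ∈ Ioo (0 : ℝ) 1, uIcc (1 / 2) x ⊆ Ioo 0 1 := fun x hx =>
    OrdConnected.uIcc_subset inferInstance (by norm_num) hx
  have hdy : ∀ x ∈ Ioo (0 : ℝ) 1, HasDerivAt (deriv y) (r x) x := fun x hx => by
    rw [← hd x hx]
    have : ContDiffOn ℝ 1 (deriv y) (Ioo 0 1) := hcd.deriv_of_isOpen isOpen_Ioo (by norm_num)
    exact ((this.differentiableOn (by norm_num)).differentiableAt
      (Ioo_mem_nhds hx.1 hx.2)).hasDerivAt
  set y' : ℝ → ℝ := fun x => deriv y (1 / 2) + ∫ z in (1 / 2 : ℝ)..x, r z with hy'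
  have hy'e : ∀ x ∈ Ioo (0 : ℝ) 1, y' x = deriv y x := fun x hx => by
    rw [hy']
    simp only
    rw [intervalIntegral.integral_eq_sub_of_hasDerivAt (f := deriv y)
      (fun z hz => hdy z (hsub x hx hz))]
    · ring
    · exact (hr.mono ((hsub x hx).trans Ioo_subset_Icc_self)).intervalIntegrable
  refine integral_mul_sin_of_hasDerivAt hk hy (f' := y') ?_ hri (fun x hx => ?_) (fun x hx => ?_)
    h0 h1
  · have := intervalIntegral.continuousOn_primitive_interval' hri hmid
    rw [uIcc_of_le zero_le_one] at this
    exact continuousOn_const.add this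
  · rw [hy'e x hx]
    exact ((hcd.differentiableOn (by norm_num)).differentiableAt
      (Ioo_mem_nhds hx.1 hx.2)).hasDerivAt
  · refine (hdy x hx).congr_of_eventuallyEq ?_
    filter_upwards [Ioo_mem_nhds hx.1 hx.2] with z hz using hy'e z hz

/-- Testing against a continuous function of `x` keeps a power bound. -/
lemma PowerBdd.integral_mul {f : ℝ → ℝ → ℝ} (hf : PowerBdd T s C f) {S : ℝ → ℝ}
    (hS : Continuous S) (hS1 : ∀ x, |S x| ≤ 1) :
    PowerBdd₁ T s C (fun t => ∫ x in (0 : ℝ)..1, f t x * S x) := by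
  have hslice : ∀ t ∈ Ioc 0 T, ContinuousOn (fun x => f t x) (Icc 0 1) := fun t ht =>
    hf.1.comp (f := fun x : ℝ => (t, x)) (by fun_prop) fun x hx => ⟨ht, hx⟩
  refine ⟨?_, fun t ht => ?_⟩
  · have h1 : ContinuousOn (fun t => t ^ (s - 1) *
        ∫ x in Ioc (0 : ℝ) 1, t ^ (1 - s) * f t x * S x) (Ioc 0 T) := by
      refine (continuousOn_id.rpow_const fun t ht => Or.inl (ne_of_gt ht.1)).mul ?_
      refine continuousOn_of_dominated (bound := fun _ => C) (fun t ht => ?_) (fun t ht => ?_)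
        (integrable_const _) ?_
      · exact (((continuousOn_const.mul (hslice t ht)).mul hS.continuousOn).mono
          Ioc_subset_Icc_self).aestronglyMeasurable measurableSet_Ioc
      · filter_upwards [ae_restrict_mem measurableSet_Ioc] with x hx
        have h2 := hf.2 t ht x (Ioc_subset_Icc_self hx)
        have h3 : 0 ≤ t ^ (1 - s) := Real.rpow_nonneg ht.1.le _
        have h4 : t ^ (1 - s) * t ^ (s - 1) = 1 := by rw [← Real.rpow_add ht.1]; simp
        rw [Real.norm_eq_abs, abs_mul, abs_mul, abs_of_nonneg h3]
        calc t ^ (1 - s) * |f t x| * |S x| ≤ t ^ (1 - s) * (C * t ^ (s - 1)) * 1 := by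
              gcongr
              · exact mul_nonneg h3 ((abs_nonneg _).trans h2)
              · exact hS1 x
          _ = C * (t ^ (1 - s) * t ^ (s - 1)) := by ring
          _ = C := by rw [h4, mul_one]
      · filter_upwards [ae_restrict_mem measurableSet_Ioc] with x hx
        exact ((continuousOn_id.rpow_const fun t ht => Or.inl (ne_of_gt ht.1)).mul
          (hf.slice (Ioc_subset_Icc_self hx)).1).mul continuousOn_const
    refine h1.congr fun t ht => ?_
    have h4 : t ^ (s - 1) * t ^ (1 - s) = 1 := by rw [← Real.rpow_add ht.1]; simp
    rw [intervalIntegral.integral_of_le zero_le_one]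
    simp_rw [mul_assoc (t ^ (1 - s))]
    rw [integral_const_mul, ← mul_assoc, h4, one_mul]
  · have := intervalIntegral.norm_integral_le_of_norm_le_const (a := 0) (b := 1)
      (C := C * t ^ (s - 1)) (f := fun x => f t x * S x) fun x hx => by
        rw [uIoc_of_le zero_le_one] at hx
        have h2 := hf.2 t ht x (Ioc_subset_Icc_self hx)
        rw [Real.norm_eq_abs, abs_mul]
        calc _ ≤ C * t ^ (s - 1) * 1 :=
              mul_le_mul h2 (hS1 x) (abs_nonneg _) ((abs_nonneg _).trans h2)
          _ = _ := mul_one _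
    simpa using this

/-- Fractional integration in time commutes with testing in space. -/
lemma PowerBdd.integral_rlInt_mul {f : ℝ → ℝ → ℝ} (hf : PowerBdd T s C f) (hs : 0 < s) (hγ : 0 < γ)
    {S : ℝ → ℝ} (hS : Continuous S) (hS1 : ∀ x, |S x| ≤ 1) {t : ℝ} (ht : t ∈ Ioc 0 T) :
    ∫ x in (0 : ℝ)..1, _root_.rlInt γ (fun z => f z x) t * S x =
      _root_.rlInt γ (fun z => ∫ x in (0 : ℝ)..1, f z x * S x) t := by
  have hint : Integrable (Function.uncurry fun x z => (t - z) ^ (γ - 1) * (f z x * S x))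
      ((volume.restrict (Ioc (0 : ℝ) 1)).prod (volume.restrict (Ioo 0 t))) := by
    have hb := ((intervalIntegrable_iff_integrableOn_Ioo_of_le ht.1.le).1
      (intervalIntegrable_beta hγ hs ht.1)).const_mul C
    have hb2 : Integrable (fun q : ℝ × ℝ => (1 : ℝ) * (C * ((t - q.2) ^ (γ - 1) * q.2 ^ (s - 1))))
        ((volume.restrict (Ioc (0 : ℝ) 1)).prod (volume.restrict (Ioo 0 t))) :=
      (integrable_const (1 : ℝ)).mul_prod hb
    refine hb2.mono' ?_ ?_
    · rw [Measure.prod_restrict]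
      refine ContinuousOn.aestronglyMeasurable ?_ (measurableSet_Ioc.prod measurableSet_Ioo)
      refine ContinuousOn.mul ?_ (ContinuousOn.mul ?_ (hS.comp continuous_fst).continuousOn)
      · exact (continuousOn_const.sub continuousOn_snd).rpow_const fun q hq =>
          Or.inl (ne_of_gt (sub_pos.2 hq.2.2))
      · exact hf.1.comp (f := fun q : ℝ × ℝ => (q.2, q.1)) (by fun_prop) fun q hq =>
          ⟨⟨hq.2.1, hq.2.2.le.trans ht.2⟩, Ioc_subset_Icc_self hq.1⟩
    · rw [Measure.prod_restrict]
      filter_upwards [ae_restrict_mem (measurableSet_Ioc.prod measurableSet_Ioo)] with q hq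
      have h2 := hf.2 q.2 ⟨hq.2.1, hq.2.2.le.trans ht.2⟩ q.1 (Ioc_subset_Icc_self hq.1)
      have h3 : 0 ≤ (t - q.2) ^ (γ - 1) := Real.rpow_nonneg (by linarith [hq.2.2]) _
      rw [Function.uncurry, Real.norm_eq_abs, abs_mul, abs_mul, abs_of_nonneg h3]
      calc (t - q.2) ^ (γ - 1) * (|f q.2 q.1| * |S q.1|)
          ≤ (t - q.2) ^ (γ - 1) * (C * q.2 ^ (s - 1) * 1) := by
            refine mul_le_mul_of_nonneg_left ?_ h3
            exact mul_le_mul h2 (hS1 _) (abs_nonneg _) ((abs_nonneg _).trans h2)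
        _ = _ := by ring
  have hswap := integral_integral_swap hint
  simp only [rlInt_of_pos hγ]
  simp_rw [mul_assoc (1 / Real.Gamma γ)]
  rw [intervalIntegral.integral_const_mul, intervalIntegral.integral_of_le zero_le_one,
    intervalIntegral.integral_of_le ht.1.le]
  simp_rw [intervalIntegral.integral_of_le zero_le_one, intervalIntegral.integral_of_le ht.1.le,
    integral_Ioc_eq_integral_Ioo (y := t)]
  congr 1
  rw [show (fun x => (∫ z in Ioo 0 t, (t - z) ^ (γ - 1) * f z x) * S x) =
    fun x => ∫ z in Ioo 0 t, (t - z) ^ (γ - 1) * (f z x * S x) by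
      funext x
      rw [← integral_mul_const]
      simp_rw [mul_assoc], hswap]
  simp_rw [integral_const_mul]

/-- Monotonicity of the fractional integral. -/
lemma abs_rlInt_le_rlInt (hγ : 0 < γ) {f g : ℝ → ℝ} {t : ℝ} (ht : 0 < t)
    (h : ∀ z ∈ Ioc 0 t, |f z| ≤ g z)
    (hg : IntervalIntegrable (fun z => (t - z) ^ (γ - 1) * g z) volume 0 t) :
    |rlInt γ f t| ≤ rlInt γ g t := by
  have hG := Real.Gamma_pos_of_pos hγ
  rw [rlInt_of_pos hγ, rlInt_of_pos hγ, abs_mul, abs_of_pos (by positivity)]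
  refine mul_le_mul_of_nonneg_left ?_ (by positivity)
  rw [← Real.norm_eq_abs]
  refine intervalIntegral.norm_integral_le_of_norm_le ht.le (Eventually.of_forall fun z hz => ?_) hg
  have h2 : 0 ≤ (t - z) ^ (γ - 1) := Real.rpow_nonneg (by linarith [hz.2]) _
  rw [Real.norm_eq_abs, abs_mul, abs_of_nonneg h2]
  exact mul_le_mul_of_nonneg_left (h z hz) h2

/-- Uniqueness for the homogeneous Volterra equation: a solution is dominated by every term of the
(convergent) Neumann series with `-|μ|`, `-|λ|` in place of `μ`, `λ`. -/
lemma PowerBdd₁.eq_zero_of_volterra {a b μ lam : ℝ} (ha : 0 < a) (hb : 0 < b) {R : ℝ → ℝ}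
    (hR : PowerBdd₁ T s C R) (hs : 0 < s)
    (h : ∀ t ∈ Ioc 0 T, R t + μ * _root_.rlInt a R t + lam * _root_.rlInt b R t = 0) {t : ℝ}
    (ht : t ∈ Ioc 0 T) : R t = 0 := by
  have hGs := Real.Gamma_pos_of_pos hs
  have hdom : ∀ n : ℕ, ∀ r ∈ Ioc 0 T,
      |R r| ≤ C * Real.Gamma s * resolventTerm a b (-|μ|) (-|lam|) n s r := by
    intro n
    induction n with
    | zero =>
      intro r hr
      refine (hR.2 r hr).trans (le_of_eq ?_)
      rw [resolventTerm, rlKer]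
      field_simp
    | succ n ih =>
      intro r hr
      obtain ⟨K, -, hK⟩ := exists_powerBdd_resolventTerm ha hb (-|μ|) (-|lam|) r hs
      have hstep : ∀ γ, 0 < γ → |_root_.rlInt γ R r| ≤
          C * Real.Gamma s * resolventTerm a b (-|μ|) (-|lam|) n (s + γ) r := fun γ hγ => by
        rw [← rlInt_resolventTerm ha hb (-|μ|) (-|lam|) hs hγ.le hr.1 n, ← rlInt_const_mul]
        refine abs_rlInt_le_rlInt hγ hr.1 (fun z hz => ih z ⟨hz.1, hz.2.trans hr.2⟩) ?_
        exact ((hK n).const_mul (C * Real.Gamma s)).intervalIntegrable_kernel hs hγ ⟨hr.1, le_rfl⟩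
      have e : R r = -(μ * _root_.rlInt a R r) - lam * _root_.rlInt b R r := by
        linarith [h r hr]
      rw [e, resolventTerm, neg_neg, neg_neg]
      refine (abs_sub _ _).trans ?_
      rw [abs_neg, abs_mul, abs_mul]
      have h1 := mul_le_mul_of_nonneg_left (hstep a ha) (abs_nonneg μ)
      have h2 := mul_le_mul_of_nonneg_left (hstep b hb) (abs_nonneg lam)
      linarith
  have hlim := ((summable_resolventTerm ha hb (-|μ|) (-|lam|) hs ht.1).tendsto_atTop_zero).const_mul
    (C * Real.Gamma s)
  rw [mul_zero] at hlim
  exact abs_nonpos_iff.1 (ge_of_tendsto' hlim fun n => hdom n t ht)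

end

/-! ### Uniqueness: the sine coefficients of a solution -/

section

variable {α₁ α₂ β₁ β₂ μ T : ℝ} {φ : ℝ → ℝ}

/-- The equation in integrated form. With `q = D^{α₁,β₁} v` one has `v = I^{α₁} q`, and the equation
becomes `q + μ I^{α₁-α₂} q - v_xx = h`, in which every term but `v_xx` is continuous up to the
lateral boundary. -/
lemma IsInverseSolution.exists_density (hα₂ : 0 < α₂) (hα : α₂ < α₁) (hα₁ : α₁ < 1)
    (hβ₁ : β₁ ∈ Icc (0 : ℝ) 1) (hβ₂ : β₂ ∈ Icc (0 : ℝ) 1) {v : ℝ → ℝ → ℝ} {h : ℝ → ℝ}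
    (hsol : IsInverseSolution α₁ α₂ β₁ β₂ μ T φ v h) :
    ∃ (q : ℝ → ℝ → ℝ) (s C : ℝ), 0 < s ∧ PowerBdd T s C q ∧
      (∀ t ∈ Ioc 0 T, ∀ x ∈ Icc (0 : ℝ) 1, v t x = rlInt α₁ (fun z => q z x) t) ∧
      ∀ t ∈ Ioo 0 T, ∀ x ∈ Ioo (0 : ℝ) 1,
        deriv (deriv (v t)) x = q t x + μ * rlInt (α₁ - α₂) (fun z => q z x) t - h x := by
  have ha : 0 < α₁ - α₂ := sub_pos.2 hα
  have hb : 0 < α₁ := hα₂.trans hα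
  obtain ⟨sv, Cv, hsv, -, hv⟩ := hsol.u_mem.exists_powerBdd
  obtain ⟨w, hwmem, hwd⟩ := hsol.int_mem
  obtain ⟨sw, Cw, hsw, -, hw⟩ := hwmem.exists_powerBdd
  set γ := (1 - β₁) * (1 - α₁) with hγ
  set η := β₁ * (1 - α₁) with hη
  have hγ0 : 0 ≤ γ := mul_nonneg (by linarith [hβ₁.2]) (by linarith)
  have hη0 : 0 ≤ η := mul_nonneg hβ₁.1 (by linarith)
  have hsum : 1 - γ = α₁ + η := by rw [hγ, hη]; ring
  obtain ⟨Cq, hq⟩ := hw.exists_rlInt hsw hη0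
  set q : ℝ → ℝ → ℝ := fun t x => rlInt η (fun z => w z x) t with hqdef
  have hsq : 0 < sw + η := by linarith
  have hvq : ∀ t ∈ Ioc 0 T, ∀ x ∈ Icc (0 : ℝ) 1, v t x = rlInt α₁ (fun z => q z x) t := by
    intro t ht x hx
    have h1 := (hv.slice hx).eq_rlInt_of_rlInt_eq hsv (hw.slice hx) hsw hγ0 (by linarith)
      (fun r hr => (hw.slice hx).eq_integral hsw (fun z hz => hwd z hz x hx)
        (hsol.init₁ x hx) hr) ht
    rw [h1, hsum, ← (hw.slice hx).rlInt_rlInt hsw hb.le hη0 ht]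
  -- the Hilfer derivative of order `α₁` is `q`
  have hD₁ : ∀ t ∈ Ioo 0 T, ∀ x ∈ Ioo (0 : ℝ) 1,
      hilferDeriv α₁ β₁ (fun s => v s x) t = q t x := by
    intro t ht x hx
    refine rlInt_congr ht.1 fun z hz => ?_
    have hz' : z ∈ Ioo 0 T := ⟨hz.1, hz.2.trans_lt ht.2⟩
    exact ((hwd z (Ioo_subset_Ioc_self hz') x (Ioo_subset_Icc_self hx)).hasDerivAt
      (Ioc_mem_nhds hz'.1 hz'.2)).deriv
  refine ⟨q, sw + η, Cq, hsq, hq, hvq, fun t ht x hx => ?_⟩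
  have hx' := Ioo_subset_Icc_self hx
  have heq : ∀ r ∈ Ioo 0 T, μ * hilferDeriv α₂ β₂ (fun s => v s x) r =
      h x + deriv (deriv (v r)) x - q r x := fun r hr => by
    rw [← hsol.eqn r hr x hx, hD₁ r hr x hx]; ring
  suffices hD₂ : μ * hilferDeriv α₂ β₂ (fun s => v s x) t =
      μ * rlInt (α₁ - α₂) (fun z => q z x) t by
    have := heq t ht
    linarith
  rcases eq_or_ne μ 0 with rfl | hμ
  · simp
  congr 1
  -- by the equation `D^{α₂,β₂} v` is continuous in time, so it is determined by its primitive
  obtain ⟨Ka, hKa⟩ := (hq.slice hx').exists_rlInt hsq ha.le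
  have hcont : ContinuousOn (hilferDeriv α₂ β₂ (fun s => v s x)) (Ioo 0 T) := by
    have h1 : ContinuousOn (fun r => (h x + deriv (deriv (v r)) x - q r x) / μ) (Ioo 0 T) := by
      refine ((continuousOn_const.add ?_).sub
        ((hq.slice hx').1.mono Ioo_subset_Ioc_self)).div_const _
      exact hsol.uxx_cont.comp (f := fun r : ℝ => (r, x)) (by fun_prop) fun r hr => ⟨hr, hx⟩
    refine h1.congr fun r hr => ?_
    simp only
    rw [← heq r hr, mul_div_cancel_left₀ _ hμ]
  have hprim := fun r (hr : r ∈ Ioo 0 T) => integral_hilferDeriv_eq (β := β₂) hα₂ hα hα₁ hβ₂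
    (hq.slice hx') hsq (fun z hz => hvq z hz x hx') (hsol.hilfer₂ x hx) (hsol.init₂ x hx') hr
  exact eqOn_of_integral_eq hcont (hKa.1.mono Ioo_subset_Ioc_self) (fun r hr => (hprim r hr).1)
    (fun r hr => hKa.intervalIntegrable (by linarith) (Ioo_subset_Ioc_self hr))
    (fun r hr => (hprim r hr).2) ht

/-- The sine coefficients of any solution evolve by the resolvent: testing the integrated equation
with a sine gives a scalar Volterra equation, whose solution is unique. -/
theorem IsInverseSolution.sineCoeff_eq (hα₂ : 0 < α₂) (hα : α₂ < α₁) (hα₁ : α₁ < 1)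
    (hβ₁ : β₁ ∈ Icc (0 : ℝ) 1) (hβ₂ : β₂ ∈ Icc (0 : ℝ) 1) {v : ℝ → ℝ → ℝ} {h : ℝ → ℝ}
    (hsol : IsInverseSolution α₁ α₂ β₁ β₂ μ T φ v h) {k : ℕ} (hk : k ≠ 0) {t : ℝ}
    (ht : t ∈ Ioc 0 T) : sineCoeff (v t) k = sineCoeff h k * modeFun α₁ α₂ μ k t := by
  have ha : 0 < α₁ - α₂ := sub_pos.2 hα
  have hb : 0 < α₁ := hα₂.trans hα
  obtain ⟨q, s, C, hs, hq, hvq, heq⟩ := hsol.exists_density hα₂ hα hα₁ hβ₁ hβ₂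
  obtain ⟨sv, Cv, hsv, -, hv⟩ := hsol.u_mem.exists_powerBdd
  obtain ⟨Ca, hqa⟩ := hq.exists_rlInt hs ha.le
  set lam := ((k : ℝ) * Real.pi) ^ 2 with hlam
  set S : ℝ → ℝ := fun x => Real.sin (k * Real.pi * x) with hS
  have hSc : Continuous S := by fun_prop
  have hS1 : ∀ x, |S x| ≤ 1 := fun x => Real.abs_sin_le_one _
  set Q : ℝ → ℝ := fun r => ∫ x in (0 : ℝ)..1, q r x * S x with hQdef
  have hQ : PowerBdd₁ T s C Q := hq.integral_mul hSc hS1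
  set c := ∫ x in (0 : ℝ)..1, h x * S x with hc
  have hslice : ∀ {f : ℝ → ℝ → ℝ} {s C : ℝ}, PowerBdd T s C f → ∀ r ∈ Ioc 0 T,
      ContinuousOn (fun x => f r x) (Icc 0 1) := fun hf r hr =>
    hf.1.comp (f := fun x : ℝ => (r, x)) (by fun_prop) fun x hx => ⟨hr, hx⟩
  have hvS : ∀ r ∈ Ioc 0 T, ∫ x in (0 : ℝ)..1, v r x * S x = rlInt α₁ Q r := fun r hr => by
    rw [← hq.integral_rlInt_mul hs hb hSc hS1 hr]
    refine intervalIntegral.integral_congr fun x hx => ?_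
    rw [uIcc_of_le zero_le_one] at hx
    simp only [hvq r hr x hx]
  -- the scalar Volterra equation
  have hvolt : ∀ r ∈ Ioo 0 T, Q r + μ * rlInt (α₁ - α₂) Q r + lam * rlInt α₁ Q r = c := by
    intro r hr
    have hr' := Ioo_subset_Ioc_self hr
    have hrc : ContinuousOn (fun x => q r x + μ * rlInt (α₁ - α₂) (fun z => q z x) r - h x)
        (Icc 0 1) :=
      ((hslice hq r hr').add (continuousOn_const.mul (hslice hqa r hr'))).sub hsol.g_cont
    have hG := integral_mul_sin_of_deriv_deriv hk (hslice hv r hr') (hsol.u_contDiff r hr)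
      (hsol.bdry r ⟨hr.1.le, hr.2.le⟩).1 (hsol.bdry r ⟨hr.1.le, hr.2.le⟩).2 hrc
      (fun x hx => heq r hr x hx)
    have hi : ∀ {f : ℝ → ℝ}, ContinuousOn f (Icc 0 1) →
        IntervalIntegrable (fun x => f x * S x) volume 0 1 := fun hf =>
      (hf.mul hSc.continuousOn).intervalIntegrable_of_Icc zero_le_one
    have e : ∫ x in (0 : ℝ)..1, (q r x + μ * rlInt (α₁ - α₂) (fun z => q z x) r - h x) * S x =
        Q r + μ * rlInt (α₁ - α₂) Q r - c := by
      rw [← hq.integral_rlInt_mul hs ha hSc hS1 hr', ← intervalIntegral.integral_const_mul,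
        hc, hQdef, ← intervalIntegral.integral_add (hi (hslice hq r hr'))
          ((hi (hslice hqa r hr')).const_mul μ), ← intervalIntegral.integral_sub
          ((hi (hslice hq r hr')).add ((hi (hslice hqa r hr')).const_mul μ)) (hi hsol.g_cont)]
      exact intervalIntegral.integral_congr fun x _ => by ring
    rw [e, hvS r hr'] at hG
    rw [hlam]
    linarith
  -- comparison with the resolvent `F_1`
  set F := resolventFun (α₁ - α₂) α₁ μ lam 1 with hF
  have hQF : ∀ r ∈ Ioo 0 T, Q r = c * F r := by
    intro r hr
    have hrT : r ≤ T := hr.2.le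
    obtain ⟨K, hK⟩ := exists_powerBdd_resolventFun ha hb μ lam r one_pos
    have hQr := hQ.mono hrT
    have hC0 : 0 ≤ C := by
      have h1 := (abs_nonneg _).trans (hQr.2 r ⟨hr.1, le_rfl⟩)
      exact nonneg_of_mul_nonneg_left h1 (Real.rpow_pos_of_pos hr.1 _)
    have hK0 : 0 ≤ K := by
      have h1 := (abs_nonneg _).trans (hK.2 r ⟨hr.1, le_rfl⟩)
      exact nonneg_of_mul_nonneg_left h1 (Real.rpow_pos_of_pos hr.1 _)
    have hm : 0 < min s 1 := lt_min hs one_pos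
    have hR := (hQr.of_le (min_le_left s 1) hC0).sub
      ((hK.of_le (min_le_right s 1) hK0).const_mul c)
    have hzero := hR.eq_zero_of_volterra ha hb hm (μ := μ) (lam := lam) (fun z hz => by
      have hz' : z ∈ Ioo 0 T := ⟨hz.1, hz.2.trans_lt hr.2⟩
      have hlin : ∀ γ, 0 ≤ γ → rlInt γ (fun y => Q y - c * F y) z =
          rlInt γ Q z - c * resolventFun (α₁ - α₂) α₁ μ lam (1 + γ) z := fun γ hγ => by
        have h1 := hQr.rlInt_add_mul hK hs one_pos hγ 1 (-c) hz
        rw [rlInt_resolventFun ha hb μ lam one_pos hγ hz.1] at h1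
        rw [show (fun y => Q y - c * F y) = fun y => 1 * Q y + -c * F y by funext y; ring, h1]
        ring
      rw [hlin _ ha.le, hlin _ hb.le]
      have h2 := hvolt z hz'
      have h3 := resolventFun_eq ha hb μ lam one_pos hz.1
      rw [rlKer_one] at h3
      linear_combination h2 - c * h3) ⟨hr.1, le_rfl⟩
    linarith
  have hfin : ∫ x in (0 : ℝ)..1, v t x * S x = c * modeFun α₁ α₂ μ k t := by
    rw [hvS t ht, modeFun_eq_resolventFun μ k hb hα ht.1.le, ← hlam, add_comm α₁ 1,
      ← rlInt_resolventFun ha hb μ lam one_pos hb.le ht.1, ← rlInt_const_mul]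
    exact rlInt_congr_Ioo ht.1 hb.ne' fun z hz => hQF z ⟨hz.1, hz.2.trans_le ht.2⟩
  rw [sineCoeff, sineCoeff, hfin]
  ring

end

/-! ### Existence: summation of the modes -/

section

variable {α₁ α₂ β μ T ρ γ : ℝ} {c : ℕ → ℝ}

lemma PowerBdd.memCNegOne {s C : ℝ} {f : ℝ → ℝ → ℝ} (hf : PowerBdd T s C f) (hs : 0 < s) :
    MemCNegOne T f := by
  refine ⟨s / 2 - 1, by linarith, fun t x => if t = 0 then 0 else t ^ (1 - s / 2) * f t x, ?_,
    fun t ht x hx => ?_⟩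
  · rintro ⟨t, x⟩ ⟨ht, hx⟩
    rcases ht.1.eq_or_lt with h0 | h0
    · have h0' : t = 0 := h0.symm
      subst h0'
      have hlim : Tendsto (fun q : ℝ × ℝ => |C| * q.1 ^ (s / 2))
          (𝓝[Icc 0 T ×ˢ Icc 0 1] ((0 : ℝ), x)) (𝓝 0) := by
        have h1 : Continuous fun q : ℝ × ℝ => |C| * q.1 ^ (s / 2) :=
          continuous_const.mul (continuous_fst.rpow_const fun _ => Or.inr (by linarith))
        have h2 := (h1.tendsto ((0 : ℝ), x)).mono_left
          (nhdsWithin_le_nhds (s := Icc 0 T ×ˢ Icc (0 : ℝ) 1))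
        simpa [Real.zero_rpow (show s / 2 ≠ 0 by linarith)] using h2
      rw [ContinuousWithinAt]
      simp only [if_true]
      refine squeeze_zero_norm' ?_ hlim
      filter_upwards [self_mem_nhdsWithin] with q hq
      rcases hq.1.1.eq_or_lt with h | h
      · rw [if_pos h.symm, norm_zero]
        exact mul_nonneg (abs_nonneg _) (Real.rpow_nonneg hq.1.1 _)
      · rw [if_neg h.ne', Real.norm_eq_abs, abs_mul, abs_of_nonneg (Real.rpow_nonneg h.le _)]
        have h1 := hf.2 q.1 ⟨h, hq.1.2⟩ q.2 hq.2
        have e : q.1 ^ (s / 2) = q.1 ^ (1 - s / 2) * q.1 ^ (s - 1) := by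
          rw [← Real.rpow_add h]; ring_nf
        rw [e, mul_left_comm]
        refine mul_le_mul_of_nonneg_left (h1.trans ?_) (Real.rpow_nonneg h.le _)
        exact mul_le_mul_of_nonneg_right (le_abs_self C) (Real.rpow_nonneg h.le _)
    · have h1 : ContinuousOn (fun q : ℝ × ℝ => q.1 ^ (1 - s / 2) * f q.1 q.2)
          (Ioc 0 T ×ˢ Icc 0 1) :=
        (continuousOn_fst.rpow_const fun q hq => Or.inl (ne_of_gt hq.1.1)).mul hf.1
      have h2 : Ioi (0 : ℝ) ×ˢ (univ : Set ℝ) ∈ 𝓝 (t, x) :=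
        prod_mem_nhds (Ioi_mem_nhds h0) univ_mem
      have h3 := h1 (t, x) ⟨⟨h0, ht.2⟩, hx⟩
      rw [← continuousWithinAt_inter h2]
      refine ContinuousWithinAt.congr (h3.mono ?_) (fun q hq => if_neg (ne_of_gt hq.2.1))
        (if_neg h0.ne')
      rintro q ⟨⟨hq1, hq2⟩, hq3, -⟩
      exact ⟨⟨hq3, hq1.2⟩, hq2⟩
  · simp only [if_neg ht.1.ne']
    rw [← mul_assoc, ← Real.rpow_add ht.1]
    simp

/-- The members of index at least `α₁` satisfy their natural power bounds uniformly in `λ ≥ 0`. -/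
lemma exists_powerBdd_uniform (hα₂ : 0 < α₂) (hα : α₂ < α₁) (hα₁ : α₁ < 1) (μ : ℝ) (hT : 0 < T)
    (hρ : α₁ ≤ ρ) :
    ∃ K, ∀ lam, 0 ≤ lam → PowerBdd₁ T ρ K (resolventFun (α₁ - α₂) α₁ μ lam ρ) := by
  have ha : 0 < α₁ - α₂ := sub_pos.2 hα
  have hb : 0 < α₁ := hα₂.trans hα
  obtain ⟨K, -, h⟩ := exists_uniform_bound hα₂ hα hα₁ μ hT
  have h0 : ∀ lam, 0 ≤ lam → PowerBdd₁ T α₁ K (resolventFun (α₁ - α₂) α₁ μ lam α₁) := fun lam hl =>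
    ⟨fun t ht =>
      (differentiableAt_resolventFun ha hb μ lam hb ht.1).continuousAt.continuousWithinAt,
      fun t ht => (h lam hl t ht).2⟩
  rcases hρ.eq_or_lt with rfl | hρ
  · exact ⟨K, h0⟩
  · refine ⟨K * Real.Gamma α₁ / Real.Gamma ρ, fun lam hl => ?_⟩
    have h1 := (h0 lam hl).rlInt hb (sub_pos.2 hρ)
    rw [add_sub_cancel] at h1
    refine h1.congr fun t ht => ?_
    rw [rlInt_resolventFun ha hb μ lam hb (by linarith) ht.1, add_sub_cancel]

/-- Superposition of modes `c_k sin(kπx) F_ρ(t)` with `λ = (kπ)²`, `k ≥ 1`. -/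
noncomputable def resolventSeries (α₁ α₂ μ : ℝ) (c : ℕ → ℝ) (ρ t x : ℝ) : ℝ :=
  ∑' k : ℕ, c k * Real.sin ((k + 1 : ℕ) * Real.pi * x) *
    resolventFun (α₁ - α₂) α₁ μ (((k + 1 : ℕ) * Real.pi) ^ 2) ρ t

lemma exists_powerBdd_modes (hα₂ : 0 < α₂) (hα : α₂ < α₁) (hα₁ : α₁ < 1)
    (hc : Summable fun k => |c k|) (hT : 0 < T) (hρ : α₁ ≤ ρ) :
    ∃ M : ℕ → ℝ, Summable M ∧ ∀ k : ℕ, PowerBdd T ρ (M k)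
      (fun t x => c k * Real.sin ((k + 1 : ℕ) * Real.pi * x) *
        resolventFun (α₁ - α₂) α₁ μ (((k + 1 : ℕ) * Real.pi) ^ 2) ρ t) := by
  obtain ⟨K, hK⟩ := exists_powerBdd_uniform hα₂ hα hα₁ μ hT hρ
  refine ⟨fun k => |c k| * K, hc.mul_right K, fun k => ?_⟩
  have h := (hK (((k + 1 : ℕ) * Real.pi) ^ 2) (sq_nonneg _)).const
  refine ⟨ContinuousOn.mul ?_ h.1, fun t ht x hx => ?_⟩
  · exact Continuous.continuousOn (by fun_prop)
  · rw [abs_mul, abs_mul, mul_assoc |c k| K]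
    have h1 := h.2 t ht x hx
    have h2 := Real.abs_sin_le_one ((k + 1 : ℕ) * Real.pi * x)
    calc |c k| * |Real.sin ((k + 1 : ℕ) * Real.pi * x)| * _
        ≤ |c k| * 1 * (K * t ^ (ρ - 1)) := by
          refine mul_le_mul ?_ h1 (abs_nonneg _) (by positivity)
          gcongr
      _ = _ := by ring

lemma exists_powerBdd_resolventSeries (hα₂ : 0 < α₂) (hα : α₂ < α₁) (hα₁ : α₁ < 1)
    (hc : Summable fun k => |c k|) (hT : 0 < T) (hρ : α₁ ≤ ρ) :
    ∃ M, PowerBdd T ρ M (resolventSeries α₁ α₂ μ c ρ) := by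
  obtain ⟨M, hM, h⟩ := exists_powerBdd_modes (μ := μ) hα₂ hα hα₁ hc hT hρ
  exact ⟨_, PowerBdd.tsum h hM⟩

lemma hasSum_resolventSeries (hα₂ : 0 < α₂) (hα : α₂ < α₁) (hα₁ : α₁ < 1)
    (hc : Summable fun k => |c k|) (hρ : α₁ ≤ ρ) {t x : ℝ} (ht : 0 < t)
    (hx : x ∈ Icc (0 : ℝ) 1) :
    HasSum (fun k : ℕ => c k * Real.sin ((k + 1 : ℕ) * Real.pi * x) *
      resolventFun (α₁ - α₂) α₁ μ (((k + 1 : ℕ) * Real.pi) ^ 2) ρ t)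
      (resolventSeries α₁ α₂ μ c ρ t x) := by
  obtain ⟨M, hM, h⟩ := exists_powerBdd_modes (μ := μ) hα₂ hα hα₁ hc ht hρ
  exact (PowerBdd₁.summable (fun k => (h k).slice hx) hM ⟨ht, le_rfl⟩).hasSum

/-- Fractional integration shifts the index of the superposed modes. -/
lemma rlInt_resolventSeries (hα₂ : 0 < α₂) (hα : α₂ < α₁) (hα₁ : α₁ < 1)
    (hc : Summable fun k => |c k|) (hρ : α₁ ≤ ρ) (hγ : 0 ≤ γ) {t x : ℝ} (ht : 0 < t)
    (hx : x ∈ Icc (0 : ℝ) 1) :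
    rlInt γ (fun z => resolventSeries α₁ α₂ μ c ρ z x) t =
      resolventSeries α₁ α₂ μ c (ρ + γ) t x := by
  have ha : 0 < α₁ - α₂ := sub_pos.2 hα
  have hb : 0 < α₁ := hα₂.trans hα
  obtain ⟨M, hM, h⟩ := exists_powerBdd_modes (μ := μ) hα₂ hα hα₁ hc ht hρ
  have h1 := PowerBdd₁.hasSum_rlInt (fun k => (h k).slice hx) hM (hb.trans_le hρ) hγ ⟨ht, le_rfl⟩
  simp_rw [rlInt_const_mul, rlInt_resolventFun ha hb μ _ (hb.trans_le hρ) hγ ht] at h1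
  exact h1.tsum_eq.symm

lemma hasDerivAt_resolventSeries (hα₂ : 0 < α₂) (hα : α₂ < α₁) (hα₁ : α₁ < 1)
    (hc : Summable fun k => |c k|) (hρ : α₁ ≤ ρ) {t x : ℝ} (ht : 0 < t)
    (hx : x ∈ Icc (0 : ℝ) 1) :
    HasDerivAt (fun z => resolventSeries α₁ α₂ μ c (ρ + 1) z x)
      (resolventSeries α₁ α₂ μ c ρ t x) t := by
  obtain ⟨M, hM⟩ := exists_powerBdd_resolventSeries (μ := μ) (T := t + 1) hα₂ hα hα₁ hc
    (by linarith) hρ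
  refine ((hM.slice hx).hasDerivAt_integral ((hα₂.trans hα).trans_le hρ) (t := t)
    ⟨ht, by linarith⟩).congr_of_eventuallyEq ?_
  filter_upwards [Ioi_mem_nhds ht] with r hr
  rw [← rlInt_one, rlInt_resolventSeries hα₂ hα hα₁ hc hρ zero_le_one hr hx]

/-- The inner fractional integral of the Hilfer derivative of the superposition. -/
lemma hasDerivAt_rlInt_resolventSeries (hα₂ : 0 < α₂) (hα : α₂ < α₁) (hα₁ : α₁ < 1)
    (hc : Summable fun k => |c k|) (hγ : 0 ≤ γ) {t x : ℝ} (ht : 0 < t) (hx : x ∈ Icc (0 : ℝ) 1) :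
    HasDerivAt (rlInt γ (fun z => resolventSeries α₁ α₂ μ c (α₁ + 1) z x))
      (resolventSeries α₁ α₂ μ c (α₁ + γ) t x) t := by
  refine (hasDerivAt_resolventSeries (μ := μ) hα₂ hα hα₁ hc (show α₁ ≤ α₁ + γ by linarith)
    ht hx).congr_of_eventuallyEq ?_
  filter_upwards [Ioi_mem_nhds ht] with r hr
  rw [rlInt_resolventSeries hα₂ hα hα₁ hc (by linarith) hγ hr hx, add_right_comm]

/-- Whatever the type `β`, the Hilfer derivative of the superposition exists and shifts the
index. -/
lemma hilferDeriv_resolventSeries (hα₂ : 0 < α₂) (hα : α₂ < α₁) (hα₁ : α₁ < 1)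
    (hc : Summable fun k => |c k|) {α : ℝ} (hα' : α < 1) (hβ : β ∈ Icc (0 : ℝ) 1) {x : ℝ}
    (hx : x ∈ Icc (0 : ℝ) 1) :
    HilferExists α β T (fun z => resolventSeries α₁ α₂ μ c (α₁ + 1) z x) ∧
    ∀ t, 0 < t → hilferDeriv α β (fun z => resolventSeries α₁ α₂ μ c (α₁ + 1) z x) t =
      resolventSeries α₁ α₂ μ c (α₁ + (1 - α)) t x := by
  have hb : 0 < α₁ := hα₂.trans hα
  have hγ0 : 0 ≤ (1 - β) * (1 - α) := mul_nonneg (by linarith [hβ.2]) (by linarith)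
  have hη0 : 0 ≤ β * (1 - α) := mul_nonneg hβ.1 (by linarith)
  have hd := fun t (ht : 0 < t) =>
    hasDerivAt_rlInt_resolventSeries (μ := μ) hα₂ hα hα₁ hc hγ0 ht hx
  constructor
  · intro t ht
    obtain ⟨M, hM⟩ := exists_powerBdd_resolventSeries (μ := μ) (T := t) hα₂ hα hα₁ hc
      ht.1 (show α₁ ≤ α₁ + (1 - β) * (1 - α) by linarith)
    have hpb := (hM.slice hx).congr (fun z hz => (hd z hz.1).deriv)
    refine ⟨(hd t ht.1).differentiableAt,
      hpb.intervalIntegrable (by linarith) ⟨ht.1, le_rfl⟩, ?_⟩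
    rcases hη0.eq_or_lt with h | h
    · exact Or.inl h.symm
    · exact Or.inr (hpb.intervalIntegrable_kernel (by linarith) h ⟨ht.1, le_rfl⟩)
  · intro t ht
    rw [hilferDeriv, rlInt_congr ht (fun z hz => (hd z hz.1).deriv),
      rlInt_resolventSeries hα₂ hα hα₁ hc (by linarith) hη0 ht hx]
    congr 1
    ring

/-! ### Regularity in space -/

lemma hasDerivAt_sin_mul (ω x : ℝ) :
    HasDerivAt (fun x => Real.sin (ω * x)) (Real.cos (ω * x) * ω) x := by
  have := (Real.hasDerivAt_sin (ω * x)).comp x ((hasDerivAt_id x).const_mul ω)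
  exact HasDerivAt.congr_deriv (f := fun x => Real.sin (ω * x)) this (by ring)

lemma hasDerivAt_cos_mul (ω x : ℝ) :
    HasDerivAt (fun x => Real.cos (ω * x)) (-Real.sin (ω * x) * ω) x := by
  have := (Real.hasDerivAt_cos (ω * x)).comp x ((hasDerivAt_id x).const_mul ω)
  exact HasDerivAt.congr_deriv (f := fun x => Real.cos (ω * x)) this (by ring)

/-- A sine series whose coefficients are summable against the squared frequencies is `C²`, and is
differentiated termwise. -/
lemma contDiff_two_sineSeries {d ω : ℕ → ℝ} (hω : ∀ k, 1 ≤ ω k)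
    (hd : Summable fun k => |d k| * ω k ^ 2) :
    ContDiff ℝ 2 (fun x => ∑' k, d k * Real.sin (ω k * x)) ∧
    ∀ x, deriv (deriv fun x => ∑' k, d k * Real.sin (ω k * x)) x =
      ∑' k, -(d k * ω k ^ 2 * Real.sin (ω k * x)) := by
  have hd1 : Summable fun k => |d k| * ω k := by
    refine Summable.of_nonneg_of_le (fun k => mul_nonneg (abs_nonneg _) (by linarith [hω k]))
      (fun k => ?_) hd
    refine mul_le_mul_of_nonneg_left ?_ (abs_nonneg _)
    nlinarith [hω k]
  have h1 : ∀ x, HasDerivAt (fun x => ∑' k, d k * Real.sin (ω k * x))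
      (∑' k, d k * (Real.cos (ω k * x) * ω k)) x := fun x => by
    refine hasDerivAt_tsum hd1 (fun k y => (hasDerivAt_sin_mul (ω k) y).const_mul (d k))
      (fun k y => ?_) (y₀ := 0) (by simp) x
    rw [Real.norm_eq_abs, abs_mul, abs_mul, abs_of_pos (show 0 < ω k by linarith [hω k])]
    have := Real.abs_cos_le_one (ω k * y)
    have := hω k
    refine mul_le_mul_of_nonneg_left ?_ (abs_nonneg _)
    nlinarith
  have hb2 : ∀ k y, ‖d k * (-Real.sin (ω k * y) * ω k * ω k)‖ ≤ |d k| * ω k ^ 2 := fun k y => by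
    rw [Real.norm_eq_abs, abs_mul, abs_mul, abs_mul, abs_neg,
      abs_of_pos (show 0 < ω k by linarith [hω k])]
    have := Real.abs_sin_le_one (ω k * y)
    have := hω k
    refine mul_le_mul_of_nonneg_left ?_ (abs_nonneg _)
    rw [mul_assoc, ← sq]
    nlinarith [sq_nonneg (ω k)]
  have h2 : ∀ x, HasDerivAt (fun x => ∑' k, d k * (Real.cos (ω k * x) * ω k))
      (∑' k, d k * (-Real.sin (ω k * x) * ω k * ω k)) x := fun x => by
    refine hasDerivAt_tsum hd (fun k y => ((hasDerivAt_cos_mul (ω k) y).mul_const (ω k)).const_mul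
      (d k)) hb2 (y₀ := 0) ?_ x
    refine Summable.of_norm (hd1.congr fun k => ?_)
    rw [Real.norm_eq_abs, abs_mul, mul_zero, Real.cos_zero, one_mul,
      abs_of_pos (show 0 < ω k by linarith [hω k])]
  have hderiv : deriv (fun x => ∑' k, d k * Real.sin (ω k * x)) =
      fun x => ∑' k, d k * (Real.cos (ω k * x) * ω k) := funext fun x => (h1 x).deriv
  have hderiv2 : deriv (fun x => ∑' k, d k * (Real.cos (ω k * x) * ω k)) =
      fun x => ∑' k, d k * (-Real.sin (ω k * x) * ω k * ω k) := funext fun x => (h2 x).deriv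
  constructor
  · rw [show (2 : WithTop ℕ∞) = 1 + 1 by norm_num, contDiff_succ_iff_deriv]
    refine ⟨fun x => (h1 x).differentiableAt, by simp, ?_⟩
    rw [hderiv, contDiff_one_iff_deriv, hderiv2]
    exact ⟨fun x => (h2 x).differentiableAt,
      continuous_tsum (fun k => by fun_prop) hd hb2⟩
  · intro x
    rw [hderiv, hderiv2]
    exact tsum_congr fun k => by ring

end

/-! ### Existence and uniqueness for the inverse problem -/

section

variable {α₁ α₂ β₁ β₂ μ T : ℝ} {φ : ℝ → ℝ} {c : ℕ → ℝ}

lemma one_le_freq (k : ℕ) : 1 ≤ ((k + 1 : ℕ) : ℝ) * Real.pi := by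
  have h1 : (1 : ℝ) ≤ (k + 1 : ℕ) := by exact_mod_cast Nat.le_add_left 1 k
  nlinarith [Real.pi_gt_three]

/-- The modes at the final time decay no faster than `1 / (kπ)²`: for large frequencies by
`exists_lower_bound`, and the finitely many others do not vanish. -/
lemma exists_one_le_mul_modeFun (hα₂ : 0 < α₂) (hα : α₂ < α₁) (hα₁ : α₁ < 1) (hT : 0 < T)
    (hne : ∀ k : ℕ, 1 ≤ k → modeFun α₁ α₂ μ k T ≠ 0) :
    ∃ A, ∀ k : ℕ, 1 ≤ A * ((((k + 1 : ℕ) : ℝ) * Real.pi) ^ 2 * |modeFun α₁ α₂ μ (k + 1) T|) := by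
  have hb : 0 < α₁ := hα₂.trans hα
  obtain ⟨Λ, hΛ⟩ := exists_lower_bound hα₂ hα hα₁ μ hT
  obtain ⟨N, hN⟩ := exists_nat_ge Λ
  set a : ℕ → ℝ := fun k => (((k + 1 : ℕ) : ℝ) * Real.pi) ^ 2 * |modeFun α₁ α₂ μ (k + 1) T| with ha
  have hpos : ∀ k, 0 < a k := fun k =>
    mul_pos (by have := one_le_freq k; positivity) (abs_pos.2 (hne (k + 1) (Nat.le_add_left 1 k)))
  have hsum : 0 ≤ ∑ k ∈ Finset.range N, (a k)⁻¹ :=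
    Finset.sum_nonneg fun k _ => (inv_pos.2 (hpos k)).le
  refine ⟨2 + ∑ k ∈ Finset.range N, (a k)⁻¹, fun k => ?_⟩
  change 1 ≤ _ * a k
  rcases lt_or_ge k N with hk | hk
  · have h1 := Finset.single_le_sum (f := fun k => (a k)⁻¹) (fun k _ => (inv_pos.2 (hpos k)).le)
      (Finset.mem_range.2 hk)
    calc (1 : ℝ) = (a k)⁻¹ * a k := (inv_mul_cancel₀ (hpos k).ne').symm
      _ ≤ _ := mul_le_mul_of_nonneg_right (by linarith) (hpos k).le
  · have hlam : Λ ≤ (((k + 1 : ℕ) : ℝ) * Real.pi) ^ 2 := by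
      have h1 : (N : ℝ) ≤ ((k + 1 : ℕ) : ℝ) := by exact_mod_cast hk.trans (Nat.le_succ k)
      have h2 := one_le_freq k
      have h3 : ((k + 1 : ℕ) : ℝ) ≤ ((k + 1 : ℕ) : ℝ) * Real.pi :=
        le_mul_of_one_le_right (Nat.cast_nonneg _) (by linarith [Real.pi_gt_three])
      nlinarith
    have h1 : 1 / 2 ≤ a k := by
      refine (hΛ _ hlam).trans ?_
      simp only [ha, modeFun_eq_resolventFun μ (k + 1) hb hα hT.le]
      exact mul_le_mul_of_nonneg_left (le_abs_self _) (sq_nonneg _)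
    nlinarith [hpos k]

/-- Termwise second space derivative of the superposition. -/
lemma resolventSeries_space (hα₂ : 0 < α₂) (hα : α₂ < α₁) (hα₁ : α₁ < 1)
    (hc : Summable fun k => |c k|) {t : ℝ} (ht : 0 < t) :
    ContDiff ℝ 2 (resolventSeries α₁ α₂ μ c (α₁ + 1) t) ∧
    ∀ x, deriv (deriv (resolventSeries α₁ α₂ μ c (α₁ + 1) t)) x =
      ∑' k : ℕ, -(c k * Real.sin ((k + 1 : ℕ) * Real.pi * x) *
        ((((k + 1 : ℕ) * Real.pi) ^ 2) *
          resolventFun (α₁ - α₂) α₁ μ (((k + 1 : ℕ) * Real.pi) ^ 2) (α₁ + 1) t)) := by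
  obtain ⟨K, -, hK⟩ := exists_uniform_bound hα₂ hα hα₁ μ ht
  set F : ℕ → ℝ := fun k =>
    resolventFun (α₁ - α₂) α₁ μ (((k + 1 : ℕ) * Real.pi) ^ 2) (α₁ + 1) t with hF
  have hd : Summable fun k => |c k * F k| * (((k + 1 : ℕ) : ℝ) * Real.pi) ^ 2 := by
    refine Summable.of_nonneg_of_le (fun k => by positivity) (fun k => ?_) (hc.mul_right K)
    rw [abs_mul, mul_assoc, mul_comm |F k|]
    exact mul_le_mul_of_nonneg_left (hK _ (sq_nonneg _) t ⟨ht, le_rfl⟩).1 (abs_nonneg _)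
  have e : resolventSeries α₁ α₂ μ c (α₁ + 1) t =
      fun x => ∑' k : ℕ, c k * F k * Real.sin ((k + 1 : ℕ) * Real.pi * x) := by
    funext x
    exact tsum_congr fun k => by rw [hF]; ring
  obtain ⟨h1, h2⟩ := contDiff_two_sineSeries one_le_freq hd
  rw [e]
  refine ⟨h1, fun x => (h2 x).trans (tsum_congr fun k => by ring)⟩

/-- The superposition of the modes solves the problem for the final data that it attains. -/
theorem isInverseSolution_resolventSeries (hT : 0 < T) (hα₂ : 0 < α₂) (hα : α₂ < α₁) (hα₁ : α₁ < 1)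
    (hβ₁ : β₁ ∈ Icc (0 : ℝ) 1) (hβ₂ : β₂ ∈ Icc (0 : ℝ) 1) (hc : Summable fun k => |c k|)
    (hfin : ∀ x ∈ Icc (0 : ℝ) 1, resolventSeries α₁ α₂ μ c (α₁ + 1) T x = φ x) :
    IsInverseSolution α₁ α₂ β₁ β₂ μ T φ (resolventSeries α₁ α₂ μ c (α₁ + 1))
      (fun x => ∑' k : ℕ, c k * Real.sin ((k + 1 : ℕ) * Real.pi * x)) := by
  have ha : 0 < α₁ - α₂ := sub_pos.2 hα
  have hb : 0 < α₁ := hα₂.trans hα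
  have hγ : ∀ {β α : ℝ}, β ∈ Icc (0 : ℝ) 1 → α < 1 → 0 ≤ (1 - β) * (1 - α) := fun hβ h =>
    mul_nonneg (by linarith [hβ.2]) (by linarith)
  have hinit : ∀ {γ x : ℝ}, 0 ≤ γ → x ∈ Icc (0 : ℝ) 1 → Tendsto
      (rlInt γ (fun s => resolventSeries α₁ α₂ μ c (α₁ + 1) s x)) (𝓝[>] 0) (𝓝 0) := by
    intro γ x hγ hx
    obtain ⟨M, hM⟩ := exists_powerBdd_resolventSeries (μ := μ) hα₂ hα hα₁ hc hT
      (show α₁ ≤ α₁ + 1 + γ by linarith)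
    refine ((hM.slice hx).tendsto_zero hT (by linarith)).congr' ?_
    filter_upwards [self_mem_nhdsWithin] with t ht
    exact (rlInt_resolventSeries hα₂ hα hα₁ hc (by linarith) hγ ht hx).symm
  have hsin : ∀ (k : ℕ) (x : ℝ), ‖c k * Real.sin ((k + 1 : ℕ) * Real.pi * x)‖ ≤ |c k| :=
      fun k x => by
    rw [Real.norm_eq_abs, abs_mul]
    exact mul_le_of_le_one_right (abs_nonneg _) (Real.abs_sin_le_one _)
  constructor
  · obtain ⟨M, hM⟩ := exists_powerBdd_resolventSeries (μ := μ) hα₂ hα hα₁ hc hT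
      (show α₁ ≤ α₁ + 1 by linarith)
    exact hM.memCNegOne (by linarith)
  · have h0 := hγ hβ₁ hα₁
    obtain ⟨M, hM⟩ := exists_powerBdd_resolventSeries (μ := μ) hα₂ hα hα₁ hc hT
      (show α₁ ≤ α₁ + (1 - β₁) * (1 - α₁) by linarith)
    exact ⟨_, hM.memCNegOne (by linarith), fun t ht x hx =>
      (hasDerivAt_rlInt_resolventSeries hα₂ hα hα₁ hc h0 ht.1 hx).hasDerivWithinAt⟩
  · exact fun t ht => (resolventSeries_space hα₂ hα hα₁ hc ht.1).1.contDiffOn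
  · obtain ⟨K, -, hK⟩ := exists_uniform_bound hα₂ hα hα₁ μ hT
    refine ContinuousOn.congr ?_ fun q hq => (resolventSeries_space hα₂ hα hα₁ hc hq.1.1).2 q.2
    refine continuousOn_tsum (fun k => ?_) (hc.mul_right K) fun k q hq => ?_
    · refine (ContinuousOn.mul (Continuous.continuousOn (by fun_prop))
        (continuousOn_const.mul ?_)).neg
      exact (continuousOn_resolventFun ha hb μ _ (by linarith)).comp continuousOn_fst
        fun q hq => hq.1.1.le
    · rw [norm_neg, norm_mul]
      refine mul_le_mul (hsin k q.2) ?_ (norm_nonneg _) (abs_nonneg _)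
      rw [Real.norm_eq_abs, abs_mul, abs_of_nonneg (sq_nonneg _)]
      exact (hK _ (sq_nonneg _) q.1 (Ioo_subset_Ioc_self hq.1)).1
  · exact (continuous_tsum (fun k => by fun_prop) hc hsin).continuousOn
  · exact fun x hx => (hilferDeriv_resolventSeries hα₂ hα hα₁ hc (hα.trans hα₁) hβ₂
      (Ioo_subset_Icc_self hx)).1
  · intro t ht x hx
    have hx' := Ioo_subset_Icc_self hx
    rw [(hilferDeriv_resolventSeries (T := T) hα₂ hα hα₁ hc hα₁ hβ₁ hx').2 t ht.1,
      (hilferDeriv_resolventSeries (T := T) hα₂ hα hα₁ hc (hα.trans hα₁) hβ₂ hx').2 t ht.1,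
      (resolventSeries_space hα₂ hα hα₁ hc ht.1).2 x]
    have hS : Summable fun k : ℕ => c k * Real.sin ((k + 1 : ℕ) * Real.pi * x) *
        ((((k + 1 : ℕ) * Real.pi) ^ 2) *
          resolventFun (α₁ - α₂) α₁ μ (((k + 1 : ℕ) * Real.pi) ^ 2) (α₁ + 1) t) := by
      obtain ⟨K, -, hK⟩ := exists_uniform_bound hα₂ hα hα₁ μ hT
      refine Summable.of_norm_bounded (hc.mul_right K) fun k => ?_
      rw [norm_mul]
      refine mul_le_mul (hsin k x) ?_ (norm_nonneg _) (abs_nonneg _)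
      rw [Real.norm_eq_abs, abs_mul, abs_of_nonneg (sq_nonneg _)]
      exact (hK _ (sq_nonneg _) t (Ioo_subset_Ioc_self ht)).1
    have h1 := hasSum_resolventSeries (μ := μ) hα₂ hα hα₁ hc
      (show α₁ ≤ α₁ + (1 - α₁) by linarith) ht.1 hx'
    have h2 := hasSum_resolventSeries (μ := μ) hα₂ hα hα₁ hc
      (show α₁ ≤ α₁ + (1 - α₂) by linarith) ht.1 hx'
    refine ((h1.add (h2.mul_left μ)).sub hS.neg.hasSum).tsum_eq.symm.trans (tsum_congr fun k => ?_)
    -- the resolvent equation `F_1 + μ F_{1+α₁-α₂} + λ F_{1+α₁} = 1`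
    have h3 := resolventFun_eq ha hb μ ((((k + 1 : ℕ) : ℝ) * Real.pi) ^ 2) one_pos ht.1
    rw [rlKer_one, add_comm 1 α₁] at h3
    rw [show α₁ + (1 - α₁) = 1 by ring, show α₁ + (1 - α₂) = 1 + (α₁ - α₂) by ring, h3]
    ring
  · intro t ht
    constructor
    · simp [resolventSeries]
    · simp only [resolventSeries, mul_one, Real.sin_nat_mul_pi, mul_zero, zero_mul, tsum_zero]
  · exact fun x hx => hinit (hγ hβ₁ hα₁) hx
  · exact fun x hx => hinit (hγ hβ₂ (hα.trans hα₁)) hx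
  · exact hfin

/-- The source is determined by the state, as all other terms of the equation are. -/
lemma IsInverseSolution.source_eq (hT : 0 < T) {u v : ℝ → ℝ → ℝ} {g h : ℝ → ℝ}
    (hv : IsInverseSolution α₁ α₂ β₁ β₂ μ T φ v h) (hu : IsInverseSolution α₁ α₂ β₁ β₂ μ T φ u g)
    (huv : ∀ t ∈ Ioc 0 T, ∀ x ∈ Icc (0 : ℝ) 1, v t x = u t x) :
    ∀ x ∈ Icc (0 : ℝ) 1, h x = g x := by
  have hI : EqOn h g (Ioo 0 1) := by
    intro x hx
    have ht : T / 2 ∈ Ioo 0 T := ⟨by linarith, by linarith⟩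
    have hH : ∀ α β : ℝ, hilferDeriv α β (fun s => v s x) (T / 2) =
        hilferDeriv α β (fun s => u s x) (T / 2) := fun α β => by
      refine rlInt_congr ht.1 fun z hz => Filter.EventuallyEq.deriv_eq ?_
      filter_upwards [Ioo_mem_nhds hz.1 (hz.2.trans_lt ht.2)] with r hr
      exact rlInt_congr hr.1 fun y hy =>
        huv y ⟨hy.1, hy.2.trans hr.2.le⟩ x (Ioo_subset_Icc_self hx)
    have hxx : deriv (deriv (v (T / 2))) x = deriv (deriv (u (T / 2))) x := by
      have : v (T / 2) =ᶠ[𝓝 x] u (T / 2) := by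
        filter_upwards [Ioo_mem_nhds hx.1 hx.2] with y hy
        exact huv _ (Ioo_subset_Ioc_self ht) y (Ioo_subset_Icc_self hy)
      exact this.deriv.deriv_eq
    rw [← hv.eqn _ ht x hx, ← hu.eqn _ ht x hx, hH, hH, hxx]
  refine hI.of_subset_closure hv.g_cont hu.g_cont Ioo_subset_Icc_self ?_
  rw [closure_Ioo zero_ne_one]

theorem theorem1 (α₁ α₂ β₁ β₂ μ T : ℝ) (φ : ℝ → ℝ)
    (hT : 0 < T) (hα₂ : 0 < α₂) (hα : α₂ < α₁) (hα₁ : α₁ < 1)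
    (hβ₁ : β₁ ∈ Set.Icc (0 : ℝ) 1) (hβ₂ : β₂ ∈ Set.Icc (0 : ℝ) 1)
    (hne : ∀ k : ℕ, 1 ≤ k → modeFun α₁ α₂ μ k T ≠ 0)
    (hφ : IsAdmissibleData φ) :
    ∃ (u : ℝ → ℝ → ℝ) (g : ℝ → ℝ),
      IsInverseSolution α₁ α₂ β₁ β₂ μ T φ u g ∧
      (∀ t ∈ Set.Icc 0 T, ∀ x ∈ Set.Icc (0 : ℝ) 1,
        HasSum (fun k : ℕ => modeFun α₁ α₂ μ (k + 1) t / modeFun α₁ α₂ μ (k + 1) T *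
          sineCoeff φ (k + 1) * Real.sin ((k + 1 : ℕ) * Real.pi * x)) (u t x)) ∧
      (∀ x ∈ Set.Icc (0 : ℝ) 1,
        HasSum (fun k : ℕ => 1 / modeFun α₁ α₂ μ (k + 1) T *
          sineCoeff φ (k + 1) * Real.sin ((k + 1 : ℕ) * Real.pi * x)) (g x)) ∧
      (∀ (v : ℝ → ℝ → ℝ) (h : ℝ → ℝ), IsInverseSolution α₁ α₂ β₁ β₂ μ T φ v h →
        (∀ t ∈ Set.Ioc 0 T, ∀ x ∈ Set.Icc (0 : ℝ) 1, v t x = u t x) ∧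
        (∀ x ∈ Set.Icc (0 : ℝ) 1, h x = g x)) := by
  have hb : 0 < α₁ := hα₂.trans hα
  have hne' : ∀ k : ℕ, modeFun α₁ α₂ μ (k + 1) T ≠ 0 := fun k => hne (k + 1) (Nat.le_add_left 1 k)
  -- the coefficients of the source, which are also the amplitudes of the modes of `u`
  set c : ℕ → ℝ := fun k => 1 / modeFun α₁ α₂ μ (k + 1) T * sineCoeff φ (k + 1) with hcdef
  have hc : Summable fun k => |c k| := by
    obtain ⟨A, hA⟩ := exists_one_le_mul_modeFun hα₂ hα hα₁ hT hne
    refine Summable.of_nonneg_of_le (fun k => abs_nonneg _) (fun k => ?_)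
      (hφ.summable_sineCoeff.mul_left A)
    rw [hcdef, abs_mul, abs_div, abs_one, ← mul_assoc]
    refine mul_le_mul_of_nonneg_right ?_ (abs_nonneg _)
    rw [div_le_iff₀ (abs_pos.2 (hne' k)), mul_assoc]
    exact hA k
  have hsφ : Summable fun k : ℕ => sineCoeff φ (k + 1) := by
    refine Summable.of_norm_bounded hφ.summable_sineCoeff fun k => ?_
    exact le_mul_of_one_le_left (abs_nonneg _) (one_le_pow₀ (one_le_freq k))
  have hterm : ∀ (k : ℕ) (t x : ℝ), 0 ≤ t →
      c k * Real.sin ((k + 1 : ℕ) * Real.pi * x) *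
        resolventFun (α₁ - α₂) α₁ μ (((k + 1 : ℕ) * Real.pi) ^ 2) (α₁ + 1) t =
      modeFun α₁ α₂ μ (k + 1) t / modeFun α₁ α₂ μ (k + 1) T *
          sineCoeff φ (k + 1) * Real.sin ((k + 1 : ℕ) * Real.pi * x) := fun k t x ht => by
    rw [← modeFun_eq_resolventFun μ (k + 1) hb hα ht, hcdef]
    ring
  have hsum : ∀ t ∈ Icc 0 T, ∀ x ∈ Icc (0 : ℝ) 1,
      HasSum (fun k : ℕ => modeFun α₁ α₂ μ (k + 1) t / modeFun α₁ α₂ μ (k + 1) T *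
        sineCoeff φ (k + 1) * Real.sin ((k + 1 : ℕ) * Real.pi * x))
        (resolventSeries α₁ α₂ μ c (α₁ + 1) t x) := by
    intro t ht x hx
    simp_rw [← hterm _ t x ht.1]
    -- at `t = 0` all modes vanish
    rcases ht.1.eq_or_lt with rfl | h0
    · simp only [resolventSeries, resolventFun_apply_zero (sub_pos.2 hα) hb
        (show 1 < α₁ + 1 by linarith), mul_zero, tsum_zero]
      exact hasSum_zero
    · exact hasSum_resolventSeries hα₂ hα hα₁ hc (by linarith) h0 hx
  have hfin : ∀ x ∈ Icc (0 : ℝ) 1, resolventSeries α₁ α₂ μ c (α₁ + 1) T x = φ x := by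
    intro x hx
    refine (hsum T ⟨hT.le, le_rfl⟩ x hx).unique ?_
    simpa only [div_self (hne' _), one_mul] using
      hasSum_sineSeries hφ.contDiff.continuousOn hφ.zero_left hφ.zero_right hsφ hx
  have hsol := isInverseSolution_resolventSeries (μ := μ) hT hα₂ hα hα₁ hβ₁ hβ₂ hc hfin
  refine ⟨_, _, hsol, hsum, fun x hx => ?_, fun v h hv => ?_⟩
  · refine Summable.hasSum (Summable.of_norm_bounded hc fun k => ?_)
    rw [norm_mul]
    exact mul_le_of_le_one_right (abs_nonneg _) (Real.abs_sin_le_one _)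
  -- the sine coefficients of `v(t, ·)` are those of the series
  have hcoeff : ∀ t ∈ Ioc 0 T, ∀ k : ℕ, sineCoeff (v t) (k + 1) =
      modeFun α₁ α₂ μ (k + 1) t / modeFun α₁ α₂ μ (k + 1) T * sineCoeff φ (k + 1) := by
    intro t ht k
    have h1 := hv.sineCoeff_eq hα₂ hα hα₁ hβ₁ hβ₂ k.succ_ne_zero ht
    have h2 := hv.sineCoeff_eq hα₂ hα hα₁ hβ₁ hβ₂ k.succ_ne_zero ⟨hT, le_rfl⟩
    have h3 : sineCoeff (v T) (k + 1) = sineCoeff φ (k + 1) := by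
      unfold sineCoeff
      congr 1
      refine intervalIntegral.integral_congr fun x hx => ?_
      rw [uIcc_of_le zero_le_one] at hx
      simp only [hv.final x hx]
    rw [← h3, h2, h1]
    field_simp [hne' k]
  have hvu : ∀ t ∈ Ioc 0 T, ∀ x ∈ Icc (0 : ℝ) 1,
      v t x = resolventSeries α₁ α₂ μ c (α₁ + 1) t x := by
    intro t ht x hx
    obtain ⟨s, C, -, -, hpb⟩ := hv.u_mem.exists_powerBdd
    have hvc : ContinuousOn (v t) (Icc 0 1) :=
      hpb.1.comp (f := fun x : ℝ => (t, x)) (by fun_prop) fun x hx => ⟨ht, hx⟩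
    obtain ⟨hv0, hv1⟩ := hv.bdry t (Ioc_subset_Icc_self ht)
    have hsv : Summable fun k : ℕ => sineCoeff (v t) (k + 1) := by
      obtain ⟨K, hK0, hK⟩ := exists_uniform_bound hα₂ hα hα₁ μ hT
      refine Summable.of_norm_bounded (hc.mul_right K) fun k => ?_
      have h1 := (hK _ (sq_nonneg (((k + 1 : ℕ) : ℝ) * Real.pi)) t ht).1
      rw [← modeFun_eq_resolventFun μ (k + 1) hb hα ht.1.le] at h1
      rw [hcoeff t ht k, show modeFun α₁ α₂ μ (k + 1) t / modeFun α₁ α₂ μ (k + 1) T *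
        sineCoeff φ (k + 1) = c k * modeFun α₁ α₂ μ (k + 1) t by rw [hcdef]; ring, norm_mul]
      refine mul_le_mul_of_nonneg_left (le_trans ?_ h1) (abs_nonneg _)
      exact le_mul_of_one_le_left (abs_nonneg _) (one_le_pow₀ (one_le_freq k))
    have h1 := hasSum_sineSeries hvc hv0 hv1 hsv hx
    simp only [hcoeff t ht] at h1
    exact h1.unique (hsum t (Ioc_subset_Icc_self ht) x hx)
  exact ⟨hvu, hv.source_eq hT hsol hvu⟩

end
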